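/- Let $K$ be an algebraically closed field of any characteristic, $n\ge 2$, $\underline x=(x_1,\dots,x_n)$, and let $P\in K[\underline x]$ be non constant. **Definitions.** A *monomial* is $x_1^{e_1}\cdots x_n^{e_n}$, up to a non-zero constant factor; below $Q_1,\dots,Q_\ell,m,m_1,m_2$ always have coefficient $1$. $P$ is a *pure power* if $P=S^e$ with $S\in K[\underline x]$, $e>1$. Polynomials are *relatively prime* if they have no non-constant common divisor. A set $\{Q_1,\dots,Q_\ell\}$ of $\ell\ge 1$ distinct monomials is *admissible* for $P$ if $\deg Q_i\le\deg P$ for all $i$, no $Q_i$ is proportional to $P$, and $P,Q_1,\dots,Q_\ell$ are (jointly) relatively prime. It is a *reducibility monomial site* of $P$ if moreover $F=P+\lambda_1Q_1+\cdots+\lambda_\ell Q_\ell$ is reducible in $\overline{K(\underline\lambda)}[\underline x]$, where $\underline\lambda=(\lambda_1,\dots,\lambda_\ell)$ are independent indeterminates. For relatively prime $\phi,\psi\in K[\underline x]$ of degrees $<\deg P$, a *$(\phi,\psi)$-homogeneous decomposition of $P$ of degree $d$* is an identity $P=h(\phi,\psi)$ with $h\in K[u,v]$ homogeneous of degree $d$;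 it is *maximal* if $\phi+\lambda\psi$ is irreducible in $\overline{K(\lambda)}[\underline x]$. A $(\phi,\psi)$-homogeneous decomposition of $F$ is defined in the same way, with $\phi,\psi\in K[\underline x]$ of degrees $<\deg_{\underline x}F$ and $h\in\overline{K(\underline\lambda)}[u,v]$. $P$ is *homogeneous in two monomials* if it has an $(m_1,m_2)$-homogeneous decomposition with $m_1,m_2$ monomials. **Preliminary fact.** If $P$ is not a monomial and is homogeneous in two monomials, then it has a maximal $(m_1,m_2)$-homogeneous decomposition with $m_1,m_2$ monomials, and the pair $\{m_1,m_2\}$ is unique. **Theorem (general case).** Assume $P$ is not a monomial and not a pure power. 1. If $P$ is homogeneous in two monomials, then, given any maximal $(m_1,m_2)$-homogeneous decomposition $P=h(m_1,m_2)$ of degree $\delta$ with $m_1,m_2$ monomials, the reducibility monomial sites of $P$ are exactly the admissible sets all of whose elements are of the form $m_1^km_2^{\delta-k}$ with $0\le k\le\delta$. 2. If $P$ is not homogeneous in two monomials, then the reducibility monomial sites of $P$ are exactly the admissible singletons $\{m^d\}$ with $d\ge2$ and $m$ a monomial relatively prime to $P$ such that $P$ has a maximal $(m,\psi)$-homogeneous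 decomposition $P=h(m,\psi)$ of degree $d$ with $\psi\in K[\underline x]$ not a monomial. **Addendum 1.** Assume $P$ is a monomial and $\{Q_1,\dots,Q_\ell\}$ is admissible for $P$. Then $\{Q_1,\dots,Q_\ell\}$ is a reducibility monomial site of $P$ if and only if - (a) $\mathrm{char}\,K=p>0$ and $P,Q_1,\dots,Q_\ell\in K[x_1^p,\dots,x_n^p]$; or - (b) there are relatively prime monomials $m_1,m_2$ and an integer $d>1$ such that, up to non-zero constants, $P,Q_1,\dots,Q_\ell$ are all of the form $m_1^km_2^{d-k}$ ($0\le k\le d$), and $m_1^d$ and $m_2^d$ are among them. Furthermore, for every $(\phi,\psi)$-homogeneous decomposition of $F=P+\lambda_1Q_1+\cdots+\lambda_\ell Q_\ell$ there is $L\in\mathrm{GL}_2(K)$ such that $L(\phi,\psi)$ is a couple of monomials. **Addendum 2.** Assume $P$ is a pure power but not a monomial. Then an admissible set $\{Q_1,\dots,Q_\ell\}$ is a reducibility monomial site of $P$ if and only if at least one of the following holds: 1. $P$ has a maximal $(m_1,m_2)$-homogeneous decomposition, of some degree $\delta$, with $m_1,m_2$ monomials, and every $Q_i$ is of the form $m_1^km_2^{\delta-k}$,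 $0\le k\le\delta$; 2. $\ell=1$ and $Q_1=m^d$, where $m$ is a monomial and $P$ has a maximal $(m,\psi)$-homogeneous decomposition of degree $d$ with $\psi\in K[\underline x]$ not a monomial; 3. $\mathrm{char}\,K=p>0$, $P\in K[x_1^p,\dots,x_n^p]$, and every $Q_i$ is the $p$-th power of a monomial. -/

import Mathlib

open MvPolynomial

namespace MonSite

noncomputable section

/-- An algebraic closure of the rational function field `K(λ_i : i ∈ ι)`, the `λ_i` being
independent indeterminates. -/
abbrev GenField (K : Type*) [Field K] (ι : Type*) : Type _ :=
  AlgebraicClosure (FractionRing (MvPolynomial ι K))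

/-- The indeterminate `λ_i`, as an element of the algebraic closure of `K(λ)`. -/
def lam (K : Type*) [Field K] {ι : Type*} (i : ι) : GenField K ι :=
  algebraMap (FractionRing (MvPolynomial ι K)) (GenField K ι)
    (algebraMap (MvPolynomial ι K) (FractionRing (MvPolynomial ι K)) (X i))

/-- The polynomial `P + ∑ i, λ_i Q_i`, with coefficients in the algebraic closure of `K(λ)`. -/
def genericPoly {K : Type*} [Field K] {n : ℕ} {ι : Type*} [Fintype ι]
    (P : MvPolynomial (Fin n) K) (Q : ι → MvPolynomial (Fin n) K) :
    MvPolynomial (Fin n) (GenField K ι) :=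
  map (algebraMap K (GenField K ι)) P +
    ∑ i, C (lam K i) * map (algebraMap K (GenField K ι)) (Q i)

/-- `f` is a product of two non-units (for polynomials over a field: of two factors neither of
which is a non-zero constant). -/
def IsReducible {R : Type*} [CommRing R] (f : R) : Prop :=
  ∃ A B : R, ¬ IsUnit A ∧ ¬ IsUnit B ∧ f = A * B

/-- The monomial `x_1 ^ e_1 ⋯ x_n ^ e_n`. -/
def mono (K : Type*) [Field K] {n : ℕ} (e : Fin n →₀ ℕ) : MvPolynomial (Fin n) K :=
  monomial e 1

/-- `P` is of the form `γ x_1 ^ e_1 ⋯ x_n ^ e_n` with `γ ≠ 0`. -/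
def IsMonomial {K : Type*} [Field K] {n : ℕ} (P : MvPolynomial (Fin n) K) : Prop :=
  ∃ (e : Fin n →₀ ℕ) (γ : K), γ ≠ 0 ∧ P = monomial e γ

/-- `P = S ^ e` for some polynomial `S` and some `e > 1`. -/
def IsPurePower {K : Type*} [Field K] {n : ℕ} (P : MvPolynomial (Fin n) K) : Prop :=
  ∃ (S : MvPolynomial (Fin n) K) (e : ℕ), 1 < e ∧ P = S ^ e

/-- `P` is a polynomial in `x_1 ^ p, …, x_n ^ p`. -/
def InPowVars {K : Type*} [Field K] {n : ℕ} (p : ℕ) (P : MvPolynomial (Fin n) K) : Prop :=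
  ∃ R : MvPolynomial (Fin n) K, P = expand p R

/-- The conditions on a finite set `{Q_1, …, Q_ℓ}` of monomials, given by the set `S` of their
exponent vectors: `ℓ ≥ 1`; `deg Q_i ≤ deg P`; no `Q_i` is equal to `P` up to a constant; and
`P, Q_1, …, Q_ℓ` have no non-constant common divisor. -/
structure Admissible {K : Type*} [Field K] {n : ℕ} (P : MvPolynomial (Fin n) K)
    (S : Finset (Fin n →₀ ℕ)) : Prop where
  nonempty : S.Nonempty
  degree_le : ∀ e ∈ S, (mono K e).totalDegree ≤ P.totalDegree
  distinct : ∀ e ∈ S, ∀ γ : K, P ≠ C γ * mono K e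
  relPrime : ∀ D : MvPolynomial (Fin n) K, D ∣ P → (∀ e ∈ S, D ∣ mono K e) → IsUnit D

/-- The polynomial `P + λ_1 Q_1 + ⋯ + λ_ℓ Q_ℓ` attached to a set of monomials; there is one
indeterminate for each of the monomials. -/
def sitePoly {K : Type*} [Field K] {n : ℕ} (P : MvPolynomial (Fin n) K)
    (S : Finset (Fin n →₀ ℕ)) : MvPolynomial (Fin n) (GenField K S) :=
  genericPoly P (fun e : S => mono K e.1)

/-- The set of monomials with exponent vectors in `S` is a reducibility monomial site of `P`. -/
def IsSite {K : Type*} [Field K] {n : ℕ} (P : MvPolynomial (Fin n) K)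
    (S : Finset (Fin n →₀ ℕ)) : Prop :=
  Admissible P S ∧ IsReducible (sitePoly P S)

/-- `F = H(φ, ψ)` is a `(φ, ψ)`-homogeneous decomposition of degree `d` of the polynomial `F`:
`φ` and `ψ` are relatively prime polynomials over `K`, both of degree `< deg F`, and `H` is
homogeneous of degree `d`. The coefficients of `F` and `H` lie in an extension `L` of `K`: one
takes `L = K` for a polynomial over `K`, and the algebraic closure of `K(λ)` for
`P + λ_1 Q_1 + ⋯ + λ_ℓ Q_ℓ`. -/
structure IsHomDecomp {K L : Type*} [Field K] [Field L] [Algebra K L] {n : ℕ}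
    (F : MvPolynomial (Fin n) L) (φ ψ : MvPolynomial (Fin n) K)
    (H : MvPolynomial (Fin 2) L) (d : ℕ) : Prop where
  relPrime : IsRelPrime φ ψ
  degree_lt : max φ.totalDegree ψ.totalDegree < F.totalDegree
  homogeneous : H.IsHomogeneous d
  eq : F = aeval ![map (algebraMap K L) φ, map (algebraMap K L) ψ] H

/-- A homogeneous decomposition `P = h(φ, ψ)` is maximal if `φ + λ ψ` is irreducible over the
algebraic closure of `K(λ)`, for one indeterminate `λ`. -/
structure IsMaxHomDecomp {K : Type*} [Field K] {n : ℕ}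
    (P φ ψ : MvPolynomial (Fin n) K) (h : MvPolynomial (Fin 2) K) (d : ℕ) : Prop
    extends IsHomDecomp P φ ψ h d where
  irreducible : Irreducible (genericPoly φ (fun _ : Unit => ψ))

/-- `P = h(m₁, m₂)` is a homogeneous decomposition of `P` for some monomials `m₁`, `m₂` (constant
factors of the monomials can be moved into `h`). -/
def HomInTwoMonomials {K : Type*} [Field K] {n : ℕ} (P : MvPolynomial (Fin n) K) : Prop :=
  ∃ (a b : Fin n →₀ ℕ) (h : MvPolynomial (Fin 2) K) (d : ℕ),
    IsHomDecomp P (mono K a) (mono K b) h d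

end

end MonSite

open MonSite

/-! The engine is the Bertini-Krull theorem for linear pencils (`exists_formIn_of_isReducible`): if
`P`, `Q` are relatively prime over an algebraically closed `k` and `P + tQ` is reducible over an
algebraically closed field algebraic over `k(t)`, then `P` and `Q` are forms of one degree in a
relatively prime pair of polynomials of smaller degree. Send `t` to `τ = -P/Q`, so that `P + tQ`,
and hence an irreducible factor `A`, vanishes at the generic point of affine space. If the cofactor
vanishes there too, the product rule gives `d(P/Q) = 0`, and `P`, `Q` are `p`-th powers. Otherwise
`A` is Galois invariant, so that some `q^N`-th powers of its coefficients lie in `k(x)` and are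
algebraic over `k(τ)`. By Lüroth they generate together with `τ` a field `k(θ)`. If `θ ∈ k(τ)`,
Gauss's lemma makes `P + tQ` divide a power of `A`, which the nonvanishing nonunit cofactor forbids.
So `τ` is a rational function of degree at least 2 of `θ = φ/ψ`, and clearing denominators gives the
forms.

A pair `φ, ψ` that cannot be lowered in this way (`Indec`) is one with `φ + λψ` irreducible; this
replaces maximality by a condition over the base field. When `Q` is a monomial, its linear factors
in the pair are monomials. Hence either the pair may be taken to consist of two monomials, or `Q =
m^d` and the pair is `m, ψ`.

For a site, one indeterminate `λ_i` is singled out and the others go into an algebraically closed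
base field. If no pair of monomials appears, then `F` is, up to a constant, a product of irreducible
factors `ψ + u m`. If all `u` agree, the characteristic `p` divides their number and all exponents
are multiples of `p`. If not, and the site has a second element, its factorization has factors `ψ' +
u' m'`; unique factorization puts `ψ'` in the span of `m` and `m'`, so again `F` is a form in two
monomials. This trichotomy is `Admissible.site_cases`.

The rest is reading it off. Divisibility of exponents by `p` makes `P` a pure power. Forms in two
monomials have their support on a line, and indecomposability makes its direction primitive, so the
line and a degree bound determine the admissible exponents. If `P` is of this kind and `S = {m^d}`,
a weight argument shows that `m^d` lies on the same line. Conversely, a form over an algebraically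
closed field splits into linear forms. -/

namespace MonSite

/-! ### Binary forms in two polynomials and their linear factors. -/

section Forms

variable {L : Type*} [Field L] {σ : Type*}

/-- `P` is a form of degree `d` in `φ` and `ψ`, with coefficients in `L`. -/
def FormIn (d : ℕ) (φ ψ P : MvPolynomial σ L) : Prop :=
  ∃ H : MvPolynomial (Fin 2) L, H.IsHomogeneous d ∧ P = aeval ![φ, ψ] H

/-- The linear form `v.1 * φ + v.2 * ψ`. -/
noncomputable def lin (v : L × L) (φ ψ : MvPolynomial σ L) : MvPolynomial σ L :=
  C v.1 * φ + C v.2 * ψ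

theorem FormIn.add {d : ℕ} {φ ψ P Q : MvPolynomial σ L} (hP : FormIn d φ ψ P)
    (hQ : FormIn d φ ψ Q) : FormIn d φ ψ (P + Q) := by
  obtain ⟨H, hH, rfl⟩ := hP
  obtain ⟨G, hG, rfl⟩ := hQ
  exact ⟨H + G, hH.add hG, by simp⟩

theorem FormIn.C_mul {d : ℕ} {φ ψ P : MvPolynomial σ L} (hP : FormIn d φ ψ P) (c : L) :
    FormIn d φ ψ (C c * P) := by
  obtain ⟨H, hH, rfl⟩ := hP
  refine ⟨C c * H, ?_, by simp [algebraMap_eq]⟩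
  simpa using (isHomogeneous_C (Fin 2) c).mul hH

theorem FormIn.mul {d e : ℕ} {φ ψ P Q : MvPolynomial σ L} (hP : FormIn d φ ψ P)
    (hQ : FormIn e φ ψ Q) : FormIn (d + e) φ ψ (P * Q) := by
  obtain ⟨H, hH, rfl⟩ := hP
  obtain ⟨G, hG, rfl⟩ := hQ
  exact ⟨H * G, hH.mul hG, by simp⟩

theorem FormIn.pow {d : ℕ} {φ ψ P : MvPolynomial σ L} (hP : FormIn d φ ψ P) (k : ℕ) :
    FormIn (d * k) φ ψ (P ^ k) := by
  obtain ⟨H, hH, rfl⟩ := hP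
  exact ⟨H ^ k, hH.pow k, by simp⟩

theorem formIn_left (φ ψ : MvPolynomial σ L) : FormIn 1 φ ψ φ :=
  ⟨X 0, isHomogeneous_X _ _, by simp⟩

theorem formIn_right (φ ψ : MvPolynomial σ L) : FormIn 1 φ ψ ψ :=
  ⟨X 1, isHomogeneous_X _ _, by simp⟩

theorem formIn_lin (v : L × L) (φ ψ : MvPolynomial σ L) : FormIn 1 φ ψ (lin v φ ψ) :=
  ((formIn_left φ ψ).C_mul _).add ((formIn_right φ ψ).C_mul _)

theorem formIn_pow_mul_pow (φ ψ : MvPolynomial σ L) {k d : ℕ} (h : k ≤ d) :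
    FormIn d φ ψ (φ ^ k * ψ ^ (d - k)) := by
  have := ((formIn_left φ ψ).pow k).mul ((formIn_right φ ψ).pow (d - k))
  rwa [one_mul, one_mul, Nat.add_sub_cancel' h] at this

theorem formIn_sum {ι : Type*} (s : Finset ι) {d : ℕ} {φ ψ : MvPolynomial σ L}
    {f : ι → MvPolynomial σ L} (h : ∀ i ∈ s, FormIn d φ ψ (f i)) :
    FormIn d φ ψ (∑ i ∈ s, f i) := by
  classical
  induction s using Finset.induction_on with
  | empty => exact ⟨0, isHomogeneous_zero _ _ _, by simp⟩
  | insert a s ha ih =>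
    rw [Finset.sum_insert ha]
    exact (h a (by simp)).add (ih fun i hi => h i (by simp [hi]))

/-- The coefficients of a form. -/
theorem FormIn.exists_sum {d : ℕ} {φ ψ P : MvPolynomial σ L} (hP : FormIn d φ ψ P) :
    ∃ c : ℕ → L, P = ∑ k ∈ Finset.range (d + 1), C (c k) * (φ ^ k * ψ ^ (d - k)) := by
  obtain ⟨H, hH, rfl⟩ := hP
  refine ⟨fun k => H.coeff (Finsupp.single 0 k + Finsupp.single 1 (d - k)), ?_⟩
  have key : H = ∑ k ∈ Finset.range (d + 1),
      monomial (Finsupp.single 0 k + Finsupp.single 1 (d - k))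
        (H.coeff (Finsupp.single 0 k + Finsupp.single 1 (d - k))) := by
    have hm : ∀ m : Fin 2 →₀ ℕ, m 0 + m 1 = d →
        Finsupp.single 0 (m 0) + Finsupp.single 1 (d - m 0) = m := by
      intro m hm
      ext i
      fin_cases i
      · simp
      · simp; omega
    ext m
    simp only [coeff_sum, coeff_monomial]
    by_cases hd : m 0 + m 1 = d
    · rw [Finset.sum_eq_single (m 0)]
      · rw [hm m hd]; simp
      · intro b _ hb
        rw [if_neg]
        intro h
        apply hb
        have := DFunLike.congr_fun h 0
        simpa using this
      · intro h
        exact absurd (Finset.mem_range.2 (by omega)) h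
    · rw [Finset.sum_eq_zero]
      · by_contra h0
        apply hd
        have := hH h0
        simpa [Finsupp.weight_apply, Finsupp.sum_fintype, Fin.sum_univ_two] using this
      · intro k hk
        rw [if_neg]
        intro h
        apply hd
        have h0 := DFunLike.congr_fun h 0
        have h1 := DFunLike.congr_fun h 1
        simp at h0 h1 hk
        omega
  conv_lhs => rw [key]
  rw [map_sum]
  refine Finset.sum_congr rfl fun k _ => ?_
  rw [aeval_monomial, algebraMap_eq, Finsupp.prod_add_index' (by simp) (by intros; rw [pow_add])]
  simp

theorem FormIn.trans {d e : ℕ} {φ ψ φ' ψ' P : MvPolynomial σ L} (hP : FormIn d φ ψ P)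
    (hφ : FormIn e φ' ψ' φ) (hψ : FormIn e φ' ψ' ψ) : FormIn (e * d) φ' ψ' P := by
  obtain ⟨c, rfl⟩ := hP.exists_sum
  refine formIn_sum _ fun k hk => FormIn.C_mul ?_ _
  have := (hφ.pow k).mul (hψ.pow (d - k))
  rwa [← mul_add, Nat.add_sub_cancel' (by simp at hk; omega)] at this

theorem FormIn.map {L' : Type*} [Field L'] (f : L →+* L') {d : ℕ} {φ ψ P : MvPolynomial σ L}
    (hP : FormIn d φ ψ P) :
    FormIn d (MvPolynomial.map f φ) (MvPolynomial.map f ψ) (MvPolynomial.map f P) := by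
  obtain ⟨c, rfl⟩ := hP.exists_sum
  rw [map_sum]
  refine formIn_sum _ fun k hk => ?_
  rw [map_mul, map_C, map_mul, map_pow, map_pow]
  exact (formIn_pow_mul_pow _ _ (by simp at hk; omega)).C_mul _

theorem lin_swap_det {v w : L × L} (h : v.1 * w.2 - v.2 * w.1 ≠ 0) (φ ψ : MvPolynomial σ L) :
    ∃ a b : L × L, φ = lin a (lin v φ ψ) (lin w φ ψ) ∧ ψ = lin b (lin v φ ψ) (lin w φ ψ) := by
  set D := v.1 * w.2 - v.2 * w.1 with hD
  refine ⟨(w.2 / D, -v.2 / D), (-w.1 / D, v.1 / D), ?_, ?_⟩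
  · have h1 : w.2 / D * v.1 + -v.2 / D * w.1 = 1 := by field_simp; rw [hD]; ring
    have h2 : w.2 / D * v.2 + -v.2 / D * w.2 = 0 := by ring
    calc φ = C 1 * φ + C 0 * ψ := by simp
      _ = _ := by rw [← h1, ← h2]; simp only [lin, map_add, map_mul]; ring
  · have h1 : -w.1 / D * v.1 + v.1 / D * w.1 = 0 := by ring
    have h2 : -w.1 / D * v.2 + v.1 / D * w.2 = 1 := by field_simp; rw [hD]; ring
    calc ψ = C 0 * φ + C 1 * ψ := by simp
      _ = _ := by rw [← h1, ← h2]; simp only [lin, map_add, map_mul]; ring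

theorem totalDegree_lin_le (v : L × L) (φ ψ : MvPolynomial σ L) :
    (lin v φ ψ).totalDegree ≤ max φ.totalDegree ψ.totalDegree := by
  refine (totalDegree_add _ _).trans (max_le_max ?_ ?_) <;>
  · refine (totalDegree_mul _ _).trans ?_
    simp

theorem dvd_of_dvd_lin {v w : L × L} (h : v.1 * w.2 - v.2 * w.1 ≠ 0) {φ ψ D : MvPolynomial σ L}
    (hv : D ∣ lin v φ ψ) (hw : D ∣ lin w φ ψ) : D ∣ φ ∧ D ∣ ψ := by
  obtain ⟨a, b, ha, hb⟩ := lin_swap_det h φ ψ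
  constructor
  · rw [ha]; exact dvd_add (hv.mul_left _) (hw.mul_left _)
  · rw [hb]; exact dvd_add (hv.mul_left _) (hw.mul_left _)

theorem max_totalDegree_lin {v w : L × L} (h : v.1 * w.2 - v.2 * w.1 ≠ 0)
    (φ ψ : MvPolynomial σ L) :
    max (lin v φ ψ).totalDegree (lin w φ ψ).totalDegree = max φ.totalDegree ψ.totalDegree := by
  apply le_antisymm (max_le (totalDegree_lin_le _ _ _) (totalDegree_lin_le _ _ _))
  obtain ⟨a, b, ha, hb⟩ := lin_swap_det h φ ψ
  apply max_le
  · conv_lhs => rw [ha]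
    exact totalDegree_lin_le _ _ _
  · conv_lhs => rw [hb]
    exact totalDegree_lin_le _ _ _

/-- The linear factors of the homogenization of `f` in degree `d`. -/
noncomputable def linFactors (f : Polynomial L) (d : ℕ) : Multiset (L × L) :=
  f.roots.map (fun r => (1, -r)) + Multiset.replicate (d - f.natDegree) (0, 1)

theorem ne_zero_of_mem_linFactors {f : Polynomial L} {d : ℕ} {v : L × L}
    (hv : v ∈ linFactors f d) : v ≠ 0 := by
  simp only [linFactors, Multiset.mem_add, Multiset.mem_map] at hv
  rcases hv with ⟨r, _, rfl⟩ | hv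
  · simp
  · rw [Multiset.eq_of_mem_replicate hv]; simp

theorem card_linFactors [IsAlgClosed L] {f : Polynomial L} {d : ℕ} (hd : f.natDegree ≤ d) :
    (linFactors f d).card = d := by
  have := (IsAlgClosed.splits f).natDegree_eq_card_roots
  simp [linFactors, ← this, hd]

theorem lin_homogeneous (v : L × L) :
    (lin v (X 0 : MvPolynomial (Fin 2) L) (X 1)).IsHomogeneous 1 := by
  apply IsHomogeneous.add
  · simpa using (isHomogeneous_C (Fin 2) v.1).mul (isHomogeneous_X L (0 : Fin 2))
  · simpa using (isHomogeneous_C (Fin 2) v.2).mul (isHomogeneous_X L (1 : Fin 2))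

/-- Both sides are homogeneous of degree `d`, so it suffices to dehomogenize, where this is the
factorization of `f` over its roots. The factors `(0, 1)` are the roots at infinity and become `1`.
-/
theorem homogenize_eq_prod [IsAlgClosed L] {f : Polynomial L} {d : ℕ} (hd : f.natDegree ≤ d) :
    f.homogenize d =
      C f.leadingCoeff * ((linFactors f d).map fun v => lin v (X 0) (X 1)).prod := by
  apply Polynomial.homogenize_eq_of_isHomogeneous
  · have h : ∀ s : Multiset (L × L), ((s.map fun v => lin v
        (X 0 : MvPolynomial (Fin 2) L) (X 1)).prod).IsHomogeneous s.card := by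
      intro s
      induction s using Multiset.induction_on with
      | empty => simpa using isHomogeneous_one (Fin 2) L
      | cons a s ih =>
        rw [Multiset.map_cons, Multiset.prod_cons, Multiset.card_cons, add_comm]
        exact (lin_homogeneous a).mul ih
    have := (isHomogeneous_C (Fin 2) f.leadingCoeff).mul (h (linFactors f d))
    rwa [card_linFactors hd, zero_add] at this
  · rw [map_mul, map_multiset_prod, Multiset.map_map, linFactors, Multiset.map_add,
      Multiset.prod_add, Multiset.map_map]
    have h1 : (Multiset.map ((⇑(aeval ![(Polynomial.X : Polynomial L), 1]) ∘
        fun v => lin v (X 0) (X 1)) ∘ fun r => (1, -r)) f.roots) =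
        f.roots.map fun r => Polynomial.X - Polynomial.C r := by
      refine Multiset.map_congr rfl fun r _ => ?_
      simp [lin, sub_eq_add_neg]
    rw [h1]
    conv_rhs => rw [(IsAlgClosed.splits f).eq_prod_roots]
    simp [lin]

theorem aeval_homogenize_eq_prod [IsAlgClosed L] {f : Polynomial L} {d : ℕ}
    (hd : f.natDegree ≤ d) (φ ψ : MvPolynomial σ L) :
    aeval ![φ, ψ] (f.homogenize d) =
      C f.leadingCoeff * ((linFactors f d).map fun v => lin v φ ψ).prod := by
  rw [homogenize_eq_prod hd, map_mul, map_multiset_prod, Multiset.map_map]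
  simp [lin, algebraMap_eq]

theorem IsHomogeneous.exists_homogenize {d : ℕ} {H : MvPolynomial (Fin 2) L}
    (hH : H.IsHomogeneous d) : ∃ f : Polynomial L, f.natDegree ≤ d ∧ H = f.homogenize d := by
  refine ⟨aeval ![Polynomial.X, 1] H, ?_,
    (Polynomial.homogenize_eq_of_isHomogeneous hH rfl).symm⟩
  rw [aeval_def, eval₂_eq']
  refine Polynomial.natDegree_sum_le_of_forall_le _ _ fun m hm => ?_
  have hd : m 0 + m 1 = d := by
    have := hH (mem_support_iff.1 hm)
    simpa [Finsupp.weight_apply, Finsupp.sum_fintype, Fin.sum_univ_two] using this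
  simp only [Fin.prod_univ_two, Matrix.cons_val_zero, Matrix.cons_val_one, one_pow, mul_one,
    ← Polynomial.C_eq_algebraMap]
  exact (Polynomial.natDegree_C_mul_X_pow_le _ _).trans (by omega)

theorem FormIn.exists_homogenize {d : ℕ} {φ ψ P : MvPolynomial σ L} (hP : FormIn d φ ψ P) :
    ∃ f : Polynomial L, f.natDegree ≤ d ∧ P = aeval ![φ, ψ] (f.homogenize d) := by
  obtain ⟨H, hH, rfl⟩ := hP
  obtain ⟨f, hf, rfl⟩ := IsHomogeneous.exists_homogenize hH
  exact ⟨f, hf, rfl⟩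

theorem formIn_homogenize (f : Polynomial L) (d : ℕ) (φ ψ : MvPolynomial σ L) :
    FormIn d φ ψ (aeval ![φ, ψ] (f.homogenize d)) :=
  ⟨_, Polynomial.isHomogeneous_homogenize f, rfl⟩

/-- A nonzero form over an algebraically closed field is a product of linear forms. -/
theorem FormIn.exists_prod [IsAlgClosed L] {d : ℕ} {φ ψ P : MvPolynomial σ L}
    (hP : FormIn d φ ψ P) (h0 : P ≠ 0) :
    ∃ (c : L) (s : Multiset (L × L)), c ≠ 0 ∧ s.card = d ∧ (∀ v ∈ s, v ≠ 0) ∧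
      P = C c * (s.map fun v => lin v φ ψ).prod := by
  obtain ⟨f, hf, rfl⟩ := hP.exists_homogenize
  refine ⟨f.leadingCoeff, linFactors f d, ?_, card_linFactors hf,
    fun v => ne_zero_of_mem_linFactors, aeval_homogenize_eq_prod hf φ ψ⟩
  rw [Ne, Polynomial.leadingCoeff_eq_zero]
  rintro rfl
  simp at h0

/-- Proportional factors would come either from a common root, excluded by coprimality, or from a
root at infinity on both sides, excluded because one of `f`, `g` attains the degree `max`. -/
theorem det_linFactors_ne_zero {f g : Polynomial L} (hfg : IsCoprime f g)
    {v w : L × L} (hv : v ∈ linFactors f (max f.natDegree g.natDegree))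
    (hw : w ∈ linFactors g (max f.natDegree g.natDegree)) :
    v.1 * w.2 - v.2 * w.1 ≠ 0 := by
  simp only [linFactors, Multiset.mem_add, Multiset.mem_map, Multiset.mem_replicate] at hv hw
  rcases hv with ⟨r, hr, rfl⟩ | ⟨h1, rfl⟩ <;> rcases hw with ⟨s, hs, rfl⟩ | ⟨h2, rfl⟩
  · intro h
    have hrs : r = s := by
      simp at h
      linear_combination h
    subst hrs
    obtain ⟨a, b, hab⟩ := hfg
    have := congrArg (Polynomial.eval r) hab
    rw [Polynomial.eval_add, Polynomial.eval_mul, Polynomial.eval_mul,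
      (Polynomial.isRoot_of_mem_roots hr : _ = _), (Polynomial.isRoot_of_mem_roots hs : _ = _)]
      at this
    simp at this
  · simp
  · simp
  · omega

theorem multiset_prod_dvd {M : Type*} [CommMonoidWithZero M] {p : M} (hp : Prime p)
    {ι : Type*} (s : Multiset ι) (f : ι → M) (h : p ∣ (s.map f).prod) : ∃ i ∈ s, p ∣ f i := by
  obtain ⟨a, ha, hpa⟩ := hp.exists_mem_multiset_dvd h
  obtain ⟨i, hi, rfl⟩ := Multiset.mem_map.1 ha
  exact ⟨i, hi, hpa⟩

/-- An irreducible common divisor divides a linear form on each side. The two linear forms are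
independent, so it divides `φ` and `ψ`. -/
theorem isRelPrime_homogenize [Finite σ] [IsAlgClosed L] {f g : Polynomial L} (hfg : IsCoprime f g)
    (hf : f ≠ 0) (hg : g ≠ 0) {φ ψ : MvPolynomial σ L} (h : IsRelPrime φ ψ)
    (hne : aeval ![φ, ψ] (f.homogenize (max f.natDegree g.natDegree)) ≠ 0) :
    IsRelPrime (aeval ![φ, ψ] (f.homogenize (max f.natDegree g.natDegree)))
      (aeval ![φ, ψ] (g.homogenize (max f.natDegree g.natDegree))) := by
  intro D hD1 hD2
  by_contra hu
  have hD0 : D ≠ 0 := fun h0 => hne (zero_dvd_iff.1 (h0 ▸ hD1))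
  obtain ⟨p, hp, hpD⟩ := WfDvdMonoid.exists_irreducible_factor hu hD0
  have hpp := hp.prime
  replace hD1 := hpD.trans hD1
  replace hD2 := hpD.trans hD2
  rw [aeval_homogenize_eq_prod (le_max_left _ _)] at hD1
  rw [aeval_homogenize_eq_prod (le_max_right _ _)] at hD2
  have hC : ∀ c : L, c ≠ 0 → ¬ p ∣ C c := fun c hc hpc =>
    hp.not_isUnit (isUnit_of_dvd_unit hpc ((isUnit_iff_ne_zero.2 hc).map C))
  obtain ⟨v, hv, hpv⟩ := multiset_prod_dvd hpp _ _
    ((hpp.dvd_or_dvd hD1).resolve_left (hC _ (Polynomial.leadingCoeff_ne_zero.2 hf)))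
  obtain ⟨w, hw, hpw⟩ := multiset_prod_dvd hpp _ _
    ((hpp.dvd_or_dvd hD2).resolve_left (hC _ (Polynomial.leadingCoeff_ne_zero.2 hg)))
  obtain ⟨h1, h2⟩ := dvd_of_dvd_lin (det_linFactors_ne_zero hfg hv hw) hpv hpw
  exact hp.not_isUnit (h h1 h2)

theorem totalDegree_prod_const {ι : Type*} (s : Multiset ι) (f : ι → MvPolynomial σ L) (D : ℕ)
    (hD : ∀ i ∈ s, f i ≠ 0 ∧ (f i).totalDegree = D) :
    (s.map f).prod ≠ 0 ∧ (s.map f).prod.totalDegree = s.card * D := by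
  induction s using Multiset.induction_on with
  | empty => simp
  | cons a s ih =>
    obtain ⟨h1, h2⟩ := ih fun i hi => hD i (by simp [hi])
    obtain ⟨h3, h4⟩ := hD a (by simp)
    rw [Multiset.map_cons, Multiset.prod_cons, Multiset.card_cons]
    refine ⟨mul_ne_zero h3 h1, ?_⟩
    rw [totalDegree_mul_of_isDomain h3 h1, h2, h4]
    ring

/-- Coprime forms of degree `d` multiply degrees by `d`. -/
theorem le_max_totalDegree_homogenize [IsAlgClosed L] {f g : Polynomial L} (hfg : IsCoprime f g)
    (hf : f ≠ 0) (hg : g ≠ 0) {φ ψ : MvPolynomial σ L}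
    (h0 : 0 < max φ.totalDegree ψ.totalDegree) :
    max f.natDegree g.natDegree * max φ.totalDegree ψ.totalDegree ≤
      max (aeval ![φ, ψ] (f.homogenize (max f.natDegree g.natDegree))).totalDegree
        (aeval ![φ, ψ] (g.homogenize (max f.natDegree g.natDegree))).totalDegree := by
  set d := max f.natDegree g.natDegree with hd
  set D := max φ.totalDegree ψ.totalDegree with hD
  have key : ∀ f : Polynomial L, f ≠ 0 → f.natDegree ≤ d →
      (∀ v ∈ linFactors f d, (lin v φ ψ).totalDegree = D) →
      (aeval ![φ, ψ] (f.homogenize d)).totalDegree = d * D := by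
    intro f hf hfd h
    rw [aeval_homogenize_eq_prod hfd]
    have := totalDegree_prod_const (linFactors f d) (fun v => lin v φ ψ) D fun v hv => by
      refine ⟨fun h1 => ?_, h v hv⟩
      have := h v hv
      rw [h1, totalDegree_zero] at this
      omega
    rw [totalDegree_mul_of_isDomain (by simpa using hf) this.1, this.2, totalDegree_C, zero_add,
      card_linFactors hfd]
  by_cases h1 : ∀ v ∈ linFactors f d, (lin v φ ψ).totalDegree = D
  · rw [key f hf (le_max_left _ _) h1]
    exact le_max_left _ _
  -- Cancellation of the top degree happens in at most one direction: if it happens for a factor `v`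
  -- of `f`, every factor of `g`, being independent of `v`, has full degree `D`.
  · push Not at h1
    obtain ⟨v, hv, hvD⟩ := h1
    have h2 : ∀ w ∈ linFactors g d, (lin w φ ψ).totalDegree = D := by
      intro w hw
      have h3 := max_totalDegree_lin (det_linFactors_ne_zero hfg hv hw) φ ψ
      have h4 := totalDegree_lin_le v φ ψ
      rw [← hD] at h3 h4
      rcases max_choice (lin v φ ψ).totalDegree (lin w φ ψ).totalDegree with h | h
      · exact absurd (h.symm.trans h3) hvD
      · exact h.symm.trans h3
    rw [key g hg (le_max_right _ _) h2]
    exact le_max_right _ _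

theorem isUnit_iff_totalDegree {f : MvPolynomial σ L} (hf : f ≠ 0) :
    IsUnit f ↔ f.totalDegree = 0 := by
  rw [isUnit_iff_totalDegree_of_isReduced]
  constructor
  · exact fun h => h.2
  · intro h
    refine ⟨?_, h⟩
    rw [totalDegree_eq_zero_iff_eq_C.1 h] at hf ⊢
    simpa using hf

/-- A form of degree larger than that of the polynomials it is built from is reducible. -/
theorem FormIn.isReducible [IsAlgClosed L] {d : ℕ} {φ ψ F : MvPolynomial σ L}
    (hF : FormIn d φ ψ F) (hdeg : max φ.totalDegree ψ.totalDegree < F.totalDegree) :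
    IsReducible F := by
  have hF0 : F ≠ 0 := by
    rintro rfl
    simp at hdeg
  obtain ⟨c, s, hc, -, -, rfl⟩ := hF.exists_prod hF0
  have h2 := right_ne_zero_of_mul hF0
  rw [totalDegree_mul_of_isDomain (left_ne_zero_of_mul hF0) h2, totalDegree_C, zero_add] at hdeg
  -- A linear factor has smaller degree than `F`, so splitting off a nonconstant one leaves a
  -- nonconstant cofactor.
  by_cases h : ∃ v ∈ s, (lin v φ ψ).totalDegree ≠ 0
  · obtain ⟨v, hv, hv0⟩ := h
    obtain ⟨t, rfl⟩ := Multiset.exists_cons_of_mem hv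
    rw [Multiset.map_cons, Multiset.prod_cons] at h2 hdeg ⊢
    have h3 := left_ne_zero_of_mul h2
    have h4 := right_ne_zero_of_mul h2
    rw [totalDegree_mul_of_isDomain h3 h4] at hdeg
    have h5 := totalDegree_lin_le v φ ψ
    refine ⟨C c * lin v φ ψ, _, ?_, ?_, (mul_assoc _ _ _).symm⟩
    · rw [isUnit_iff_totalDegree (mul_ne_zero (left_ne_zero_of_mul hF0) h3),
        totalDegree_mul_of_isDomain (left_ne_zero_of_mul hF0) h3]
      omega
    · rw [isUnit_iff_totalDegree h4]
      omega
  · push Not at h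
    have := (totalDegree_prod_const s (fun v => lin v φ ψ) 0 fun v hv => ⟨fun h0 => h2 ?_, h v hv⟩).2
    · omega
    · exact Multiset.prod_eq_zero (Multiset.mem_map.2 ⟨v, hv, h0⟩)

end Forms

end MonSite

namespace MonSite

/-! ### Lüroth's theorem in several variables, by restriction to a line. -/

section Luroth

open IntermediateField

variable {k : Type*} [Field k] {σ : Type*}

theorem exists_eval_ne_zero [Infinite k] {f : MvPolynomial σ k} (hf : f ≠ 0) :
    ∃ a, eval a f ≠ 0 := by
  by_contra! h
  exact hf (MvPolynomial.funext fun a => by simp [h a])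

/-- There is a line on which `D` does not vanish and `N / D` is not constant. -/
theorem exists_line [Infinite k] {N D : MvPolynomial σ k} (hD : D ≠ 0)
    (hN : ∀ c, N ≠ C c * D) :
    ∃ ℓ : MvPolynomial σ k →ₐ[k] Polynomial k, ℓ D ≠ 0 ∧
      ∀ c, ℓ N ≠ Polynomial.C c * ℓ D := by
  obtain ⟨a, ha⟩ := exists_eval_ne_zero hD
  -- A point `b` where this polynomial is nonzero is one where `D` does not vanish and `N / D` takes
  -- another value than at `a`. The line through `a` and `b` then works.
  have h1 : D * (C (eval a D) * N - C (eval a N) * D) ≠ 0 := by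
    refine mul_ne_zero hD fun h => hN (eval a N / eval a D) ?_
    have h2 : C (eval a D)⁻¹ * (C (eval a D) * N - C (eval a N) * D) = 0 := by rw [h, mul_zero]
    rw [mul_sub, ← mul_assoc, ← mul_assoc, ← C_mul, ← C_mul, inv_mul_cancel₀ ha, C_1, one_mul,
      sub_eq_zero] at h2
    rw [div_eq_inv_mul, C_mul, mul_assoc]
    rwa [C_mul, mul_assoc] at h2
  obtain ⟨b, hb⟩ := exists_eval_ne_zero h1
  let ℓ : MvPolynomial σ k →ₐ[k] Polynomial k :=
    aeval fun i => Polynomial.C (a i) + Polynomial.C (b i - a i) * Polynomial.X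
  have h0 : ∀ f, Polynomial.eval 0 (ℓ f) = eval a f := by
    intro f
    have : (Polynomial.evalRingHom (0 : k)).comp (ℓ : MvPolynomial σ k →+* Polynomial k) =
        eval a := by
      ext i <;> simp [ℓ]
    exact DFunLike.congr_fun this f
  have h1 : ∀ f, Polynomial.eval 1 (ℓ f) = eval b f := by
    intro f
    have : (Polynomial.evalRingHom (1 : k)).comp (ℓ : MvPolynomial σ k →+* Polynomial k) =
        eval b := by
      ext i <;> simp [ℓ]
    exact DFunLike.congr_fun this f
  refine ⟨ℓ, fun h => ha ?_, fun c h => hb ?_⟩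
  · rw [← h0, h, Polynomial.eval_zero]
  · have e0 := congrArg (Polynomial.eval 0) h
    have e1 := congrArg (Polynomial.eval 1) h
    simp only [Polynomial.eval_mul, Polynomial.eval_C, h0, h1] at e0 e1
    simp only [map_mul, map_sub, eval_C, e0, e1]
    ring

/-- A finitely generated subalgebra of a rational function field can be mapped to a rational
function field in one variable in such a way that a given transcendental stays transcendental. -/
theorem exists_algHom_ratFunc [Infinite k] {F : Type*} [Field F] [Algebra (MvPolynomial σ k) F]
    [IsFractionRing (MvPolynomial σ k) F] [Algebra k F] [IsScalarTower k (MvPolynomial σ k) F]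
    {s : Set F} (hs : s.Finite) {τ : F} (hτs : τ ∈ s) (hτ : Transcendental k τ) :
    ∃ g : Algebra.adjoin k s →ₐ[k] RatFunc k,
      Transcendental k (g ⟨τ, Algebra.subset_adjoin hτs⟩) := by
  classical
  obtain ⟨⟨D, hD⟩, hDs⟩ := IsLocalization.exist_integer_multiples_of_finset
    (nonZeroDivisors (MvPolynomial σ k)) hs.toFinset
  have hD0 : D ≠ 0 := nonZeroDivisors.ne_zero hD
  have hDF : algebraMap (MvPolynomial σ k) F D ≠ 0 := by simpa using hD0
  have hfrac : ∀ a ∈ s, ∃ N : MvPolynomial σ k, a =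
      algebraMap (MvPolynomial σ k) F N * (algebraMap (MvPolynomial σ k) F D)⁻¹ := by
    intro a ha
    obtain ⟨N, hN⟩ := hDs a (by simpa using ha)
    refine ⟨N, ?_⟩
    rw [hN, Algebra.smul_def, mul_comm, ← mul_assoc, inv_mul_cancel₀ hDF, one_mul]
  obtain ⟨N, hN⟩ := hfrac τ hτs
  obtain ⟨ℓ, hℓD, hℓN⟩ := exists_line (N := N) hD0 fun c hc => by
    refine hτ ?_
    rw [hN, hc, map_mul, mul_assoc, mul_inv_cancel₀ hDF, mul_one,
      ← MvPolynomial.algebraMap_eq, ← IsScalarTower.algebraMap_apply]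
    exact isAlgebraic_algebraMap c
  -- Restriction to the line extends to fractions whose denominator is not identically zero on it.
  -- The common denominator `D` is allowed, so all of `s` lies in this ring.
  let S : Submonoid (MvPolynomial σ k) := (nonZeroDivisors (Polynomial k)).comap ℓ
  have hS : S ≤ nonZeroDivisors (MvPolynomial σ k) := by
    intro f hf
    refine mem_nonZeroDivisors_of_ne_zero fun h0 => ?_
    have : ℓ f ∈ nonZeroDivisors (Polynomial k) := hf
    rw [h0, map_zero] at this
    exact nonZeroDivisors.ne_zero this rfl
  let A : Subalgebra (MvPolynomial σ k) F := Localization.subalgebra.ofField F S hS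
  obtain ⟨g, hgR⟩ : ∃ g : A →ₐ[k] RatFunc k, ∀ f : MvPolynomial σ k,
      g (algebraMap (MvPolynomial σ k) A f) = algebraMap (Polynomial k) (RatFunc k) (ℓ f) := by
    refine ⟨IsLocalization.liftAlgHom (M := S)
      (f := (IsScalarTower.toAlgHom k (Polynomial k) (RatFunc k)).comp ℓ) fun y => ?_, ?_⟩
    · have : ℓ y ≠ 0 := nonZeroDivisors.ne_zero y.2
      simpa using this
    · intro f
      simp
  have hDS : D ∈ S := mem_nonZeroDivisors_of_ne_zero hℓD
  have hsA : ∀ a ∈ s, a ∈ A := by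
    intro a ha
    obtain ⟨N, hN⟩ := hfrac a ha
    exact ⟨N, D, hDS, hN⟩
  have hR₀ : Algebra.adjoin k s ≤ A.restrictScalars k := Algebra.adjoin_le hsA
  refine ⟨g.comp (Subalgebra.inclusion hR₀), ?_⟩
  apply RatFunc.transcendental_of_ne_C
  rintro ⟨c, hc⟩
  apply hℓN c
  have h1 : (⟨τ, hsA τ hτs⟩ : A) * algebraMap (MvPolynomial σ k) A D =
      algebraMap (MvPolynomial σ k) A N := by
    apply Subtype.ext
    change τ * algebraMap (MvPolynomial σ k) F D = algebraMap (MvPolynomial σ k) F N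
    rw [hN, mul_assoc, inv_mul_cancel₀ hDF, mul_one]
  have h2 := congrArg g h1
  rw [map_mul, hgR, hgR] at h2
  have h3 : g ⟨τ, hsA τ hτs⟩ = RatFunc.C c := hc
  rw [h3] at h2
  apply RatFunc.algebraMap_injective k
  rw [← h2, map_mul, RatFunc.algebraMap_C]

/-- A nonzero kernel element is algebraic over `k[τ]`, so it has a nonzero multiple `q(τ)` in
`k[τ]`. This would make the image of `τ` a root of `q`. -/
theorem injective_of_transcendental {F B : Type*} [Field F] [Field B] [Algebra k F] [Algebra k B]
    {τ : F} (R₀ : Subalgebra k F) (halg : ∀ a ∈ R₀, IsAlgebraic k⟮τ⟯ a) (hτR : τ ∈ R₀)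
    (g : R₀ →ₐ[k] B) (hg : Transcendental k (g ⟨τ, hτR⟩)) : Function.Injective g := by
  rw [injective_iff_map_eq_zero]
  intro r hr
  by_contra hr0
  have hT : Algebra.adjoin k {τ} ≤ R₀ := Algebra.adjoin_le (by simpa using hτR)
  let _ : Algebra (Algebra.adjoin k {τ}) R₀ := (Subalgebra.inclusion hT).toAlgebra
  have : IsScalarTower (Algebra.adjoin k {τ}) R₀ F := IsScalarTower.of_algebraMap_eq fun _ => rfl
  have h1 : IsAlgebraic (Algebra.adjoin k {τ}) r := by
    have h2 := halg r r.2
    open scoped algebraAdjoinAdjoin in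
    rw [← IsFractionRing.isAlgebraic_iff (Algebra.adjoin k {τ}) k⟮τ⟯ F] at h2
    exact (isAlgebraic_algebraMap_iff (R := Algebra.adjoin k {τ}) (S := R₀) (A := F)
      Subtype.val_injective).1 h2
  obtain ⟨u, hu0, v, hv⟩ := h1.exists_nonzero_dvd (mem_nonZeroDivisors_of_ne_zero hr0)
  obtain ⟨q, hq⟩ := (Algebra.adjoin_singleton_eq_range_aeval k τ).le u.2
  have hq' : algebraMap (Algebra.adjoin k {τ}) R₀ u = Polynomial.aeval (⟨τ, hτR⟩ : R₀) q := by
    apply Subtype.ext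
    rw [← Subalgebra.coe_val R₀, ← Polynomial.aeval_algHom_apply]
    exact hq.symm
  rw [hq'] at hv
  have h3 := congrArg g hv
  rw [map_mul, hr, zero_mul, ← Polynomial.aeval_algHom_apply] at h3
  refine hg ⟨q, ?_, h3⟩
  rintro rfl
  apply hu0
  apply Subtype.ext
  rw [← hq]
  simp

/-- The injection extends to the fraction field `k(s)`, and the one-variable Lüroth theorem applies
to its image in `k(X)`. -/
theorem adjoin_eq_of_algHom_ratFunc {F : Type*} [Field F] [Algebra k F] {s : Set F}
    (g : Algebra.adjoin k s →ₐ[k] RatFunc k) (hg : Function.Injective g) :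
    ∃ θ, adjoin k s = k⟮θ⟯ := by
  open scoped algebraAdjoinAdjoin in
  let G : adjoin k s →ₐ[k] RatFunc k := IsFractionRing.liftAlgHom (g := g) hg
  have hE := RatFunc.Luroth.eq_adjoin_generator (E := G.fieldRange)
  obtain ⟨θ, hθ⟩ := RatFunc.Luroth.generator_mem (E := G.fieldRange)
  refine ⟨θ, ?_⟩
  have htop : (⊤ : IntermediateField k (adjoin k s)) = k⟮θ⟯ := by
    apply IntermediateField.map_injective G
    rw [← AlgHom.fieldRange_eq_map, IntermediateField.adjoin_map, Set.image_singleton]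
    have hθ' : G θ = RatFunc.Luroth.generator G.fieldRange := hθ
    rw [hθ']
    exact hE
  have := congrArg (IntermediateField.map (adjoin k s).val) htop
  rw [← AlgHom.fieldRange_eq_map, IntermediateField.adjoin_map, Set.image_singleton,
    IntermediateField.fieldRange_val] at this
  exact this

/-- Lüroth's theorem for subfields of transcendence degree one of a rational function field. -/
theorem exists_adjoin_simple [Infinite k] {F : Type*} [Field F] [Algebra (MvPolynomial σ k) F]
    [IsFractionRing (MvPolynomial σ k) F] [Algebra k F] [IsScalarTower k (MvPolynomial σ k) F]
    {s : Set F} (hs : s.Finite) {τ : F} (hτs : τ ∈ s)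
    (hτ : Transcendental k τ) (halg : ∀ a ∈ s, IsAlgebraic k⟮τ⟯ a) :
    ∃ θ, adjoin k s = k⟮θ⟯ := by
  obtain ⟨g, hg⟩ := exists_algHom_ratFunc (σ := σ) hs hτs hτ
  refine adjoin_eq_of_algHom_ratFunc g (injective_of_transcendental _ ?_ _ g hg)
  intro a ha
  induction ha using Algebra.adjoin_induction with
  | mem x hx => exact halg x hx
  | algebraMap c =>
    rw [IsScalarTower.algebraMap_apply k k⟮τ⟯ F]
    exact isAlgebraic_algebraMap _
  | add x y _ _ hx hy => exact hx.add hy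
  | mul x y _ _ hx hy => exact hx.mul hy

end Luroth

end MonSite

namespace MonSite

/-! ### Vanishing differentials and `p`-th powers. -/

section Derivative

variable {k : Type*} [Field k] {σ : Type*}

theorem exists_pow_of_dvd [IsAlgClosed k] {p : ℕ} (hp : p.Prime) [CharP k p]
    (P : MvPolynomial σ k) (h : ∀ m ∈ P.support, ∀ i, p ∣ m i) : ∃ φ, P = φ ^ p := by
  have : Fact p.Prime := ⟨hp⟩
  choose r hr using fun c : k => IsAlgClosed.exists_pow_nat_eq c hp.pos
  refine ⟨∑ m ∈ P.support, monomial (m.mapRange (· / p) (Nat.zero_div p)) (r (P.coeff m)), ?_⟩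
  rw [sum_pow_char p]
  conv_lhs => rw [P.as_sum]
  refine Finset.sum_congr rfl fun m hm => ?_
  have hm' : p • m.mapRange (· / p) (Nat.zero_div p) = m := by
    ext i
    simp [Nat.mul_div_cancel' (h m hm i)]
  rw [monomial_pow, hr, hm']

theorem totalDegree_pderiv_lt {P : MvPolynomial σ k} {i : σ} (h : pderiv i P ≠ 0) :
    (pderiv i P).totalDegree < P.totalDegree := by
  obtain ⟨m, hm, hmd⟩ := Finset.exists_mem_eq_sup _ (support_nonempty.2 h)
    fun m : σ →₀ ℕ => m.sum fun _ e => e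
  have h1 : m + Finsupp.single i 1 ∈ P.support := by
    rw [mem_support_iff] at hm ⊢
    rw [coeff_pderiv] at hm
    exact left_ne_zero_of_mul hm
  have h2 := le_totalDegree h1
  rw [totalDegree, hmd]
  rw [Finsupp.sum_add_index' (by simp) (by simp)] at h2
  simp at h2
  exact lt_of_lt_of_le (Nat.lt_succ_self _) h2

/-- Relative primality makes `P` divide its own derivative, which has smaller degree unless it is
zero. -/
theorem pderiv_eq_zero_of_isRelPrime {P Q : MvPolynomial σ k} (h : IsRelPrime P Q) {i : σ}
    (hd : Q * pderiv i P = P * pderiv i Q) : pderiv i P = 0 := by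
  by_contra h0
  have h1 : P ∣ pderiv i P := h.dvd_of_dvd_mul_left (Dvd.intro _ hd.symm)
  exact absurd (totalDegree_le_of_dvd_of_isDomain h1 h0) (not_le.2 (totalDegree_pderiv_lt h0))

theorem natCast_eq_zero_of_pderiv {P : MvPolynomial σ k} (h : ∀ i, pderiv i P = 0)
    {m : σ →₀ ℕ} (hm : m ∈ P.support) (i : σ) : (m i : k) = 0 := by
  by_contra h0
  have h1 : 1 ≤ m i := by
    by_contra h2
    apply h0
    have : m i = 0 := by omega
    simp [this]
  have h2 : m - Finsupp.single i 1 + Finsupp.single i 1 = m :=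
    tsub_add_cancel_of_le (by simpa using h1)
  have h3 := coeff_pderiv (i := i) P (m - Finsupp.single i 1)
  rw [h i, h2, coeff_zero] at h3
  have h4 : ((m - Finsupp.single i 1 : σ →₀ ℕ) i : k) + 1 = m i := by
    simp [Nat.cast_sub h1]
  rw [h4] at h3
  exact (mul_ne_zero (mem_support_iff.1 hm) h0) h3.symm

/-- If `P / Q` has zero differential, then `P` and `Q` are `p`-th powers. -/
theorem exists_pow_of_pderiv [IsAlgClosed k] {P Q : MvPolynomial σ k} (h : IsRelPrime P Q)
    (hdeg : 0 < max P.totalDegree Q.totalDegree)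
    (hd : ∀ i, Q * pderiv i P = P * pderiv i Q) :
    ∃ p : ℕ, p.Prime ∧ ∃ φ ψ, P = φ ^ p ∧ Q = ψ ^ p := by
  have hP := @natCast_eq_zero_of_pderiv k _ σ _ fun i => pderiv_eq_zero_of_isRelPrime h (hd i)
  have hQ := @natCast_eq_zero_of_pderiv k _ σ _ fun i => pderiv_eq_zero_of_isRelPrime h.symm (hd i).symm
  obtain ⟨p, hp⟩ := CharP.exists k
  have key : ∀ P : MvPolynomial σ k, (∀ m ∈ P.support, ∀ i, (m i : k) = 0) →
      0 < P.totalDegree → p ≠ 0 := by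
    rintro P hP hP0 rfl
    have := CharP.charP_to_charZero k
    refine hP0.ne' ?_
    rw [totalDegree_eq_zero_iff]
    intro m hm i
    exact_mod_cast hP m hm i
  have hp0 : p ≠ 0 := by
    rcases lt_max_iff.1 hdeg with h0 | h0
    · exact key P (fun m hm => hP hm) h0
    · exact key Q (fun m hm => hQ hm) h0
  have hpp : p.Prime := (CharP.char_is_prime_or_zero k p).resolve_right hp0
  obtain ⟨φ, hφ⟩ := exists_pow_of_dvd hpp P fun m hm i => (CharP.cast_eq_zero_iff k p _).1 (hP hm i)
  obtain ⟨ψ, hψ⟩ := exists_pow_of_dvd hpp Q fun m hm i => (CharP.cast_eq_zero_iff k p _).1 (hQ hm i)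
  exact ⟨p, hpp, φ, ψ, hφ, hψ⟩

end Derivative

/-! ### Gauss's lemma for a primitive linear polynomial. -/

section Gauss

/-- `QX + P` is primitive because `P` and `Q` are relatively prime, so its divisibility over the
fraction field descends to `R`. -/
theorem linear_dvd_of_root {R F : Type*} [CommRing R] [IsDomain R] [UniqueFactorizationMonoid R]
    [Field F] [Algebra R F] [IsFractionRing R F] {P Q : R} (h : IsRelPrime P Q) (hQ : Q ≠ 0)
    {f : Polynomial R} (hf : Polynomial.aeval (-(algebraMap R F P / algebraMap R F Q)) f = 0) :
    (Polynomial.C Q * Polynomial.X + Polynomial.C P) ∣ f := by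
  have hQF : algebraMap R F Q ≠ 0 := by simpa using hQ
  have hprim : (Polynomial.C Q * Polynomial.X + Polynomial.C P).IsPrimitive := by
    intro r hr
    rw [Polynomial.C_dvd_iff_dvd_coeff] at hr
    have h0 := hr 0
    have h1 := hr 1
    simp at h0 h1
    exact h h0 h1
  have h1 : (Polynomial.X - Polynomial.C (-(algebraMap R F P / algebraMap R F Q))) ∣
      f.map (algebraMap R F) := by
    rw [Polynomial.dvd_iff_isRoot, Polynomial.IsRoot, Polynomial.eval_map_algebraMap, hf]
  have h2 : (Polynomial.C Q * Polynomial.X + Polynomial.C P).map (algebraMap R F) =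
      Polynomial.C (algebraMap R F Q) *
        (Polynomial.X - Polynomial.C (-(algebraMap R F P / algebraMap R F Q))) := by
    rw [mul_sub, ← Polynomial.C_mul, mul_neg, mul_div_cancel₀ _ hQF]
    simp
  have h3 : (Polynomial.C Q * Polynomial.X + Polynomial.C P).map (algebraMap R F) ∣
      f.map (algebraMap R F) := by
    rw [h2]
    exact ((Polynomial.isUnit_C.2 (isUnit_iff_ne_zero.2 hQF)).mul_left_dvd).2 h1
  obtain ⟨g, hg⟩ := h3
  have hg' : g ∈ Polynomial.lifts (algebraMap R F) := by
    rw [← hprim.map_mul_mem_lifts_iff, ← hg]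
    exact ⟨f, rfl⟩
  obtain ⟨g', hg'⟩ := hg'
  refine ⟨g', Polynomial.map_injective _ (IsFractionRing.injective R F) ?_⟩
  rw [hg, Polynomial.map_mul, ← hg']
  rfl

end Gauss

/-! ### Extending embeddings and Galois descent. -/

section Galois

open IntermediateField

/-- An element fixed by all automorphisms has no conjugate but itself, so its separable degree is
one and it is purely inseparable over `F`. -/
theorem exists_pow_mem_of_fixed {F Ω : Type*} [Field F] [Field Ω] [Algebra F Ω] [IsAlgClosed Ω]
    [Algebra.IsAlgebraic F Ω] (q : ℕ) [ExpChar F q] {a : Ω} (h : ∀ s : Ω ≃ₐ[F] Ω, s a = a) :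
    ∃ n : ℕ, a ^ q ^ n ∈ (algebraMap F Ω).range := by
  classical
  have : Normal F Ω := normal_iff.2 fun x => ⟨(Algebra.IsAlgebraic.isAlgebraic x).isIntegral,
    IsAlgClosed.splits _⟩
  have hint : IsIntegral F a := (Algebra.IsAlgebraic.isAlgebraic a).isIntegral
  rw [← minpoly.natSepDegree_eq_one_iff_pow_mem q, Polynomial.natSepDegree_eq_of_isAlgClosed Ω,
    Finset.card_eq_one]
  refine ⟨a, ?_⟩
  ext b
  simp only [Multiset.mem_toFinset, Finset.mem_singleton]
  constructor
  · intro hb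
    have hb' := (Polynomial.mem_aroots.1 hb).2
    have : minpoly F a = minpoly F b :=
      minpoly.eq_of_irreducible_of_monic (minpoly.irreducible hint) hb' (minpoly.monic hint)
    obtain ⟨s, hs⟩ := (Normal.minpoly_eq_iff_mem_orbit (F := F) (E := Ω)).1 this
    have h1 : s b = a := hs
    have h2 := h s.symm
    rw [← h1] at h2 ⊢
    rw [AlgEquiv.symm_apply_apply] at h2
    exact h2
  · rintro rfl
    rw [Polynomial.mem_aroots]
    exact ⟨minpoly.ne_zero hint, minpoly.aeval _ _⟩

variable {k L Ω : Type*} [Field k] [Field L] [Field Ω] [Algebra k L] [Algebra k Ω]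

/-- `k(t)` and `k(τ)` are both isomorphic to `k(X)`; the resulting embedding of `k(t)` extends to
the algebraic extension `L`. -/
theorem exists_algHom_of_transcendental [IsAlgClosed Ω] {t : L} (ht : Transcendental k t)
    [Algebra.IsAlgebraic k⟮t⟯ L] {τ : Ω} (hτ : Transcendental k τ) :
    ∃ j : L →ₐ[k] Ω, j t = τ := by
  let f : k⟮t⟯ →ₐ[k] Ω := (IntermediateField.val _).comp
    ((RatFunc.algEquivOfTranscendental τ hτ).toAlgHom.comp
      (RatFunc.algEquivOfTranscendental t ht).symm.toAlgHom)
  let _ : Algebra k⟮t⟯ Ω := f.toRingHom.toAlgebra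
  have : IsScalarTower k k⟮t⟯ Ω := IsScalarTower.of_algebraMap_eq fun x => (f.commutes x).symm
  let j : L →ₐ[k⟮t⟯] Ω := IsAlgClosed.lift
  refine ⟨j.restrictScalars k, ?_⟩
  have h1 : j (algebraMap k⟮t⟯ L (AdjoinSimple.gen k t)) = f (AdjoinSimple.gen k t) :=
    j.commutes _
  have h2 : RatFunc.algEquivOfTranscendental t ht RatFunc.X = AdjoinSimple.gen k t := by
    apply Subtype.ext
    simp
  have h3 : f (AdjoinSimple.gen k t) = τ := by
    rw [← h2]
    simp [f]
  rw [h3] at h1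
  exact h1

theorem algHom_eq_on_adjoin_simple {t : L} (f g : L →ₐ[k] Ω) (h : f t = g t) (a : k⟮t⟯) :
    f a = g a := by
  obtain ⟨r, s, hrs⟩ := (mem_adjoin_simple_iff k (a : L)).1 a.2
  rw [hrs, map_div₀, map_div₀, ← Polynomial.aeval_algHom_apply, ← Polynomial.aeval_algHom_apply,
    ← Polynomial.aeval_algHom_apply, ← Polynomial.aeval_algHom_apply, h]

/-- `f` and `g` agree on `k(t)`, so `f a` is a root of the image under `g` of the minimal polynomial
of `a`. That polynomial already splits in `L`, and so `f a` is the image of one of its roots. -/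
theorem exists_eq_of_algHom_eq [IsAlgClosed L] {t : L} [Algebra.IsAlgebraic k⟮t⟯ L]
    (f g : L →ₐ[k] Ω) (h : f t = g t) (a : L) : ∃ b, g b = f a := by
  have hint : IsIntegral k⟮t⟯ a := (Algebra.IsAlgebraic.isAlgebraic a).isIntegral
  set p := minpoly k⟮t⟯ a
  have hmap : (p.map (algebraMap k⟮t⟯ L)).map (f : L →+* Ω) =
      (p.map (algebraMap k⟮t⟯ L)).map (g : L →+* Ω) := by
    rw [Polynomial.map_map, Polynomial.map_map]
    congr 1
    ext x
    exact algHom_eq_on_adjoin_simple f g h x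
  have h1 : Polynomial.eval (f a) ((p.map (algebraMap k⟮t⟯ L)).map (g : L →+* Ω)) = 0 := by
    rw [← hmap]
    have h2 : Polynomial.eval a (p.map (algebraMap k⟮t⟯ L)) = 0 := by
      rw [Polynomial.eval_map_algebraMap]
      exact minpoly.aeval _ _
    have h3 : f a = (f : L →+* Ω) a := rfl
    rw [h3, Polynomial.eval_map_apply, h2, map_zero]
  rw [(IsAlgClosed.splits (p.map (algebraMap k⟮t⟯ L))).eq_prod_roots_of_monic
    ((minpoly.monic hint).map _), Polynomial.map_multiset_prod, Polynomial.eval_multiset_prod,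
    Multiset.prod_eq_zero_iff] at h1
  simp only [Multiset.map_map, Multiset.mem_map] at h1
  obtain ⟨r, -, hr⟩ := h1
  refine ⟨r, ?_⟩
  simp at hr
  exact (sub_eq_zero.1 hr).symm

/-- Since `s` fixes `τ`, the embeddings `s ∘ j` and `j` agree at `t`, so `s` maps `j(L)` into
itself. The same holds for the inverse of `s`, which makes the restriction bijective. -/
theorem exists_ringEquiv_of_algEquiv [IsAlgClosed L] {F : Type*} [Field F] [Algebra F Ω]
    [Algebra k F] [IsScalarTower k F Ω] {t : L} [Algebra.IsAlgebraic k⟮t⟯ L] (j : L →ₐ[k] Ω) {τ : F}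
    (hj : j t = algebraMap F Ω τ) (s : Ω ≃ₐ[F] Ω) :
    ∃ e : L ≃ₐ[k] L, e t = t ∧ ∀ a, j (e a) = s (j a) := by
  have key : ∀ s : Ω ≃ₐ[F] Ω, ∃ e : L → L, ∀ a, j (e a) = s (j a) := by
    intro s
    have := exists_eq_of_algHom_eq (t := t) ((s.restrictScalars k).toAlgHom.comp j) j
      (by simp [hj])
    choose e he using this
    exact ⟨e, he⟩
  obtain ⟨e, he⟩ := key s
  obtain ⟨e', he'⟩ := key s.symm
  have hinj : Function.Injective j := j.injective
  refine ⟨AlgEquiv.ofBijective ⟨⟨⟨⟨e, ?_⟩, ?_⟩, ?_, ?_⟩, fun c => ?_⟩ ⟨?_, ?_⟩, ?_, he⟩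
  · apply hinj; rw [he]; simp
  · intro x y; apply hinj; simp [he]
  · apply hinj; simp [he]
  · intro x y; apply hinj; simp [he]
  · change e (algebraMap k L c) = algebraMap k L c
    apply hinj; rw [he, j.commutes, IsScalarTower.algebraMap_apply k F Ω, s.commutes]
  · intro x y hxy
    have : e x = e y := hxy
    apply hinj; apply s.injective; rw [← he, ← he, this]
  · intro y
    refine ⟨e' y, ?_⟩
    change e (e' y) = y
    apply hinj; rw [he, he']; simp
  · change e t = t
    apply hinj; rw [he, hj]; simp

end Galois

end MonSite

namespace MonSite

open IntermediateField

/-! ### The pencil `P + tQ` with transcendental parameter. -/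

section Pencil

variable {k L : Type*} [Field k] [Field L] [Algebra k L] {σ : Type*}

/-- The polynomial `P + t Q`, with coefficients in an extension of the base field. -/
noncomputable def pencil (t : L) (P Q : MvPolynomial σ k) : MvPolynomial σ L :=
  map (algebraMap k L) P + C t * map (algebraMap k L) Q

theorem mem_range_of_not_transcendental [IsAlgClosed k] {a : L} (h : ¬ Transcendental k a) :
    ∃ c, algebraMap k L c = a := by
  have hint : IsIntegral k a := (not_not.1 h : IsAlgebraic k a).isIntegral
  exact minpoly.mem_range_of_degree_eq_one k a
    (IsAlgClosed.degree_eq_one_of_irreducible k (minpoly.irreducible hint))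

theorem add_mul_eq_zero_iff {t : L} (ht : Transcendental k t) {a b : k} :
    algebraMap k L a + t * algebraMap k L b = 0 ↔ a = 0 ∧ b = 0 := by
  constructor
  · intro h
    have hb : b = 0 := by
      by_contra hb
      have hb' : algebraMap k L b ≠ 0 := by simpa using hb
      apply ht
      have : t = algebraMap k L (-a / b) := by
        rw [map_div₀, map_neg, eq_div_iff hb']
        linear_combination h
      rw [this]
      exact isAlgebraic_algebraMap _
    subst hb
    simpa using h
  · rintro ⟨rfl, rfl⟩
    simp

theorem coeff_pencil (t : L) (P Q : MvPolynomial σ k) (m : σ →₀ ℕ) :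
    coeff m (pencil t P Q) =
      algebraMap k L (coeff m P) + t * algebraMap k L (coeff m Q) := by
  simp [pencil, coeff_map, coeff_C_mul]

theorem mem_support_pencil {t : L} (ht : Transcendental k t) {P Q : MvPolynomial σ k}
    {m : σ →₀ ℕ} : m ∈ (pencil t P Q).support ↔ m ∈ P.support ∨ m ∈ Q.support := by
  simp only [mem_support_iff, coeff_pencil, Ne, add_mul_eq_zero_iff ht]
  tauto

theorem totalDegree_pencil {t : L} (ht : Transcendental k t) (P Q : MvPolynomial σ k) :
    (pencil t P Q).totalDegree = max P.totalDegree Q.totalDegree := by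
  classical
  have : (pencil t P Q).support = P.support ∪ Q.support := by
    ext m
    rw [mem_support_pencil ht, Finset.mem_union]
  rw [totalDegree, this, Finset.sup_union]
  rfl

theorem pderiv_pencil (t : L) (P Q : MvPolynomial σ k) (i : σ) :
    pderiv i (pencil t P Q) = pencil t (pderiv i P) (pderiv i Q) := by
  simp [pencil, pderiv_map]

end Pencil

/-! ### Evaluation at the generic point, and descent of a factor. -/

section GenericEval

variable {k L F Ω : Type*} [Field k] [Field L] [Field F] [Field Ω] [Algebra k L] {σ : Type*}
  [Algebra (MvPolynomial σ k) F] [IsFractionRing (MvPolynomial σ k) F] [Algebra k F]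
  [IsScalarTower k (MvPolynomial σ k) F] [Algebra F Ω] [Algebra k Ω] [IsScalarTower k F Ω]

variable (F) in
/-- Evaluation at the generic point. -/
noncomputable def genericEval (j : L →ₐ[k] Ω) : MvPolynomial σ L →+* Ω :=
  eval₂Hom (j : L →+* Ω) fun i => algebraMap F Ω (algebraMap (MvPolynomial σ k) F (X i))

omit [IsFractionRing (MvPolynomial σ k) F] in
theorem genericEval_map (j : L →ₐ[k] Ω) (f : MvPolynomial σ k) :
    genericEval F j (map (algebraMap k L) f) =
      algebraMap F Ω (algebraMap (MvPolynomial σ k) F f) := by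
  have : (genericEval F j).comp (map (algebraMap k L)) =
      (algebraMap F Ω).comp (algebraMap (MvPolynomial σ k) F) := by
    apply MvPolynomial.ringHom_ext
    · intro c
      simp only [genericEval, RingHom.comp_apply, map_C, coe_eval₂Hom, eval₂_C]
      change j (algebraMap k L c) = _
      rw [j.commutes, ← MvPolynomial.algebraMap_eq,
        ← IsScalarTower.algebraMap_apply k _ F, ← IsScalarTower.algebraMap_apply k F Ω]
    · intro i
      simp [genericEval]
  exact DFunLike.congr_fun this f

omit [IsFractionRing (MvPolynomial σ k) F] [Algebra k F] [IsScalarTower k (MvPolynomial σ k) F]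
  [IsScalarTower k F Ω] in
theorem genericEval_C (j : L →ₐ[k] Ω) (c : L) :
    genericEval F j (C c : MvPolynomial σ L) = j c := by
  simp [genericEval]

omit [IsFractionRing (MvPolynomial σ k) F] in
theorem genericEval_pencil (j : L →ₐ[k] Ω) {t : L} {τ : F} (hj : j t = algebraMap F Ω τ)
    (P Q : MvPolynomial σ k) :
    genericEval F j (pencil t P Q) = algebraMap F Ω (algebraMap (MvPolynomial σ k) F P +
      τ * algebraMap (MvPolynomial σ k) F Q) := by
  rw [pencil, map_add, map_mul, genericEval_map, genericEval_map, genericEval_C, hj, map_add,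
    map_mul]

omit [IsFractionRing (MvPolynomial σ k) F] [Algebra k F] [IsScalarTower k (MvPolynomial σ k) F]
  [IsScalarTower k F Ω] in
theorem genericEval_map_algEquiv (j : L →ₐ[k] Ω) (e : L ≃ₐ[k] L) (s : Ω ≃ₐ[F] Ω)
    (h : ∀ a, j (e a) = s (j a)) (f : MvPolynomial σ L) :
    genericEval F j (map (e : L →+* L) f) = s (genericEval F j f) := by
  have : (genericEval F j).comp (map (σ := σ) (e : L →+* L)) =
      (s : Ω →+* Ω).comp (genericEval F j) := by
    apply MvPolynomial.ringHom_ext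
    · intro c
      simp [genericEval, h]
    · intro i
      simp [genericEval]
  exact DFunLike.congr_fun this f

omit [IsFractionRing (MvPolynomial σ k) F] [IsScalarTower k (MvPolynomial σ k) F] in
/-- An irreducible factor which vanishes at the generic point is fixed by the Galois group if its
cofactor does not vanish there. -/
theorem coeff_fixed [IsAlgClosed L] {t : L} [Algebra.IsAlgebraic k⟮t⟯ L]
    (j : L →ₐ[k] Ω) {τ : F} (hj : j t = algebraMap F Ω τ) {P Q : MvPolynomial σ k}
    {A B : MvPolynomial σ L} (hA : Irreducible A) {m₀ : σ →₀ ℕ} (hm₀ : coeff m₀ A = 1)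
    (hAB : pencil t P Q = A * B) (hA0 : genericEval F j A = 0) (hB0 : genericEval F j B ≠ 0)
    (s : Ω ≃ₐ[F] Ω) (m : σ →₀ ℕ) : s (j (coeff m A)) = j (coeff m A) := by
  obtain ⟨e, het, he⟩ := exists_ringEquiv_of_algEquiv (F := F) j hj s
  set A' := map (e : L →+* L) A with hA'
  have hirr : Irreducible A' := by
    have := (MulEquiv.irreducible_iff (mapEquiv σ (e : L ≃+* L))).2 hA
    exact this
  have hF : map (e : L →+* L) (pencil t P Q) = pencil t P Q := by
    have h1 : (e : L →+* L).comp (algebraMap k L) = algebraMap k L := by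
      ext x
      simp
    simp only [pencil, map_add, map_mul, map_C, MvPolynomial.map_map, h1]
    simp [het]
  have hdvd : A' ∣ A * B := by
    rw [← hAB, ← hF, hAB, map_mul]
    exact dvd_mul_right _ _
  have hA'0 : genericEval F j A' = 0 := by
    rw [hA', genericEval_map_algEquiv j e s he, hA0, map_zero]
  have h1 : A' ∣ A := by
    refine (hirr.prime.dvd_or_dvd hdvd).resolve_right ?_
    rintro ⟨D, rfl⟩
    rw [map_mul, hA'0, zero_mul] at hB0
    exact hB0 rfl
  obtain ⟨u, hu⟩ := hirr.associated_of_dvd hA h1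
  obtain ⟨c, hc⟩ := (isUnit_iff_eq_C_of_isReduced.1 u.isUnit)
  -- `A` and its conjugate are associated; the coefficient normalized to `1` is unchanged by `e`, so
  -- the constant between them is `1`.
  have hc1 : c = 1 := by
    have := congrArg (coeff m₀) hu
    rw [hc.2, mul_comm, coeff_C_mul, hm₀, hA', coeff_map, hm₀, map_one, mul_one] at this
    exact this
  have hAA : A' = A := by
    rw [← hu, hc.2, hc1, C_1, mul_one]
  rw [← he]
  congr 1
  have := congrArg (coeff m) hAA
  rw [hA', coeff_map] at this
  exact this

/-- A power of a factor vanishing at the generic point whose coefficients are rational functions of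
`t` is a multiple of the whole polynomial. -/
theorem pencil_dvd_pow {t : L} (j : L →ₐ[k] Ω) {P Q : MvPolynomial σ k}
    (hPQ : IsRelPrime P Q) (hQ : Q ≠ 0) {τ : F}
    (hτ : τ = -(algebraMap (MvPolynomial σ k) F P / algebraMap (MvPolynomial σ k) F Q))
    (hτt : Transcendental k τ) (hj : j t = algebraMap F Ω τ) {A : MvPolynomial σ L}
    (hA0 : genericEval F j A = 0) {q : ℕ} [ExpChar L q] {N : ℕ} (b : (σ →₀ ℕ) → F)
    (hb : ∀ m, algebraMap F Ω (b m) = j (coeff m A) ^ q ^ N) (hbτ : ∀ m, b m ∈ k⟮τ⟯) :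
    pencil t P Q ∣ A ^ q ^ N := by
  classical
  let ε := RatFunc.algEquivOfTranscendental τ hτt
  -- The elements `b m` of `k(τ)` are read as rational functions; `V` clears their denominators and
  -- the `u m` are the resulting numerators.
  let ρ : (σ →₀ ℕ) → RatFunc k := fun m => ε.symm ⟨b m, hbτ m⟩
  obtain ⟨⟨V, hV⟩, hVs⟩ := IsLocalization.exist_integer_multiples_of_finset
    (nonZeroDivisors (Polynomial k)) (A.support.image ρ)
  have hV0 : V ≠ 0 := nonZeroDivisors.ne_zero hV
  have hu : ∀ m, ∃ u : Polynomial k, m ∈ A.support →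
      Polynomial.aeval τ u = Polynomial.aeval τ V * b m := by
    intro m
    by_cases hm : m ∈ A.support
    · obtain ⟨u, hu⟩ := hVs (ρ m) (Finset.mem_image_of_mem _ hm)
      refine ⟨u, fun _ => ?_⟩
      have h1 : algebraMap (Polynomial k) (RatFunc k) u =
          algebraMap (Polynomial k) (RatFunc k) V * ρ m := by
        rw [hu]
        exact Algebra.smul_def _ _
      have h2 := congrArg ε h1
      rw [map_mul, RatFunc.algEquivOfTranscendental_algebraMap,
        RatFunc.algEquivOfTranscendental_algebraMap, AlgEquiv.apply_symm_apply] at h2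
      have h3 := congrArg (algebraMap k⟮τ⟯ F) h2
      rw [map_mul, ← Polynomial.aeval_algebraMap_apply, ← Polynomial.aeval_algebraMap_apply] at h3
      exact h3
    · exact ⟨0, fun h => absurd h hm⟩
  choose u hu using hu
  have hjt : ∀ f : Polynomial k, j (Polynomial.aeval t f) = algebraMap F Ω (Polynomial.aeval τ f) := by
    intro f
    rw [← Polynomial.aeval_algHom_apply, hj, Polynomial.aeval_algebraMap_apply]
  have hVt : Polynomial.aeval t V ≠ 0 := by
    intro h0
    have := hjt V
    rw [h0, map_zero] at this
    exact hτt ⟨V, hV0, ((map_eq_zero _).1 this.symm)⟩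
  have hut : ∀ m ∈ A.support,
      Polynomial.aeval t (u m) = Polynomial.aeval t V * coeff m A ^ q ^ N := by
    intro m hm
    have hinj : Function.Injective j := j.injective
    apply hinj
    rw [map_mul, map_pow, hjt, hjt, hu m hm, map_mul, hb]
  let Φ : Polynomial (MvPolynomial σ k) →+* MvPolynomial σ L :=
    Polynomial.eval₂RingHom (map (algebraMap k L)) (C t)
  -- This is `V · A^(q^N)` with `t` replaced by a variable: Frobenius raises each coefficient of `A`
  -- to the power `q^N` and multiplies exponents by `q^N`. It has `τ` as a root because `A` vanishes
  -- at the generic point.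
  let G : Polynomial (MvPolynomial σ k) := ∑ m ∈ A.support,
    Polynomial.C (monomial (q ^ N • m) 1) * (u m).map C
  have hΦG : Φ G = C (Polynomial.aeval t V) * A ^ q ^ N := by
    have h1 : A ^ q ^ N = ∑ m ∈ A.support, monomial (q ^ N • m) (coeff m A ^ q ^ N) := by
      conv_lhs => rw [A.as_sum, sum_pow_char_pow q N]
      exact Finset.sum_congr rfl fun m _ => monomial_pow
    rw [h1, Finset.mul_sum, map_sum]
    refine Finset.sum_congr rfl fun m hm => ?_
    have h2 : ∀ f : Polynomial k, Φ (f.map C) = C (Polynomial.aeval t f) := by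
      intro f
      have : (Φ.comp (Polynomial.mapRingHom C)) = (C : L →+* MvPolynomial σ L).comp
          (Polynomial.aeval t : Polynomial k →ₐ[k] L).toRingHom := by
        apply Polynomial.ringHom_ext <;> simp [Φ]
      exact DFunLike.congr_fun this f
    rw [map_mul, h2, hut m hm]
    simp only [Φ, Polynomial.coe_eval₂RingHom, Polynomial.eval₂_C, map_monomial, map_one]
    rw [C_mul, mul_comm, mul_assoc, C_mul_monomial, mul_one]
  have hΦev : ∀ f, genericEval F j (Φ f) = algebraMap F Ω (Polynomial.aeval τ f) := by
    intro f
    have : (genericEval F j).comp Φ = (algebraMap F Ω).comp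
        (Polynomial.aeval τ : Polynomial (MvPolynomial σ k) →ₐ[MvPolynomial σ k] F).toRingHom := by
      apply Polynomial.ringHom_ext
      · intro a
        simp [Φ, genericEval_map]
      · simp [Φ, genericEval_C, hj]
    exact DFunLike.congr_fun this f
  have hroot : Polynomial.aeval τ G = 0 := by
    have h1 := hΦev G
    rw [hΦG, map_mul, map_pow, hA0, zero_pow (expChar_pow_pos L q N).ne', mul_zero] at h1
    exact (map_eq_zero _).1 h1.symm
  rw [hτ] at hroot
  obtain ⟨W, hW⟩ := linear_dvd_of_root hPQ hQ hroot
  have h1 : pencil t P Q ∣ C (Polynomial.aeval t V) * A ^ q ^ N := by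
    refine ⟨Φ W, ?_⟩
    rw [← hΦG, hW, map_mul]
    congr 1
    simp [Φ, pencil]
    ring
  exact (((isUnit_iff_ne_zero.2 hVt).map C).dvd_mul_left).1 h1

end GenericEval

end MonSite

namespace MonSite

open IntermediateField

/-! ### The Bertini-Krull theorem for linear pencils. -/

section Core

variable {k L F Ω : Type*} [Field k] [Field L] [Field F] [Field Ω] [Algebra k L] {σ : Type*}
  [Algebra (MvPolynomial σ k) F] [IsFractionRing (MvPolynomial σ k) F] [Algebra k F]
  [IsScalarTower k (MvPolynomial σ k) F] [Algebra F Ω] [Algebra k Ω] [IsScalarTower k F Ω]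

omit [Algebra k L] in
-- One of the irreducible factors must be killed by `ev`. Rescaling it to have a coefficient `1`
-- removes the constant ambiguity in later comparisons with its conjugates.
theorem exists_irreducible_factor_ker {f : MvPolynomial σ L} (hf : f ≠ 0) (hred : IsReducible f)
    (ev : MvPolynomial σ L →+* Ω) (h0 : ev f = 0) :
    ∃ (A B : MvPolynomial σ L) (m₀ : σ →₀ ℕ), Irreducible A ∧ coeff m₀ A = 1 ∧ f = A * B ∧
      ev A = 0 ∧ ¬ IsUnit B := by
  obtain ⟨s, hs, hsf⟩ := WfDvdMonoid.exists_factors f hf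
  obtain ⟨A, hA, hA0⟩ : ∃ A ∈ s, ev A = 0 := by
    obtain ⟨u, hu⟩ := hsf
    rw [← hu, map_mul, mul_eq_zero] at h0
    have h1 := h0.resolve_right (u.isUnit.map ev).ne_zero
    rw [map_multiset_prod, Multiset.prod_eq_zero_iff, Multiset.mem_map] at h1
    exact h1
  have hAi := hs A hA
  obtain ⟨B, hB⟩ : A ∣ f := (Multiset.dvd_prod hA).trans hsf.dvd
  obtain ⟨m₀, hm₀⟩ := exists_coeff_ne_zero hAi.ne_zero
  have hu : IsUnit (C (coeff m₀ A)⁻¹ : MvPolynomial σ L) :=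
    (isUnit_iff_ne_zero.2 (inv_ne_zero hm₀)).map C
  refine ⟨C (coeff m₀ A)⁻¹ * A, C (coeff m₀ A) * B, m₀, ?_, ?_, ?_, ?_, ?_⟩
  · exact (irreducible_isUnit_mul hu).2 hAi
  · rw [coeff_C_mul, inv_mul_cancel₀ hm₀]
  · rw [hB, mul_mul_mul_comm, ← C_mul, inv_mul_cancel₀ hm₀, C_1, one_mul]
  · rw [map_mul, hA0, mul_zero]
  · intro h
    have hBu := isUnit_of_mul_isUnit_right h
    obtain ⟨D, E, hD, hE, hDE⟩ := hred
    have hfi : Irreducible f := by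
      rw [hB]
      exact (irreducible_mul_isUnit hBu).2 hAi
    exact (hfi.isUnit_or_isUnit hDE).elim hD hE

/-- Transport of algebraicity along a homomorphism. -/
theorem isAlgebraic_of_algHom {t : L} [Algebra.IsAlgebraic k⟮t⟯ L] (ht : Transcendental k t)
    (j : L →ₐ[k] Ω) {τ : F} (hτ : Transcendental k τ) (hj : j t = algebraMap F Ω τ)
    {a : L} {b : F} (hb : algebraMap F Ω b = j a) : IsAlgebraic k⟮τ⟯ b := by
  let f : k⟮t⟯ →ₐ[k] k⟮τ⟯ := (RatFunc.algEquivOfTranscendental τ hτ).toAlgHom.comp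
      (RatFunc.algEquivOfTranscendental t ht).symm.toAlgHom
  have hcomp : ∀ x : k⟮t⟯, algebraMap F Ω (f x) = j x := by
    intro x
    obtain ⟨y, rfl⟩ := (RatFunc.algEquivOfTranscendental t ht).surjective x
    have h1 : (f (RatFunc.algEquivOfTranscendental t ht y) : F) =
        RatFunc.algEquivOfTranscendental τ hτ y := by
      simp [f]
    rw [h1, RatFunc.algEquivOfTranscendental_apply, RatFunc.algEquivOfTranscendental_apply,
      map_div₀, map_div₀, ← Polynomial.aeval_algebraMap_apply, ← Polynomial.aeval_algebraMap_apply,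
      ← hj, Polynomial.aeval_algHom_apply, Polynomial.aeval_algHom_apply]
  have h1 : IsAlgebraic k⟮τ⟯ (j a) := by
    refine (Algebra.IsAlgebraic.isAlgebraic (R := k⟮t⟯) a).ringHom_of_comp_eq
      (f : k⟮t⟯ →+* k⟮τ⟯) (j : L →+* Ω) f.injective ?_
    ext x
    exact hcomp x
  rw [← hb] at h1
  exact (isAlgebraic_algebraMap_iff (algebraMap F Ω).injective).1 h1

theorem algebraMap_aeval_homogenize (f : Polynomial k) {d : ℕ} (hd : f.natDegree ≤ d)
    (φ ψ : MvPolynomial σ k) (hψ : ψ ≠ 0) :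
    algebraMap (MvPolynomial σ k) F (aeval ![φ, ψ] (f.homogenize d)) =
      Polynomial.aeval (algebraMap (MvPolynomial σ k) F φ / algebraMap (MvPolynomial σ k) F ψ) f *
        algebraMap (MvPolynomial σ k) F ψ ^ d := by
  have hψF : algebraMap (MvPolynomial σ k) F ψ ≠ 0 := by simpa using hψ
  have h1 := Polynomial.eval_homogenize (p := f.map (algebraMap k F)) (n := d)
    (Polynomial.natDegree_map_le.trans hd)
    ![algebraMap (MvPolynomial σ k) F φ, algebraMap (MvPolynomial σ k) F ψ] (by simpa using hψF)
  simp only [Matrix.cons_val_zero, Matrix.cons_val_one, Polynomial.eval_map_algebraMap] at h1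
  rw [← h1, Polynomial.homogenize_map, eval_map, ← aeval_def,
    ← IsScalarTower.coe_toAlgHom' k (MvPolynomial σ k) F, ← AlgHom.comp_apply, comp_aeval]
  congr 2
  funext i
  fin_cases i <;> simp

/-- If `θ` generates a field containing `τ = f(θ) / g(θ)` with `f` and `g` of degree at most one,
then `τ` generates the same field. -/
theorem mem_adjoin_of_natDegree_le_one {θ τ : F} (hτ : Transcendental k τ)
    {f g : Polynomial k} (hf : f.natDegree ≤ 1) (hg : g.natDegree ≤ 1)
    (hg0 : Polynomial.aeval θ g ≠ 0)
    (h : τ = Polynomial.aeval θ f / Polynomial.aeval θ g) : θ ∈ k⟮τ⟯ := by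
  obtain ⟨f₁, f₀, rfl⟩ := Polynomial.exists_eq_X_add_C_of_natDegree_le_one hf
  obtain ⟨g₁, g₀, rfl⟩ := Polynomial.exists_eq_X_add_C_of_natDegree_le_one hg
  rw [eq_div_iff hg0] at h
  simp only [map_add, map_mul, Polynomial.aeval_C, Polynomial.aeval_X] at h hg0
  have h1 : τ * algebraMap k F g₁ - algebraMap k F f₁ ≠ 0 := by
    intro h0
    by_cases hg1 : g₁ = 0
    · subst hg1
      have hf1 : algebraMap k F f₁ = 0 := by simpa using h0
      simp only [map_zero, zero_mul, zero_add, hf1] at h hg0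
      apply hτ
      rw [eq_div_of_mul_eq hg0 h, ← map_div₀]
      exact isAlgebraic_algebraMap _
    · have hg1' : algebraMap k F g₁ ≠ 0 := by simpa using hg1
      apply hτ
      rw [eq_div_of_mul_eq hg1' (sub_eq_zero.1 h0), ← map_div₀]
      exact isAlgebraic_algebraMap _
  have h2 : θ = (algebraMap k F f₀ - τ * algebraMap k F g₀) /
      (τ * algebraMap k F g₁ - algebraMap k F f₁) := by
    rw [eq_div_iff h1]
    linear_combination h
  have hτm := mem_adjoin_simple_self k τ
  rw [h2]
  exact div_mem (sub_mem (_root_.algebraMap_mem _ _) (mul_mem hτm (_root_.algebraMap_mem _ _)))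
    (sub_mem (mul_mem hτm (_root_.algebraMap_mem _ _)) (_root_.algebraMap_mem _ _))

/-- An algebraic value would lie in `k`, making `P` a constant multiple of `Q`; by relative
primality both would then be constant. -/
theorem transcendental_div [IsAlgClosed k] {P Q : MvPolynomial σ k} (hPQ : IsRelPrime P Q)
    (hdeg : 0 < max P.totalDegree Q.totalDegree) (hQ : Q ≠ 0) :
    Transcendental k (-(algebraMap (MvPolynomial σ k) F P / algebraMap (MvPolynomial σ k) F Q)) := by
  by_contra h
  obtain ⟨c, hc⟩ := mem_range_of_not_transcendental h
  have hQF : algebraMap (MvPolynomial σ k) F Q ≠ 0 := by simpa using hQ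
  have h1 : P = C (-c) * Q := by
    apply IsFractionRing.injective (MvPolynomial σ k) F
    rw [map_mul, ← MvPolynomial.algebraMap_eq, ← IsScalarTower.algebraMap_apply, map_neg, hc,
      neg_neg, div_mul_cancel₀ _ hQF]
  have hu : IsUnit Q := hPQ (h1 ▸ dvd_mul_left _ _) dvd_rfl
  have hQ0 := (isUnit_iff_totalDegree hQ).1 hu
  have hP0 : P.totalDegree ≤ 0 := by
    rw [h1]
    refine (totalDegree_mul _ _).trans ?_
    rw [totalDegree_C, hQ0]
  omega

/-- If `-P/Q` is a rational function of degree `d` of `φ/ψ`, then `P` and `Q` are forms of degree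
`d` in `φ` and `ψ`. -/
theorem formIn_of_div_eq [Finite σ] [IsAlgClosed k] {P Q : MvPolynomial σ k} (hPQ : IsRelPrime P Q)
    (hdeg : 0 < max P.totalDegree Q.totalDegree) (hQ : Q ≠ 0) {θ : F}
    {f g : Polynomial k} (hfg : IsCoprime f g)
    (hg0 : Polynomial.aeval θ g ≠ 0)
    (h : -(algebraMap (MvPolynomial σ k) F P / algebraMap (MvPolynomial σ k) F Q) =
      Polynomial.aeval θ f / Polynomial.aeval θ g)
    (hd : 2 ≤ max f.natDegree g.natDegree) :
    ∃ (φ ψ : MvPolynomial σ k) (d : ℕ), IsRelPrime φ ψ ∧ FormIn d φ ψ P ∧ FormIn d φ ψ Q ∧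
      max φ.totalDegree ψ.totalDegree < max P.totalDegree Q.totalDegree := by
  have hτ := transcendental_div (F := F) hPQ hdeg hQ
  have hf0' : Polynomial.aeval θ f ≠ 0 := by
    intro h0
    rw [h, h0, zero_div] at hτ
    exact hτ isAlgebraic_zero
  have hQF : algebraMap (MvPolynomial σ k) F Q ≠ 0 := by simpa using hQ
  have hf0 : f ≠ 0 := by rintro rfl; simp at hf0'
  have hg0' : g ≠ 0 := by rintro rfl; simp at hg0
  obtain ⟨φ, ⟨ψ, hψ⟩, hφψ, hθ⟩ := IsFractionRing.exists_reduced_fraction (MvPolynomial σ k) θ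
  have hψ0 : ψ ≠ 0 := nonZeroDivisors.ne_zero hψ
  have hψF : algebraMap (MvPolynomial σ k) F ψ ≠ 0 := by simpa using hψ0
  rw [IsFractionRing.mk'_eq_div] at hθ
  change algebraMap _ F φ / algebraMap _ F ψ = θ at hθ
  change IsRelPrime φ ψ at hφψ
  set d := max f.natDegree g.natDegree with hd_def
  set G₁ := aeval ![φ, ψ] (f.homogenize d) with hG₁
  set G₂ := aeval ![φ, ψ] (g.homogenize d) with hG₂
  have e1 : algebraMap (MvPolynomial σ k) F G₁ = Polynomial.aeval θ f *
      algebraMap (MvPolynomial σ k) F ψ ^ d := by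
    rw [hG₁, algebraMap_aeval_homogenize f (le_max_left _ _) φ ψ hψ0, hθ]
  have e2 : algebraMap (MvPolynomial σ k) F G₂ = Polynomial.aeval θ g *
      algebraMap (MvPolynomial σ k) F ψ ^ d := by
    rw [hG₂, algebraMap_aeval_homogenize g (le_max_right _ _) φ ψ hψ0, hθ]
  have hG₁0 : G₁ ≠ 0 := by
    intro h0
    rw [h0, map_zero] at e1
    exact mul_ne_zero hf0' (pow_ne_zero _ hψF) e1.symm
  have hrel : IsRelPrime G₁ G₂ := isRelPrime_homogenize hfg hf0 hg0' hφψ hG₁0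
  -- `-P/Q` and `G₁/G₂` are equal fractions, both in lowest terms, so numerators and denominators
  -- agree up to units.
  have hmul : P * G₂ = -(Q * G₁) := by
    apply IsFractionRing.injective (MvPolynomial σ k) F
    rw [map_mul, map_neg, map_mul, e1, e2]
    rw [neg_eq_iff_eq_neg, div_eq_iff hQF] at h
    rw [h]
    field_simp
  have hPG : Associated G₁ P := by
    refine associated_of_dvd_dvd ?_ ?_
    · exact hrel.dvd_of_dvd_mul_right ⟨-Q, by rw [hmul]; ring⟩
    · exact hPQ.dvd_of_dvd_mul_left ⟨-G₂, by linear_combination hmul⟩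
  have hQG : Associated G₂ Q := by
    refine associated_of_dvd_dvd ?_ ?_
    · exact hrel.symm.dvd_of_dvd_mul_right ⟨-P, by linear_combination hmul⟩
    · exact hPQ.symm.dvd_of_dvd_mul_left ⟨-G₁, by rw [hmul]; ring⟩
  have key : ∀ {G P : MvPolynomial σ k}, Associated G P → FormIn d φ ψ G → FormIn d φ ψ P ∧
      P.totalDegree = G.totalDegree := by
    rintro G P ⟨u, hu⟩ hG
    obtain ⟨c, hc, huc⟩ := isUnit_iff_eq_C_of_isReduced.1 u.isUnit
    rw [huc, mul_comm] at hu
    refine ⟨hu ▸ hG.C_mul c, ?_⟩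
    rw [← hu]
    by_cases hG0 : G = 0
    · rw [hG0, mul_zero]
    · rw [totalDegree_mul_of_isDomain (by simpa using hc.ne_zero) hG0, totalDegree_C, zero_add]
  have k1 := key hPG (formIn_homogenize f d φ ψ)
  have k2 := key hQG (formIn_homogenize g d φ ψ)
  refine ⟨φ, ψ, d, hφψ, k1.1, k2.1, ?_⟩
  rw [k1.2, k2.2]
  rcases Nat.eq_zero_or_pos (max φ.totalDegree ψ.totalDegree) with h0 | h0
  · rw [k1.2, k2.2] at hdeg
    omega
  · have := le_max_totalDegree_homogenize hfg hf0 hg0' h0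
    rw [← hd_def, ← hG₁, ← hG₂] at this
    nlinarith

theorem totalDegree_pow_eq (φ : MvPolynomial σ k) (p : ℕ) :
    (φ ^ p).totalDegree = p * φ.totalDegree := by
  by_cases h0 : φ = 0
  · subst h0
    rcases p.eq_zero_or_pos with rfl | hp
    · simp
    · simp [hp.ne']
  · simpa using (totalDegree_prod_const (Multiset.replicate p φ) id φ.totalDegree
      fun i hi => by simp [Multiset.eq_of_mem_replicate hi, h0]).2

theorem formIn_of_pow {P Q φ ψ : MvPolynomial σ k} {p : ℕ} (hp : p.Prime) (hP : P = φ ^ p)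
    (hQ : Q = ψ ^ p) (hPQ : IsRelPrime P Q) (hdeg : 0 < max P.totalDegree Q.totalDegree) :
    IsRelPrime φ ψ ∧ FormIn p φ ψ P ∧ FormIn p φ ψ Q ∧
      max φ.totalDegree ψ.totalDegree < max P.totalDegree Q.totalDegree := by
  have hf1 := (formIn_left φ ψ).pow p
  have hf2 := (formIn_right φ ψ).pow p
  rw [one_mul, ← hP] at hf1
  rw [one_mul, ← hQ] at hf2
  have hdP : P.totalDegree = p * φ.totalDegree := by rw [hP, totalDegree_pow_eq]
  have hdQ : Q.totalDegree = p * ψ.totalDegree := by rw [hQ, totalDegree_pow_eq]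
  refine ⟨?_, hf1, hf2, ?_⟩
  · intro D h1 h2
    exact hPQ (hP ▸ h1.trans (dvd_pow_self _ hp.ne_zero)) (hQ ▸ h2.trans (dvd_pow_self _ hp.ne_zero))
  · have := hp.two_le
    have hm : max P.totalDegree Q.totalDegree = p * max φ.totalDegree ψ.totalDegree := by
      rw [hdP, hdQ, Nat.mul_max_mul_left]
    rw [hm] at hdeg ⊢
    have := pos_of_mul_pos_right hdeg p.zero_le
    nlinarith

/-- The theorem of Bertini and Krull for linear pencils. -/
theorem exists_formIn_of_isReducible [Finite σ] [IsAlgClosed k] [IsAlgClosed L] {t : L}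
    (ht : Transcendental k t) [Algebra.IsAlgebraic k⟮t⟯ L] {P Q : MvPolynomial σ k}
    (hPQ : IsRelPrime P Q) (hdeg : 0 < max P.totalDegree Q.totalDegree)
    (hred : IsReducible (pencil t P Q)) :
    ∃ (φ ψ : MvPolynomial σ k) (d : ℕ), IsRelPrime φ ψ ∧ FormIn d φ ψ P ∧ FormIn d φ ψ Q ∧
      max φ.totalDegree ψ.totalDegree < max P.totalDegree Q.totalDegree := by
  classical
  let F := FractionRing (MvPolynomial σ k)
  let Ω := AlgebraicClosure F
  have hQ : Q ≠ 0 := by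
    rintro rfl
    have hu : IsUnit P := hPQ dvd_rfl (dvd_zero _)
    rw [isUnit_iff_totalDegree_of_isReduced] at hu
    simp [hu.2] at hdeg
  obtain ⟨τ, hτ⟩ : ∃ τ : F, τ = -(algebraMap (MvPolynomial σ k) F P /
    algebraMap (MvPolynomial σ k) F Q) := ⟨_, rfl⟩
  have hτt : Transcendental k τ := hτ ▸ transcendental_div hPQ hdeg hQ
  have hQF : algebraMap (MvPolynomial σ k) F Q ≠ 0 := by simpa using hQ
  obtain ⟨j, hj⟩ := exists_algHom_of_transcendental (Ω := Ω) ht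
    ((transcendental_algebraMap_iff (algebraMap F Ω).injective).2 hτt)
  have hpen0 : pencil t P Q ≠ 0 := by
    intro h0
    have := totalDegree_pencil ht P Q
    rw [h0, totalDegree_zero] at this
    omega
  have hev0 : genericEval F j (pencil t P Q) = 0 := by
    rw [genericEval_pencil j hj, hτ, neg_mul, div_mul_cancel₀ _ hQF, add_neg_cancel, map_zero]
  obtain ⟨A, B, m₀, hA, hm₀, hAB, hA0, hB⟩ := exists_irreducible_factor_ker hpen0 hred _ hev0
  -- If both factors vanish, so does every partial derivative of the product: `∂P + τ ∂Q = 0` for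
  -- all variables, which is `d(P/Q) = 0`.
  by_cases hB0 : genericEval F j B = 0
  · obtain ⟨p, hp, φ, ψ, hφ, hψ⟩ := exists_pow_of_pderiv hPQ hdeg fun i => by
      have h1 : genericEval F j (pderiv i (pencil t P Q)) = 0 := by
        rw [hAB, pderiv_mul, map_add, map_mul, map_mul, hA0, hB0]
        simp
      rw [pderiv_pencil, genericEval_pencil j hj, map_eq_zero, hτ] at h1
      apply IsFractionRing.injective (MvPolynomial σ k) F
      rw [map_mul, map_mul]
      have h2 := div_mul_cancel₀ (algebraMap (MvPolynomial σ k) F P) hQF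
      linear_combination algebraMap (MvPolynomial σ k) F Q * h1 +
        algebraMap (MvPolynomial σ k) F (pderiv i Q) * h2
    exact ⟨φ, ψ, p, formIn_of_pow hp hφ hψ hPQ hdeg⟩
  · obtain ⟨q, hq⟩ := ExpChar.exists k
    have : ExpChar F q := expChar_of_injective_algebraMap (algebraMap k F).injective q
    have : ExpChar L q := expChar_of_injective_algebraMap (algebraMap k L).injective q
    have hpow : ∀ m, ∃ n : ℕ, j (coeff m A) ^ q ^ n ∈ (algebraMap F Ω).range := fun m =>
      exists_pow_mem_of_fixed q fun s => coeff_fixed j hj hA hm₀ hAB hA0 hB0 s m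
    choose n hn using hpow
    have hN : ∀ m, ∃ b : F, algebraMap F Ω b = j (coeff m A) ^ q ^ A.support.sup n := by
      intro m
      by_cases hm : m ∈ A.support
      · obtain ⟨b, hb⟩ := hn m
        refine ⟨b ^ q ^ (A.support.sup n - n m), ?_⟩
        rw [map_pow, hb, ← pow_mul, ← pow_add, Nat.add_sub_cancel' (Finset.le_sup hm)]
      · refine ⟨0, ?_⟩
        rw [notMem_support_iff.1 hm, map_zero, map_zero,
          zero_pow (expChar_pow_pos L q _).ne']
    choose b hb using hN
    set N := A.support.sup n
    have hbr : (Set.range b).Finite := by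
      refine ((A.support.finite_toSet.image b).union (Set.finite_singleton 0)).subset ?_
      rintro _ ⟨m, rfl⟩
      by_cases hm : m ∈ A.support
      · exact Or.inl ⟨m, hm, rfl⟩
      · right
        have h1 := hb m
        rw [notMem_support_iff.1 hm, map_zero, zero_pow (expChar_pow_pos L q _).ne',
          map_eq_zero] at h1
        exact h1
    have halg : ∀ a ∈ insert τ (Set.range b), IsAlgebraic k⟮τ⟯ a := by
      rintro _ (rfl | ⟨m, rfl⟩)
      · exact isAlgebraic_algebraMap (AdjoinSimple.gen k _)
      · exact isAlgebraic_of_algHom ht j hτt hj (a := coeff m A ^ q ^ N) (by rw [hb, map_pow])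
    obtain ⟨θ, hθ⟩ := exists_adjoin_simple (σ := σ) (hbr.insert τ) (Set.mem_insert _ _) hτt halg
    have hτθ : τ ∈ k⟮θ⟯ := hθ ▸ subset_adjoin _ _ (Set.mem_insert _ _)
    have hθt : Transcendental k θ := by
      intro h
      obtain ⟨c, hc⟩ := mem_range_of_not_transcendental (not_not.2 h)
      obtain ⟨r, s, hrs⟩ := (mem_adjoin_simple_iff k τ).1 hτθ
      apply hτt
      rw [hrs, ← hc, Polynomial.aeval_algebraMap_apply, Polynomial.aeval_algebraMap_apply,
        ← map_div₀]
      exact isAlgebraic_algebraMap _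
    obtain ⟨u, hu⟩ := (RatFunc.algEquivOfTranscendental θ hθt).surjective ⟨τ, hτθ⟩
    have hu' : τ = Polynomial.aeval θ u.num / Polynomial.aeval θ u.denom := by
      rw [← RatFunc.algEquivOfTranscendental_apply θ hθt, hu]
    have hg0 : Polynomial.aeval θ u.denom ≠ 0 := fun h0 => hθt ⟨_, u.denom_ne_zero, h0⟩
    -- Degree at most one would give `k(θ) = k(τ)`, so that the powers `b m` of the coefficients of
    -- `A` would be rational in `τ`.
    rcases Nat.lt_or_ge (max u.num.natDegree u.denom.natDegree) 2 with hd | hd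
    · exfalso
      have hθτ : θ ∈ k⟮τ⟯ := mem_adjoin_of_natDegree_le_one hτt (by omega) (by omega) hg0 hu'
      have hbτ : ∀ m, b m ∈ k⟮τ⟯ := by
        intro m
        have h1 : b m ∈ k⟮θ⟯ :=
          hθ ▸ subset_adjoin _ _ (Set.mem_insert_of_mem _ (Set.mem_range_self m))
        exact (adjoin_simple_le_iff.2 hθτ) h1
      have hdvd := pencil_dvd_pow j hPQ hQ hτ hτt hj hA0 b hb hbτ
      have hB0' : B ≠ 0 := by
        rintro rfl
        exact hpen0 (by rw [hAB, mul_zero])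
      -- An irreducible factor of `B` divides a power of `A`, so it is associated to `A`. Then `A`
      -- divides `B`, against the nonvanishing of `B`.
      obtain ⟨D, hD, hDB⟩ := WfDvdMonoid.exists_irreducible_factor hB hB0'
      have hDA : D ∣ A := hD.prime.dvd_of_dvd_pow
        ((hDB.trans (hAB ▸ dvd_mul_left B A)).trans hdvd)
      obtain ⟨E, hE⟩ := ((hD.associated_of_dvd hA hDA).symm.dvd).trans hDB
      exact hB0 (by rw [hE, map_mul, hA0, zero_mul])
    · exact formIn_of_div_eq hPQ hdeg hQ u.isCoprime_num_denom hg0 (hτ ▸ hu') hd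

end Core

end MonSite

namespace MonSite

/-! ### Divisibility of monomials, and supports and degrees of forms. -/

section Monomials

variable {k : Type*} [Field k] {σ : Type*}

theorem monomial_dvd_iff {m : σ →₀ ℕ} {f : MvPolynomial σ k} :
    monomial m (1 : k) ∣ f ↔ ∀ m' ∈ f.support, m ≤ m' := by
  constructor
  · rintro ⟨g, rfl⟩ m' hm'
    by_contra h
    rw [mem_support_iff, coeff_monomial_mul', if_neg h] at hm'
    exact hm' rfl
  · intro h
    rw [f.as_sum]
    exact Finset.dvd_sum fun m' hm' => monomial_dvd_monomial.2 ⟨Or.inr (h m' hm'), one_dvd _⟩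

theorem isUnit_monomial_iff {m : σ →₀ ℕ} : IsUnit (monomial m (1 : k)) ↔ m = 0 := by
  constructor
  · intro h
    have := monomial_one_dvd_monomial_one.1
      ((isUnit_iff_dvd_one.1 h) : monomial m (1 : k) ∣ monomial 0 1)
    exact le_antisymm this zero_le
  · rintro rfl
    exact isUnit_one

theorem eq_C_mul_monomial_of_dvd {D : MvPolynomial σ k} {e : σ →₀ ℕ} (h : D ∣ monomial e 1) :
    ∃ m ≤ e, ∃ c : k, c ≠ 0 ∧ D = C c * monomial m 1 := by
  obtain ⟨m, u, hm, hu, rfl⟩ := dvd_monomial_one_iff_exists.1 h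
  exact ⟨m, hm, u, hu.ne_zero, by rw [C_mul_monomial, mul_one]⟩

theorem isUnit_C {c : k} (hc : c ≠ 0) : IsUnit (C c : MvPolynomial σ k) :=
  (isUnit_iff_ne_zero.2 hc).map C

theorem isRelPrime_monomial_iff {a b : σ →₀ ℕ} :
    IsRelPrime (monomial a (1 : k)) (monomial b 1) ↔ ∀ i, a i = 0 ∨ b i = 0 := by
  constructor
  · intro h i
    by_contra! hi
    have hx : IsUnit (monomial (Finsupp.single i 1) (1 : k)) := by
      apply h <;> rw [monomial_one_dvd_monomial_one, Finsupp.single_le_iff] <;> omega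
    rw [isUnit_monomial_iff] at hx
    simp at hx
  · intro h D h1 h2
    obtain ⟨m, hm, c, hc, rfl⟩ := eq_C_mul_monomial_of_dvd h1
    have h3 := (isUnit_C hc).mul_left_dvd.1 h2
    rw [monomial_one_dvd_monomial_one] at h3
    have : m = 0 := by
      ext i
      have := hm i
      have := h3 i
      have := h i
      simp
      omega
    subst this
    exact (isUnit_C hc).mul isUnit_one

theorem monomial_smul_add (a b : σ →₀ ℕ) (i j : ℕ) :
    monomial (i • a + j • b) (1 : k) = monomial a 1 ^ i * monomial b 1 ^ j := by
  simp [monomial_pow, monomial_mul]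

theorem FormIn.support {d : ℕ} {a b : σ →₀ ℕ} {P : MvPolynomial σ k}
    (h : FormIn d (monomial a 1) (monomial b 1) P) {m : σ →₀ ℕ} (hm : m ∈ P.support) :
    ∃ i ≤ d, m = i • a + (d - i) • b := by
  classical
  obtain ⟨c, rfl⟩ := h.exists_sum
  by_contra! hne
  rw [mem_support_iff] at hm
  apply hm
  rw [coeff_sum]
  refine Finset.sum_eq_zero fun i hi => ?_
  rw [← monomial_smul_add, C_mul_monomial, coeff_monomial, if_neg]
  exact fun h => hne i (by simp at hi; omega) h.symm

theorem formIn_of_support {d : ℕ} {a b : σ →₀ ℕ} {P : MvPolynomial σ k}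
    (h : ∀ m ∈ P.support, ∃ i ≤ d, m = i • a + (d - i) • b) :
    FormIn d (monomial a 1) (monomial b 1) P := by
  rw [P.as_sum]
  refine formIn_sum _ fun m hm => ?_
  obtain ⟨i, hi, hm'⟩ := h m hm
  have := (formIn_pow_mul_pow (monomial a (1 : k)) (monomial b 1) hi).C_mul (coeff m P)
  rwa [← monomial_smul_add, C_mul_monomial, mul_one, ← hm'] at this

theorem FormIn.totalDegree_le {d : ℕ} {φ ψ P : MvPolynomial σ k} (h : FormIn d φ ψ P) :
    P.totalDegree ≤ d * max φ.totalDegree ψ.totalDegree := by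
  obtain ⟨c, rfl⟩ := h.exists_sum
  refine totalDegree_finsetSum_le fun i hi => ?_
  refine (totalDegree_mul _ _).trans ?_
  rw [totalDegree_C, zero_add]
  refine (totalDegree_mul _ _).trans ((add_le_add (totalDegree_pow _ _)
    (totalDegree_pow _ _)).trans ?_)
  have h1 : i + (d - i) = d := by simp at hi; omega
  calc _ ≤ i * max φ.totalDegree ψ.totalDegree + (d - i) * max φ.totalDegree ψ.totalDegree :=
        add_le_add (Nat.mul_le_mul_left _ (le_max_left _ _))
          (Nat.mul_le_mul_left _ (le_max_right _ _))
    _ = _ := by rw [← add_mul, h1]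

theorem FormIn.two_le {d : ℕ} {φ ψ P : MvPolynomial σ k} (h : FormIn d φ ψ P)
    (hd : max φ.totalDegree ψ.totalDegree < P.totalDegree) : 2 ≤ d := by
  have := h.totalDegree_le
  by_contra h2
  have h3 : d ≤ 1 := by omega
  have := Nat.mul_le_mul_right (max φ.totalDegree ψ.totalDegree) h3
  omega

theorem totalDegree_map_algebraMap {L : Type*} [Field L] (f : k →+* L) (P : MvPolynomial σ k) :
    (map f P).totalDegree = P.totalDegree := by
  rw [totalDegree, totalDegree, support_map_of_injective _ f.injective]

end Monomials

/-! ### Indecomposable pairs and pencils containing a monomial. -/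

section Indec

variable {k : Type*} [Field k] {σ : Type*}

/-- The pair `φ, ψ` is not a pair of forms in a pair of polynomials of smaller degree. -/
def Indec (φ ψ : MvPolynomial σ k) : Prop :=
  ∀ (φ' ψ' : MvPolynomial σ k) (d : ℕ), IsRelPrime φ' ψ' → FormIn d φ' ψ' φ → FormIn d φ' ψ' ψ →
    max φ.totalDegree ψ.totalDegree ≤ max φ'.totalDegree ψ'.totalDegree

/-- Take a pair of least degree in which `P` and `Q` are forms of equal degree. Forms in forms are
forms, so lowering this pair would contradict minimality. -/
theorem exists_indec {P Q : MvPolynomial σ k} (h : IsRelPrime P Q) :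
    ∃ (φ ψ : MvPolynomial σ k) (d : ℕ), IsRelPrime φ ψ ∧ FormIn d φ ψ P ∧ FormIn d φ ψ Q ∧
      Indec φ ψ ∧ max φ.totalDegree ψ.totalDegree ≤ max P.totalDegree Q.totalDegree := by
  let S : Set ℕ := {N | ∃ (φ ψ : MvPolynomial σ k) (d : ℕ), IsRelPrime φ ψ ∧ FormIn d φ ψ P ∧
    FormIn d φ ψ Q ∧ max φ.totalDegree ψ.totalDegree = N}
  have hS : max P.totalDegree Q.totalDegree ∈ S :=
    ⟨P, Q, 1, h, formIn_left _ _, formIn_right _ _, rfl⟩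
  obtain ⟨φ, ψ, d, h1, h2, h3, h4⟩ := Nat.sInf_mem ⟨_, hS⟩
  refine ⟨φ, ψ, d, h1, h2, h3, fun φ' ψ' d' h1' h2' h3' => ?_, h4 ▸ Nat.sInf_le hS⟩
  rw [h4]
  exact Nat.sInf_le ⟨φ', ψ', _, h1', h2.trans h2' h3', h3.trans h2' h3', rfl⟩

variable {L : Type*} [Field L] [Algebra k L]

/-- This is Bertini-Krull read backwards; with `indec_of_irreducible` it identifies maximality with
indecomposability. -/
theorem Indec.irreducible [Finite σ] [IsAlgClosed k] [IsAlgClosed L] {φ ψ : MvPolynomial σ k}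
    (h : Indec φ ψ) (hrel : IsRelPrime φ ψ) (hdeg : 0 < max φ.totalDegree ψ.totalDegree)
    {t : L} (ht : Transcendental k t)
    [Algebra.IsAlgebraic (IntermediateField.adjoin k {t}) L] : Irreducible (pencil t φ ψ) := by
  refine ⟨fun hu => ?_, fun a b hab => ?_⟩
  · rw [isUnit_iff_totalDegree_of_isReduced, totalDegree_pencil ht] at hu
    omega
  · by_contra! hab'
    obtain ⟨φ', ψ', d, h1, h2, h3, h4⟩ := exists_formIn_of_isReducible ht hrel hdeg
      ⟨a, b, hab'.1, hab'.2, hab⟩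
    exact absurd (h φ' ψ' d h1 h2 h3) (not_le.2 h4)

/-- A lower pair would turn the pencil into a form in polynomials of smaller degree, and such a form
splits. -/
theorem indec_of_irreducible [IsAlgClosed L] {φ ψ : MvPolynomial σ k} {t : L}
    (ht : Transcendental k t) (h : Irreducible (pencil t φ ψ)) : Indec φ ψ := by
  intro φ' ψ' d h1 h2 h3
  by_contra! h4
  have hF : FormIn d (map (algebraMap k L) φ') (map (algebraMap k L) ψ') (pencil t φ ψ) :=
    (h2.map _).add ((h3.map _).C_mul t)
  obtain ⟨a, b, ha, hb, hab⟩ := hF.isReducible (by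
    rwa [totalDegree_map_algebraMap, totalDegree_map_algebraMap, totalDegree_pencil ht])
  exact (h.isUnit_or_isUnit hab).elim ha hb

theorem FormIn.lin_change {d : ℕ} {φ ψ P : MvPolynomial σ k} (hP : FormIn d φ ψ P) {v w : k × k}
    (h : v.1 * w.2 - v.2 * w.1 ≠ 0) : FormIn d (lin v φ ψ) (lin w φ ψ) P := by
  obtain ⟨a, b, ha, hb⟩ := lin_swap_det h φ ψ
  have h1 : FormIn 1 (lin v φ ψ) (lin w φ ψ) φ := by
    conv => arg 4; rw [ha]
    exact formIn_lin _ _ _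
  have h2 : FormIn 1 (lin v φ ψ) (lin w φ ψ) ψ := by
    conv => arg 4; rw [hb]
    exact formIn_lin _ _ _
  have := hP.trans h1 h2
  rwa [one_mul] at this

theorem Indec.lin_change {φ ψ : MvPolynomial σ k} (hi : Indec φ ψ) {v w : k × k}
    (h : v.1 * w.2 - v.2 * w.1 ≠ 0) : Indec (lin v φ ψ) (lin w φ ψ) := by
  intro φ' ψ' d h1 h2 h3
  rw [max_totalDegree_lin h]
  obtain ⟨a, b, ha, hb⟩ := lin_swap_det h φ ψ
  refine hi φ' ψ' d h1 ?_ ?_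
  · rw [ha]
    exact (h2.C_mul _).add (h3.C_mul _)
  · rw [hb]
    exact (h2.C_mul _).add (h3.C_mul _)

theorem isRelPrime_lin_change {φ ψ : MvPolynomial σ k} (hi : IsRelPrime φ ψ) {v w : k × k}
    (h : v.1 * w.2 - v.2 * w.1 ≠ 0) : IsRelPrime (lin v φ ψ) (lin w φ ψ) := by
  intro D h1 h2
  obtain ⟨h3, h4⟩ := dvd_of_dvd_lin h h1 h2
  exact hi h3 h4

theorem exists_det_ne_zero {v : k × k} (hv : v ≠ 0) : ∃ w : k × k, v.1 * w.2 - v.2 * w.1 ≠ 0 := by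
  by_cases h : v.1 = 0
  · refine ⟨(1, 0), ?_⟩
    have : v.2 ≠ 0 := fun h2 => hv (Prod.ext h h2)
    simpa using this
  · exact ⟨(0, 1), by simpa using h⟩

theorem exists_smul_of_det_eq_zero {v w : k × k} (hv : v ≠ 0) (h : v.1 * w.2 - v.2 * w.1 = 0) :
    ∃ r : k, w = r • v := by
  by_cases h1 : v.1 = 0
  · have h2 : v.2 ≠ 0 := fun h2 => hv (Prod.ext h1 h2)
    refine ⟨w.2 / v.2, Prod.ext ?_ ?_⟩
    · rw [h1] at h
      have : w.1 = 0 := by simpa [h2] using h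
      simp [this, h1]
    · simp [h2]
  · refine ⟨w.1 / v.1, Prod.ext ?_ ?_⟩
    · simp [h1]
    · simp only [Prod.smul_snd, smul_eq_mul]
      field_simp
      linear_combination h

theorem lin_smul (r : k) (v : k × k) (φ ψ : MvPolynomial σ k) :
    lin (r • v) φ ψ = C r * lin v φ ψ := by
  simp [lin]
  ring

/-- If a product of linear forms in `φ, ψ` is a monomial, then either two of its factors are
independent monomials or it is a power of one of them. -/
theorem FormIn.monomial_cases [IsAlgClosed k] {d : ℕ} {φ ψ : MvPolynomial σ k} {e : σ →₀ ℕ}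
    (h : FormIn d φ ψ (monomial e (1 : k))) (hd : d ≠ 0) :
    ∃ (v w : k × k) (a : σ →₀ ℕ), v.1 * w.2 - v.2 * w.1 ≠ 0 ∧ lin v φ ψ = monomial a 1 ∧
      ((∃ b, lin w φ ψ = monomial b 1) ∨ e = d • a) := by
  obtain ⟨c, s, hc, hcard, hs, hP⟩ := h.exists_prod (by simp)
  -- Each linear factor divides a monomial, so it is a monomial up to a constant, which `r` removes.
  have key : ∀ v ∈ s, ∃ (r : k) (a : σ →₀ ℕ), r ≠ 0 ∧ lin (r • v) φ ψ = monomial a 1 := by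
    intro v hv
    have : lin v φ ψ ∣ monomial e 1 := by
      rw [hP]
      exact (Multiset.dvd_prod (Multiset.mem_map_of_mem _ hv)).mul_left _
    obtain ⟨m, -, b, hb, hm⟩ := eq_C_mul_monomial_of_dvd this
    refine ⟨b⁻¹, m, inv_ne_zero hb, ?_⟩
    rw [lin_smul, hm, ← mul_assoc, ← MvPolynomial.C_mul, inv_mul_cancel₀ hb, C_1, one_mul]
  obtain ⟨v, hv⟩ : ∃ v, v ∈ s := by
    apply Multiset.card_pos_iff_exists_mem.1
    omega
  obtain ⟨r, a, hr, ha⟩ := key v hv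
  by_cases hw : ∃ w ∈ s, v.1 * w.2 - v.2 * w.1 ≠ 0
  · obtain ⟨w, hw, hdet⟩ := hw
    obtain ⟨r', b, hr', hb⟩ := key w hw
    refine ⟨r • v, r' • w, a, ?_, ha, Or.inl ⟨b, hb⟩⟩
    have : (r • v).1 * (r' • w).2 - (r • v).2 * (r' • w).1 =
        r * r' * (v.1 * w.2 - v.2 * w.1) := by
      simp
      ring
    rw [this]
    exact mul_ne_zero (mul_ne_zero hr hr') hdet
  -- All linear factors are proportional, so the monomial is the `d`-th power of one of them; `w`
  -- only completes `v` to a basis.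
  · push Not at hw
    have hrv : r • v ≠ 0 := smul_ne_zero hr (hs v hv)
    obtain ⟨w, hdet⟩ := exists_det_ne_zero hrv
    refine ⟨r • v, w, a, hdet, ha, Or.inr ?_⟩
    have h1 : ∀ w ∈ s, ∃ x : k, lin w φ ψ = C x * monomial a 1 := by
      intro w hws
      obtain ⟨x, hx⟩ := exists_smul_of_det_eq_zero hrv (w := w) (by
        simp only [Prod.smul_fst, Prod.smul_snd, smul_eq_mul]
        linear_combination r * hw w hws)
      refine ⟨x, ?_⟩
      rw [hx, lin_smul, ha]
    have h2 : ∀ t : Multiset (k × k), (∀ w ∈ t, w ∈ s) →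
        ∃ x : k, (t.map fun w => lin w φ ψ).prod = C x * monomial (t.card • a) 1 := by
      intro t
      induction t using Multiset.induction_on with
      | empty => exact fun _ => ⟨1, by simp⟩
      | cons u t ih =>
        intro ht
        obtain ⟨x, hx⟩ := ih fun w hw => ht w (by simp [hw])
        obtain ⟨y, hy⟩ := h1 u (ht u (by simp))
        refine ⟨y * x, ?_⟩
        rw [Multiset.map_cons, Multiset.prod_cons, hx, hy, Multiset.card_cons]
        simp only [C_mul_monomial, monomial_mul, mul_one, add_smul, one_smul]
        rw [add_comm]
    obtain ⟨x, hx⟩ := h2 s fun _ h => h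
    rw [hx, hcard, ← mul_assoc, ← MvPolynomial.C_mul, C_mul_monomial, mul_one] at hP
    rcases (monomial_eq_monomial_iff _ _ _ _).1 hP with h | h
    · exact h.1
    · exact absurd h.1 one_ne_zero

/-- The analysis of a reducible pencil generated by a polynomial and a monomial. -/
theorem pencil_monomial_cases [Finite σ] [IsAlgClosed k] [IsAlgClosed L] {t : L}
    (ht : Transcendental k t)
    [Algebra.IsAlgebraic (IntermediateField.adjoin k {t}) L] {P : MvPolynomial σ k}
    {e : σ →₀ ℕ} (hPQ : IsRelPrime P (monomial e 1))
    (hdeg : 0 < max P.totalDegree (monomial e (1 : k)).totalDegree)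
    (hred : IsReducible (pencil t P (monomial e 1))) :
    ∃ (a : σ →₀ ℕ) (ψ : MvPolynomial σ k) (d : ℕ), IsRelPrime (monomial a 1) ψ ∧
      Indec (monomial a 1) ψ ∧ FormIn d (monomial a 1) ψ P ∧
      FormIn d (monomial a 1) ψ (monomial e (1 : k)) ∧ 2 ≤ d ∧
      max (monomial a (1 : k)).totalDegree ψ.totalDegree <
        max P.totalDegree (monomial e (1 : k)).totalDegree ∧
      ((∃ b, ψ = monomial b 1) ∨ e = d • a) := by
  obtain ⟨φ₀, ψ₀, d₀, h1, h2, h3, h4⟩ := exists_formIn_of_isReducible ht hPQ hdeg hred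
  obtain ⟨φ, ψ, d, h1', h2', h3', h4', h5'⟩ := exists_indec h1
  have hP := h2.trans h2' h3'
  have hQ := h3.trans h2' h3'
  have hlt := h5'.trans_lt h4
  set D := d * d₀
  have hD : 2 ≤ D := by
    rcases lt_max_iff.1 hlt with h | h
    · exact hP.two_le h
    · exact hQ.two_le h
  obtain ⟨v, w, a, hdet, ha, hb⟩ := hQ.monomial_cases (by omega)
  have hm := max_totalDegree_lin hdet φ ψ
  have h6 := h4'.lin_change hdet
  have h7 := isRelPrime_lin_change h1' hdet
  have h8 := hP.lin_change hdet
  have h9 := hQ.lin_change hdet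
  rw [ha] at hm h6 h7 h8 h9
  exact ⟨a, lin w φ ψ, D, h7, h6, h8, h9, hD, hm ▸ hlt, hb⟩

end Indec

end MonSite

namespace MonSite

open IntermediateField

/-! ### Singling out one indeterminate. -/

section GenField

variable {K : Type*} [Field K] {ι : Type*}

theorem algebraicIndependent_lam : AlgebraicIndependent K (lam K : ι → GenField K ι) := by
  have h1 := MvPolynomial.algebraicIndependent_X ι K
  have hinj : Function.Injective
      (algebraMap (MvPolynomial ι K) (GenField K ι)) := by
    rw [IsScalarTower.algebraMap_eq (MvPolynomial ι K) (FractionRing (MvPolynomial ι K))]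
    exact (algebraMap (FractionRing (MvPolynomial ι K)) (GenField K ι)).injective.comp
      (IsFractionRing.injective _ _)
  have h2 := h1.map' (f := IsScalarTower.toAlgHom K (MvPolynomial ι K) (GenField K ι)) hinj
  convert! h2 using 1

/-- If `k` contains the other indeterminates, `k(λ_i)` contains all of `K(λ)`, over which the big
field is algebraic. -/
theorem isAlgebraic_adjoin_lam {k : Type*} [Field k] [Algebra K k] [Algebra k (GenField K ι)]
    [IsScalarTower K k (GenField K ι)] (i : ι)
    (hi : ∀ j ≠ i, lam K j ∈ (algebraMap k (GenField K ι)).range) :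
    Algebra.IsAlgebraic k⟮(lam K i : GenField K ι)⟯ (GenField K ι) := by
  have hmem : ∀ x : FractionRing (MvPolynomial ι K), algebraMap _ (GenField K ι) x ∈
      k⟮(lam K i : GenField K ι)⟯ := by
    have hpol : ∀ f : MvPolynomial ι K, algebraMap (FractionRing (MvPolynomial ι K))
        (GenField K ι) (algebraMap _ _ f) ∈ k⟮(lam K i : GenField K ι)⟯ := by
      intro f
      induction f using MvPolynomial.induction_on with
      | C c =>
        rw [← MvPolynomial.algebraMap_eq, ← IsScalarTower.algebraMap_apply,
          ← IsScalarTower.algebraMap_apply, IsScalarTower.algebraMap_apply K k (GenField K ι)]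
        exact _root_.algebraMap_mem _ _
      | add f g hf hg =>
        rw [map_add, map_add]
        exact add_mem hf hg
      | mul_X f j hf =>
        rw [map_mul, map_mul]
        refine mul_mem hf ?_
        by_cases hj : j = i
        · subst hj
          exact mem_adjoin_simple_self k _
        · obtain ⟨c, hc⟩ := hi j hj
          have : algebraMap k (GenField K ι) c ∈ k⟮(lam K i : GenField K ι)⟯ :=
            _root_.algebraMap_mem _ _
          rw [hc] at this
          exact this
    intro x
    obtain ⟨a, b, -, rfl⟩ := IsFractionRing.div_surjective (MvPolynomial ι K) x
    rw [map_div₀]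
    exact div_mem (hpol a) (hpol b)
  let f : FractionRing (MvPolynomial ι K) →+* k⟮(lam K i : GenField K ι)⟯ :=
    (algebraMap _ (GenField K ι)).codRestrict k⟮(lam K i : GenField K ι)⟯ hmem
  refine ⟨fun a => ?_⟩
  have h1 := Algebra.IsAlgebraic.isAlgebraic (R := FractionRing (MvPolynomial ι K)) a
  exact h1.ringHom_of_comp_eq f (RingHom.id (GenField K ι)) f.injective rfl

/-- The relative algebraic closure of `K(λ_j : j ≠ i)` serves: it is algebraically closed because
the big field is, and `λ_i` stays transcendental by algebraic independence. -/
theorem exists_subfield (i : ι) : ∃ k : IntermediateField K (GenField K ι), IsAlgClosed k ∧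
    Transcendental k (lam K i) ∧ ∀ j ≠ i, lam K j ∈ k := by
  let F := IntermediateField.adjoin K ((lam K : ι → GenField K ι) '' {i}ᶜ)
  let k₀ := algebraicClosure F (GenField K ι)
  refine ⟨k₀.restrictScalars K, ?_, ?_, ?_⟩
  · exact (algebraicClosure.isAlgClosure (F := F) (E := GenField K ι)).isAlgClosed
  · have h1 : Transcendental (Algebra.adjoin K ((lam K : ι → GenField K ι) '' {i}ᶜ)) (lam K i) :=
      algebraicIndependent_lam.transcendental_adjoin (by simp)
    have h2 : Transcendental F (lam K i : GenField K ι) := by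
      open scoped algebraAdjoinAdjoin in
      intro h
      exact h1 ((IsFractionRing.isAlgebraic_iff (Algebra.adjoin K _) F (GenField K ι)).2 h)
    intro h
    have h3 : IsAlgebraic k₀ (lam K i : GenField K ι) := h
    exact h2 (h3.restrictScalars F)
  · intro j hj
    have h1 : (lam K j : GenField K ι) ∈ F := subset_adjoin _ _ ⟨j, hj, rfl⟩
    change (lam K j : GenField K ι) ∈ k₀
    exact _root_.algebraMap_mem k₀ (⟨_, h1⟩ : F)

theorem transcendental_lam (i : ι) : Transcendental K (lam K i : GenField K ι) :=
  algebraicIndependent_lam.transcendental i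

end GenField

/-! ### Support and degree of `F`, and `F` as a pencil. -/

section SitePoly

variable {K : Type*} [Field K] {n : ℕ} {P : MvPolynomial (Fin n) K} {S : Finset (Fin n →₀ ℕ)}

theorem coeff_sitePoly_of_mem {m : Fin n →₀ ℕ} (hm : m ∈ S) :
    coeff m (sitePoly P S) = algebraMap K _ (coeff m P) + lam K (⟨m, hm⟩ : S) := by
  classical
  simp only [sitePoly, genericPoly, coeff_add, coeff_map, coeff_sum, coeff_C_mul, mono,
    coeff_monomial]
  congr 1
  rw [Finset.sum_eq_single (⟨m, hm⟩ : S)]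
  · simp
  · intro b _ hb
    rw [if_neg, map_zero, mul_zero]
    exact fun h => hb (Subtype.ext h)
  · simp

theorem coeff_sitePoly_of_notMem {m : Fin n →₀ ℕ} (hm : m ∉ S) :
    coeff m (sitePoly P S) = algebraMap K _ (coeff m P) := by
  classical
  simp only [sitePoly, genericPoly, coeff_add, coeff_map, coeff_sum, coeff_C_mul, mono,
    coeff_monomial]
  rw [Finset.sum_eq_zero, add_zero]
  intro b _
  rw [if_neg, map_zero, mul_zero]
  exact fun h => hm (h ▸ b.2)

theorem mem_support_sitePoly {m : Fin n →₀ ℕ} :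
    m ∈ (sitePoly P S).support ↔ m ∈ P.support ∨ m ∈ S := by
  rw [mem_support_iff, mem_support_iff]
  by_cases hm : m ∈ S
  · rw [coeff_sitePoly_of_mem hm]
    refine iff_of_true (fun h => ?_) (Or.inr hm)
    have := (add_mul_eq_zero_iff (transcendental_lam (K := K) (⟨m, hm⟩ : S))
      (a := coeff m P) (b := 1)).1 (by simpa using h)
    exact one_ne_zero this.2
  · rw [coeff_sitePoly_of_notMem hm]
    simp [hm]

theorem totalDegree_mono (e : Fin n →₀ ℕ) : (mono K e).totalDegree = e.sum fun _ => id :=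
  totalDegree_monomial _ one_ne_zero

theorem Admissible.totalDegree_sitePoly (h : Admissible P S) :
    (sitePoly P S).totalDegree = P.totalDegree := by
  apply le_antisymm
  · refine Finset.sup_le fun m hm => ?_
    rcases mem_support_sitePoly.1 hm with h1 | h1
    · exact le_totalDegree h1
    · have := h.degree_le m h1
      rwa [totalDegree_mono] at this
  · exact Finset.sup_mono fun m hm => mem_support_sitePoly.2 (Or.inl hm)

/-- The `λ_i` prevent cancellation, so the support of `F` is the union of the support of `P` and
`S`. A monomial dividing all its terms is thus a common divisor of `P` and the `Q_i`. -/
theorem Admissible.eq_zero_of_le (h : Admissible P S) {m : Fin n →₀ ℕ}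
    (h1 : ∀ m' ∈ (sitePoly P S).support, m ≤ m') : m = 0 := by
  rw [← isUnit_monomial_iff (k := K)]
  apply h.relPrime
  · exact monomial_dvd_iff.2 fun m' hm' => h1 m' (mem_support_sitePoly.2 (Or.inl hm'))
  · exact fun e he => monomial_one_dvd_monomial_one.2 (h1 e (mem_support_sitePoly.2 (Or.inr he)))

/-- One of the indeterminates is singled out. -/
theorem exists_pencil_eq {k : IntermediateField K (GenField K S)} (i : S)
    (hi : ∀ j ≠ i, lam K j ∈ k) :
    ∃ P' : MvPolynomial (Fin n) k, pencil (lam K i) P' (monomial i.1 1) = sitePoly P S := by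
  classical
  refine ⟨map (algebraMap K k) P + ∑ j ∈ (Finset.univ.erase i).attach,
    C (⟨lam K j.1, hi j.1 (Finset.ne_of_mem_erase j.2)⟩ : k) * monomial j.1.1 1, ?_⟩
  rw [sitePoly, genericPoly, ← Finset.add_sum_erase _ _ (Finset.mem_univ i), pencil,
    ← Finset.sum_attach (Finset.univ.erase i), map_add, map_sum, MvPolynomial.map_map,
    ← IsScalarTower.algebraMap_eq]
  simp only [map_mul, map_C, map_monomial, map_one, mono]
  rw [add_assoc]
  congr 1
  rw [add_comm]
  rfl

/-- Joint primality over `K` passes to the pencil over `k`: a common divisor of its two members is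
essentially a monomial, and it divides `F`. -/
theorem pencil_isRelPrime {k : Type*} [Field k] [Algebra k (GenField K S)] (h : Admissible P S)
    {P' : MvPolynomial (Fin n) k} {t : GenField K S} {e : Fin n →₀ ℕ}
    (hP' : pencil t P' (monomial e 1) = sitePoly P S) : IsRelPrime P' (monomial e 1) := by
  intro D h1 h2
  obtain ⟨m, -, c, hc, rfl⟩ := eq_C_mul_monomial_of_dvd h2
  have h3 := (isUnit_C hc).mul_left_dvd.1 h1
  have h4 := (isUnit_C hc).mul_left_dvd.1 h2
  have h5 : monomial m (1 : GenField K S) ∣ sitePoly P S := by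
    rw [← hP', pencil]
    have : monomial m (1 : GenField K S) = map (algebraMap k (GenField K S)) (monomial m 1) := by
      simp
    rw [this]
    exact dvd_add (map_dvd _ h3) ((map_dvd _ h4).mul_left _)
  have h6 := h.eq_zero_of_le (monomial_dvd_iff.1 h5)
  subst h6
  exact (isUnit_C hc).mul isUnit_one

end SitePoly

end MonSite

namespace MonSite

open IntermediateField

section Forms

variable {k : Type*} [Field k] {σ : Type*}

theorem FormIn.symm {d : ℕ} {φ ψ P : MvPolynomial σ k} (h : FormIn d φ ψ P) :
    FormIn d ψ φ P := by
  simpa [lin] using h.lin_change (v := (0, 1)) (w := (1, 0)) (by simp)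

theorem Indec.symm {φ ψ : MvPolynomial σ k} (h : Indec φ ψ) : Indec ψ φ := by
  intro φ' ψ' d h1 h2 h3
  rw [max_comm]
  exact h φ' ψ' d h1 h3 h2

theorem dvd_of_mem_support_pow {p : ℕ} (hp : p.Prime) [CharP k p] {P : MvPolynomial σ k}
    {m : σ →₀ ℕ} (hm : m ∈ (P ^ p).support) (i : σ) : p ∣ m i := by
  classical
  have : Fact p.Prime := ⟨hp⟩
  rw [P.as_sum, sum_pow_char p, mem_support_iff, coeff_sum] at hm
  obtain ⟨m', -, hm'⟩ := Finset.exists_ne_zero_of_sum_ne_zero hm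
  rw [monomial_pow, coeff_monomial] at hm'
  have : p • m' = m := by
    by_contra h
    exact hm' (if_neg h)
  exact ⟨m' i, by rw [← this]; rfl⟩

end Forms

/-! ### Factoring a pencil whose monomial member is a power. -/

section Pencil

variable {k L : Type*} [Field k] [Field L] [Algebra k L] {σ : Type*}

theorem isAlgebraic_adjoin_of_mem {t u : L} [Algebra.IsAlgebraic k⟮t⟯ L] (h : t ∈ k⟮u⟯) :
    Algebra.IsAlgebraic k⟮u⟯ L := by
  have hle : k⟮t⟯ ≤ k⟮u⟯ := adjoin_simple_le_iff.2 h
  refine ⟨fun a => ?_⟩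
  exact (Algebra.IsAlgebraic.isAlgebraic (R := k⟮t⟯) a).ringHom_of_comp_eq
    (inclusion hle).toRingHom (RingHom.id L) (inclusion hle).toRingHom.injective rfl

/-- The factorization of a pencil generated by a form in `ψ` and a monomial `m`, and by a power
of `m`. -/
theorem exists_prod_pencil [Finite σ] [IsAlgClosed k] [IsAlgClosed L] {t : L}
    (ht : Transcendental k t) [Algebra.IsAlgebraic k⟮t⟯ L] {P ψ : MvPolynomial σ k} {a : σ →₀ ℕ}
    {d : ℕ} (hrel : IsRelPrime (monomial a 1) ψ) (hind : Indec (monomial a 1) ψ)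
    (hdeg : 0 < max (monomial a (1 : k)).totalDegree ψ.totalDegree)
    (hP : FormIn d (monomial a 1) ψ P)
    (hF0 : pencil t P (monomial (d • a) 1) ≠ 0)
    (hdvd : monomial a 1 ∣ pencil t P (monomial (d • a) 1) → a = 0) :
    ∃ (c : L) (s : Multiset L), c ≠ 0 ∧ (a ≠ 0 → s.card = d) ∧
      (∀ u ∈ s, Irreducible (pencil u ψ (monomial a 1))) ∧
      pencil t P (monomial (d • a) 1) =
        C c * (s.map fun u => pencil u ψ (monomial a 1)).prod ∧
      (2 ≤ s.card → (∀ u ∈ s, ∀ u' ∈ s, u = u') → (s.card : k) = 0) := by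
  obtain ⟨f, hfd, hf⟩ := hP.symm.exists_homogenize
  set ψL := map (algebraMap k L) ψ
  have hmL : map (algebraMap k L) (monomial a 1) = monomial a (1 : L) := by simp
  -- In the variables `ψ, m`, adding `t m^d` to `P` adds the constant `t` to the dehomogenized
  -- polynomial `f`.
  set g : Polynomial L := f.map (algebraMap k L) + Polynomial.C t with hg
  have hgd : g.natDegree ≤ d := by
    refine (Polynomial.natDegree_add_le _ _).trans (max_le ?_ (by simp))
    exact Polynomial.natDegree_map_le.trans hfd
  have hmap : ∀ f : Polynomial k, map (algebraMap k L)
      (aeval ![ψ, monomial a 1] (f.homogenize d)) =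
      aeval ![ψL, monomial a 1] ((f.map (algebraMap k L)).homogenize d) := by
    intro f
    rw [Polynomial.homogenize_map, ← hmL, aeval_def, aeval_def, eval₂_map, ← MvPolynomial.coe_eval₂Hom,
      ← MvPolynomial.coe_eval₂Hom, map_eval₂Hom]
    congr 1
    congr 1
    · ext; simp [algebraMap_eq]
    · ext i; fin_cases i <;> rfl
  have hFg : pencil t P (monomial (d • a) 1) = aeval ![ψL, monomial a 1] (g.homogenize d) := by
    rw [hg, Polynomial.homogenize_add, map_add, ← hmap, ← hf, pencil]
    congr 1
    rw [Polynomial.homogenize_C, map_mul, map_pow]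
    simp [algebraMap_eq, monomial_pow]
  have hg0 : g ≠ 0 := by
    intro h0
    rw [hFg, h0] at hF0
    simp at hF0
  have hlin : ∀ r : L, lin (1, -r) ψL (monomial a 1) = pencil (-r) ψ (monomial a 1) := by
    intro r
    simp [lin, pencil, ψL]
  have hcard := (IsAlgClosed.splits g).natDegree_eq_card_roots
  have hprod : pencil t P (monomial (d • a) 1) = C g.leadingCoeff *
      ((g.roots.map fun r => pencil (-r) ψ (monomial a 1)).prod *
        monomial a 1 ^ (d - g.natDegree)) := by
    rw [hFg, aeval_homogenize_eq_prod hgd, linFactors, Multiset.map_add, Multiset.prod_add,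
      Multiset.map_map, Multiset.map_replicate, Multiset.prod_replicate]
    simp only [Function.comp_def, hlin]
    simp [lin]
  have hN : a ≠ 0 → g.natDegree = d := by
    intro ha
    by_contra hne
    apply ha
    apply hdvd
    rw [hprod]
    exact ((dvd_pow_self _ (by omega)).mul_left _).mul_left _
  -- From `t = -f(r)` the root `r` is not in `k`, and `L` is algebraic over `k(r)`. So the pencil `ψ
  -- - r m` has a generic parameter, and indecomposability makes it irreducible.
  have hroot : ∀ r ∈ g.roots, Transcendental k r ∧ t ∈ k⟮-r⟯ := by
    intro r hr
    have h1 : Polynomial.eval r g = 0 := Polynomial.isRoot_of_mem_roots hr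
    rw [hg, Polynomial.eval_add, Polynomial.eval_C, Polynomial.eval_map_algebraMap] at h1
    have h2 : t = -Polynomial.aeval r f := by linear_combination h1
    constructor
    · by_contra h
      obtain ⟨c, rfl⟩ := mem_range_of_not_transcendental h
      rw [Polynomial.aeval_algebraMap_apply, ← map_neg] at h2
      rw [h2] at ht
      exact ht (isAlgebraic_algebraMap _)
    · rw [h2]
      have h3 : r ∈ k⟮-r⟯ := by simpa using neg_mem (mem_adjoin_simple_self k (-r))
      have h4 := Polynomial.aeval_algebraMap_apply L (⟨r, h3⟩ : k⟮-r⟯) f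
      change Polynomial.aeval r f = ((Polynomial.aeval (⟨r, h3⟩ : k⟮-r⟯) f : k⟮-r⟯) : L) at h4
      rw [h4]
      exact neg_mem (SetLike.coe_mem _)
  refine ⟨g.leadingCoeff, g.roots.map fun r => -r, by simpa using hg0, ?_, ?_, ?_, ?_⟩
  · intro ha
    rw [Multiset.card_map, ← hcard, hN ha]
  · intro u hu
    obtain ⟨r, hr, rfl⟩ := Multiset.mem_map.1 hu
    obtain ⟨h1, h2⟩ := hroot r hr
    have := isAlgebraic_adjoin_of_mem h2
    refine hind.symm.irreducible hrel.symm (by rwa [max_comm]) (t := -r) ?_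
    intro h
    exact h1 (by simpa using h.neg)
  · rw [hprod, Multiset.map_map]
    congr 1
    by_cases ha : a = 0
    · simp [ha]
    · rw [hN ha, Nat.sub_self, pow_zero, mul_one]
      rfl
  · intro h2 hall
    rw [Multiset.card_map] at h2 ⊢
    obtain ⟨r, hr⟩ := Multiset.card_pos_iff_exists_mem.1 (by omega : 0 < g.roots.card)
    have h3 : g.roots = Multiset.replicate g.natDegree r := by
      rw [Multiset.eq_replicate]
      refine ⟨hcard.symm, fun r' hr' => ?_⟩
      have := hall (-r') (Multiset.mem_map_of_mem _ hr') (-r) (Multiset.mem_map_of_mem _ hr)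
      exact neg_injective this
    have h4 := (IsAlgClosed.splits g).eq_prod_roots
    rw [h3, Multiset.map_replicate, Multiset.prod_replicate] at h4
    rw [← hcard] at h2 ⊢
    -- Only the constant coefficient of `g` involves `t`. If `g = c (X - r)^N` with `N ≥ 2`, then
    -- both `c` and the next coefficient `-N r c` lie in `k`; so `r` would lie in `k` unless `N = 0`
    -- there.
    have h5 : ∀ j, j ≠ 0 → g.coeff j = algebraMap k L (f.coeff j) := by
      intro j hj
      simp [hg, Polynomial.coeff_C, hj]
    have h6 := congrArg (fun q => q.coeff (g.natDegree - 1)) h4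
    simp only [Polynomial.coeff_C_mul, sub_eq_add_neg, ← Polynomial.C_neg,
      Polynomial.coeff_X_add_C_pow] at h6
    rw [Nat.choose_symm (by omega), Nat.choose_one_right,
      show g.natDegree - (g.natDegree - 1) = 1 by omega, pow_one, h5 _ (by omega),
      Polynomial.leadingCoeff, h5 _ (by omega)] at h6
    by_contra hne
    have h7 : f.coeff g.natDegree ≠ 0 := by
      intro h
      have := h5 g.natDegree (by omega)
      rw [h, map_zero] at this
      exact hg0 (Polynomial.leadingCoeff_eq_zero.1 this)
    have h8 : r = algebraMap k L (-(f.coeff (g.natDegree - 1)) /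
        (f.coeff g.natDegree * g.natDegree)) := by
      have h7' : algebraMap k L (f.coeff g.natDegree) ≠ 0 := by simpa using h7
      have hne' : (g.natDegree : L) ≠ 0 := by
        rw [← map_natCast (algebraMap k L), Ne, map_eq_zero]
        exact hne
      rw [map_div₀, map_neg, map_mul, map_natCast, h6]
      field_simp
    rw [h8] at hr
    exact (hroot _ hr).1 (isAlgebraic_algebraMap _)

end Pencil

/-! ### The trichotomy for reducibility monomial sites. -/

section SiteCases

variable {K : Type*} [Field K] {n : ℕ} {P : MvPolynomial (Fin n) K} {S : Finset (Fin n →₀ ℕ)}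

/-- The exponents of `P` and those in `S` are divisible by the characteristic. -/
def DivCase (P : MvPolynomial (Fin n) K) (S : Finset (Fin n →₀ ℕ)) : Prop :=
  ∃ p : ℕ, p.Prime ∧ CharP K p ∧ ∀ m, m ∈ P.support ∨ m ∈ S → ∀ i, p ∣ m i

/-- `P` and the monomials in `S` are forms of the same degree in two monomials. -/
def TwoCase (P : MvPolynomial (Fin n) K) (S : Finset (Fin n →₀ ℕ)) : Prop :=
  ∃ (a b : Fin n →₀ ℕ) (d : ℕ), 2 ≤ d ∧ (∀ i, a i = 0 ∨ b i = 0) ∧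
    (∀ m, m ∈ P.support ∨ m ∈ S → ∃ i ≤ d, m = i • a + (d - i) • b) ∧
    max (mono K a).totalDegree (mono K b).totalDegree < P.totalDegree

/-- `S` consists of the power of one monomial, and `P` is a form in it and another polynomial. -/
def SingleCase (P : MvPolynomial (Fin n) K) (S : Finset (Fin n →₀ ℕ)) : Prop :=
  ∃ (a : Fin n →₀ ℕ) (ψ : MvPolynomial (Fin n) K) (d : ℕ), 2 ≤ d ∧ S = {d • a} ∧
    IsRelPrime (mono K a) ψ ∧ Indec (mono K a) ψ ∧ FormIn d (mono K a) ψ P ∧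
    max (mono K a).totalDegree ψ.totalDegree < P.totalDegree

theorem Admissible.ne_zero_sitePoly (h : Admissible P S) : sitePoly P S ≠ 0 := by
  obtain ⟨e, he⟩ := h.nonempty
  exact fun h0 => by simpa [h0] using (mem_support_sitePoly (P := P)).2 (Or.inr he)

theorem Admissible.twoCase (h : Admissible P S) {a b : Fin n →₀ ℕ} {d : ℕ} (hd : 2 ≤ d)
    (hF : FormIn d (monomial a 1) (monomial b 1) (sitePoly P S))
    (ha : (mono K a).totalDegree < P.totalDegree) (hb : (mono K b).totalDegree < P.totalDegree) :
    TwoCase P S := by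
  refine ⟨a, b, d, hd, fun l => ?_, fun m hm => hF.support (mem_support_sitePoly.2 hm),
    max_lt ha hb⟩
  by_contra! hl
  have := h.eq_zero_of_le (m := Finsupp.single l 1) fun m hm => by
    obtain ⟨i, hi, rfl⟩ := hF.support hm
    rw [Finsupp.single_le_iff]
    simp only [Finsupp.add_apply, Finsupp.smul_apply, smul_eq_mul]
    have h1 : 1 ≤ a l := by omega
    have h2 : 1 ≤ b l := by omega
    have h3 := Nat.mul_le_mul_left i h1
    have h4 := Nat.mul_le_mul_left (d - i) h2
    omega
  simp at this

/-- `F` is viewed as a pencil in `λ_i` over a field containing the other indeterminates. The third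
case keeps only what survives in the big field, so that factorizations for different `i` can be
compared. -/
theorem Admissible.factor_cases (hP : 0 < P.totalDegree) (h : Admissible P S)
    (hred : IsReducible (sitePoly P S)) (i : S) :
    DivCase P S ∨ TwoCase P S ∨
    ∃ (a : Fin n →₀ ℕ) (d : ℕ) (ψ : MvPolynomial (Fin n) (GenField K S)) (c : GenField K S)
      (s : Multiset (GenField K S)), c ≠ 0 ∧ i.1 = d • a ∧ (a ≠ 0 → s.card = d) ∧ 2 ≤ s.card ∧
      (mono K a).totalDegree < P.totalDegree ∧
      (∀ u ∈ s, Irreducible (ψ + C u * monomial a 1)) ∧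
      sitePoly P S = C c * (s.map fun u => ψ + C u * monomial a 1).prod ∧
      ∃ u ∈ s, ∃ u' ∈ s, u ≠ u' := by
  obtain ⟨k, hk, ht, hi⟩ := exists_subfield (K := K) i
  obtain ⟨P', hP'⟩ := exists_pencil_eq (P := P) i hi
  have halg : Algebra.IsAlgebraic k⟮(lam K i : GenField K S)⟯ (GenField K S) :=
    isAlgebraic_adjoin_lam i fun j hj => ⟨⟨_, hi j hj⟩, rfl⟩
  have hdeg := totalDegree_pencil ht P' (monomial i.1 1)
  rw [hP', h.totalDegree_sitePoly] at hdeg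
  obtain ⟨a, ψ, d, h1, h2, h3, h4, h5, h6, h7⟩ := pencil_monomial_cases ht
    (pencil_isRelPrime h hP') (hdeg ▸ hP) (by rwa [hP'])
  rw [← hdeg] at h6
  have hma : (mono K a).totalDegree = (monomial a (1 : k)).totalDegree := by
    rw [totalDegree_mono, totalDegree_monomial _ one_ne_zero]; rfl
  rcases h7 with ⟨b, rfl⟩ | h7
  · right; left
    refine h.twoCase h5 (a := a) (b := b) ?_ ?_ ?_
    · have := (h3.map (algebraMap k (GenField K S))).add
        ((h4.map (algebraMap k (GenField K S))).C_mul (lam K i))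
      rw [← pencil, hP'] at this
      simpa using this
    · rw [hma]; exact (le_max_left _ _).trans_lt h6
    · have hmb : (mono K b).totalDegree = (monomial b (1 : k)).totalDegree := by
        rw [totalDegree_mono, totalDegree_monomial _ one_ne_zero]; rfl
      rw [hmb]; exact (le_max_right _ _).trans_lt h6
  have hF0 := h.ne_zero_sitePoly
  have hdeg' : 0 < max (monomial a (1 : k)).totalDegree ψ.totalDegree := by
    by_contra h0
    have h8 := h3.totalDegree_le
    have h9 := h4.totalDegree_le
    simp only [Nat.eq_zero_of_not_pos h0, mul_zero] at h8 h9
    omega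
  rw [h7] at hP'
  obtain ⟨c, s, hc, hs, hirr, hprod, hall⟩ := exists_prod_pencil ht h1 h2 hdeg' h3
    (by rwa [hP']) (fun hd => h.eq_zero_of_le (monomial_dvd_iff.1 (hP' ▸ hd)))
  rw [hP'] at hprod
  have hcard : 2 ≤ s.card := by
    by_contra hlt
    have h01 : s.card = 0 ∨ s.card = 1 := by omega
    obtain ⟨A, B, hA, hB, hAB⟩ := hred
    rcases h01 with h01 | h01
    · rw [Multiset.card_eq_zero.1 h01] at hprod
      have := h.totalDegree_sitePoly
      rw [hprod] at this
      simp at this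
      omega
    · obtain ⟨u, rfl⟩ := Multiset.card_eq_one.1 h01
      have h8 := hirr u (by simp)
      rw [hprod] at hAB
      simp only [Multiset.map_singleton, Multiset.prod_singleton] at hAB
      rw [← irreducible_isUnit_mul (isUnit_C hc)] at h8
      exact (h8.isUnit_or_isUnit hAB).elim hA hB
  -- If all factors coincide, their number vanishes in `k`, hence is a multiple of the
  -- characteristic `p > 0`. Then `F` is a constant times a `p`-th power and its exponents are
  -- multiples of `p`.
  by_cases hne : ∃ u ∈ s, ∃ u' ∈ s, u ≠ u'
  · refine Or.inr (Or.inr ⟨a, d, map (algebraMap k _) ψ, c, s, hc, h7, hs, hcard, ?_, ?_, ?_, hne⟩)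
    · rw [hma]; exact (le_max_left _ _).trans_lt h6
    · intro u hu
      simpa [pencil] using hirr u hu
    · simpa [pencil] using hprod
  · left
    push Not at hne
    have hN := hall hcard hne
    obtain ⟨p, hp⟩ := CharP.exists K
    have hpk : CharP k p := charP_of_injective_algebraMap (algebraMap K k).injective p
    have hpL : CharP (GenField K S) p :=
      charP_of_injective_algebraMap (algebraMap K (GenField K S)).injective p
    have hpN : p ∣ s.card := (CharP.cast_eq_zero_iff k p _).1 hN
    have hpp : p.Prime := by
      refine (CharP.char_is_prime_or_zero K p).resolve_right ?_
      rintro rfl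
      rw [zero_dvd_iff] at hpN
      omega
    refine ⟨p, hpp, hp, fun m hm => ?_⟩
    obtain ⟨u, hu⟩ := Multiset.card_pos_iff_exists_mem.1 (by omega : 0 < s.card)
    have hsr : s = Multiset.replicate s.card u := Multiset.eq_replicate.2
      ⟨rfl, fun u' hu' => hne _ hu' _ hu⟩
    rw [hsr, Multiset.map_replicate, Multiset.prod_replicate] at hprod
    obtain ⟨N, hN⟩ := hpN
    rw [hN, mul_comm p, pow_mul] at hprod
    have h8 := mem_support_sitePoly.2 hm
    rw [hprod, mem_support_iff, coeff_C_mul] at h8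
    exact dvd_of_mem_support_pow hpp (mem_support_iff.2 (right_ne_zero_of_mul h8))

/-- A singleton site is a pencil over `K` itself. With two elements in `S`, uniqueness of the
factorization of `F` is played against its two descriptions by `factor_cases`. -/
theorem Admissible.site_cases [IsAlgClosed K] (hP : 0 < P.totalDegree) (h : Admissible P S)
    (hred : IsReducible (sitePoly P S)) : DivCase P S ∨ TwoCase P S ∨ SingleCase P S := by
  obtain ⟨e, he⟩ := h.nonempty
  by_cases hS : ∀ e' ∈ S, e' = e
  · have hSe : S = {e} := by
      ext x
      simp only [Finset.mem_singleton]
      exact ⟨hS x, fun h => h ▸ he⟩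
    subst hSe
    let i : ({e} : Finset (Fin n →₀ ℕ)) := ⟨e, he⟩
    have hu : ∀ j : ({e} : Finset (Fin n →₀ ℕ)), j = i := fun j =>
      Subtype.ext (Finset.mem_singleton.1 j.2)
    have hF : pencil (lam K i) P (monomial e 1) = sitePoly P {e} := by
      rw [sitePoly, genericPoly, pencil, Fintype.sum_eq_single i fun j hj => absurd (hu j) hj]
      rfl
    have ht := transcendental_lam (K := K) i
    have halg : Algebra.IsAlgebraic K⟮(lam K i : GenField K ({e} : Finset (Fin n →₀ ℕ)))⟯
      (GenField K _) := isAlgebraic_adjoin_lam i fun j hj => absurd (hu j) hj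
    have hdeg := totalDegree_pencil ht P (monomial e 1)
    rw [hF, h.totalDegree_sitePoly] at hdeg
    obtain ⟨a, ψ, d, h1, h2, h3, h4, h5, h6, h7⟩ := pencil_monomial_cases ht
      (pencil_isRelPrime h hF) (hdeg ▸ hP) (by rwa [hF])
    rw [← hdeg] at h6
    right
    rcases h7 with ⟨b, rfl⟩ | h7
    · left
      have hF' := (h3.map (algebraMap K _)).add ((h4.map (algebraMap K _)).C_mul (lam K i))
      rw [← pencil, hF] at hF'
      exact h.twoCase h5 (by simpa using hF') ((le_max_left _ _).trans_lt h6)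
        ((le_max_right _ _).trans_lt h6)
    · exact Or.inr ⟨a, ψ, d, h5, by rw [h7], h1, h2, h3, h6⟩
  · push Not at hS
    obtain ⟨e', he', hne⟩ := hS
    rcases h.factor_cases hP hred ⟨e, he⟩ with h0 | h0 | h0
    · exact Or.inl h0
    · exact Or.inr (Or.inl h0)
    rcases h.factor_cases hP hred ⟨e', he'⟩ with h0' | h0' | h0'
    · exact Or.inl h0'
    · exact Or.inr (Or.inl h0')
    obtain ⟨a, d, ψ, c, s, hc, hea, hsd, hs2, had, hirr, hF, u₁, hu₁, u₂, hu₂, hu⟩ := h0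
    obtain ⟨a', d', ψ', c', s', hc', hea', hsd', hs2', had', hirr', hF', -⟩ := h0'
    simp only at hea hea'
    have hassoc : Associated (s.map fun u => ψ + C u * monomial a 1).prod
        (s'.map fun u => ψ' + C u * monomial a' 1).prod := by
      have h1 : Associated (sitePoly P S) (s.map fun u => ψ + C u * monomial a 1).prod := by
        rw [hF]
        exact (associated_isUnit_mul_left_iff (isUnit_C hc)).2 (Associated.refl _)
      have h2 : Associated (sitePoly P S) (s'.map fun u => ψ' + C u * monomial a' 1).prod := by
        rw [hF']
        exact (associated_isUnit_mul_left_iff (isUnit_C hc')).2 (Associated.refl _)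
      exact h1.symm.trans h2
    have hrel := UniqueFactorizationMonoid.factors_unique
      (f := s.map fun u => ψ + C u * monomial a 1) (g := s'.map fun u => ψ' + C u * monomial a' 1)
      (by simpa using hirr) (by simpa using hirr') hassoc
    have hcard := Multiset.card_eq_card_of_rel hrel
    rw [Multiset.card_map, Multiset.card_map] at hcard
    have key : ∀ u ∈ s, ∃ (u' γ : GenField K S),
        ψ + C u * monomial a 1 = C γ * (ψ' + C u' * monomial a' 1) := by
      intro u hu
      obtain ⟨q, hq, hqa⟩ := Multiset.exists_mem_of_rel_of_mem hrel
        (Multiset.mem_map_of_mem _ hu)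
      obtain ⟨u', -, rfl⟩ := Multiset.mem_map.1 hq
      obtain ⟨w, hw⟩ := hqa.symm
      obtain ⟨γ, -, hγ⟩ := isUnit_iff_eq_C_of_isReduced.1 w.isUnit
      exact ⟨u', γ, by rw [← hw, hγ, mul_comm]⟩
    obtain ⟨v₁, γ₁, hv₁⟩ := key u₁ hu₁
    obtain ⟨v₂, γ₂, hv₂⟩ := key u₂ hu₂
    -- Subtracting the proportionalities for two distinct parameters eliminates `ψ` and expresses
    -- the monomial through `ψ'` and the other monomial.
    have hm : C (u₁ - u₂) * monomial a 1 = C (γ₁ - γ₂) * ψ' +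
        C (γ₁ * v₁ - γ₂ * v₂) * monomial a' (1 : GenField K S) := by
      simp only [map_sub, map_mul]
      linear_combination hv₁ - hv₂
    have hu0 : u₁ - u₂ ≠ 0 := sub_ne_zero.2 hu
    -- Without `ψ'` the relation forces `a = a'`; equal numbers of factors then give `e = e'`. With
    -- `ψ'` present it can be solved for `ψ'`, and every factor becomes a linear form in two
    -- monomials.
    by_cases hα : γ₁ - γ₂ = 0
    · exfalso
      rw [hα, C_0, zero_mul, zero_add, C_mul_monomial, C_mul_monomial, mul_one, mul_one,
        monomial_eq_monomial_iff] at hm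
      rcases hm with ⟨rfl, -⟩ | ⟨h0, -⟩
      · apply hne
        rw [hea, hea']
        by_cases ha : a = 0
        · simp [ha]
        · rw [← hsd ha, ← hsd' ha, hcard]
      · exact hu0 h0
    · right; left
      have hψ' : FormIn 1 (monomial a 1) (monomial a' 1) ψ' := by
        have h1 : ψ' = lin ((γ₁ - γ₂)⁻¹ * (u₁ - u₂), -((γ₁ - γ₂)⁻¹ * (γ₁ * v₁ - γ₂ * v₂)))
            (monomial a 1) (monomial a' 1) := by
          have h2 : C (γ₁ - γ₂)⁻¹ * C (γ₁ - γ₂) = (1 : MvPolynomial (Fin n) (GenField K S)) := by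
            rw [← MvPolynomial.C_mul, inv_mul_cancel₀ hα, C_1]
          rw [lin, map_neg, MvPolynomial.C_mul, MvPolynomial.C_mul]
          linear_combination (-ψ') * h2 - C (γ₁ - γ₂)⁻¹ * hm
        rw [h1]
        exact formIn_lin _ _ _
      have hform : ∀ s : Multiset (GenField K S), FormIn s.card (monomial a 1) (monomial a' 1)
          (s.map fun u => ψ' + C u * monomial a' 1).prod := by
        intro s
        induction s using Multiset.induction_on with
        | empty =>
          have := formIn_pow_mul_pow (monomial a (1 : GenField K S)) (monomial a' 1) (le_refl 0)
          simpa using this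
        | cons u s ih =>
          rw [Multiset.map_cons, Multiset.prod_cons, Multiset.card_cons, add_comm]
          exact (hψ'.add ((formIn_right _ _).C_mul u)).mul ih
      exact h.twoCase hs2' (by rw [hF']; exact (hform s').C_mul c') had had'

end SiteCases

end MonSite

namespace MonSite

/-! ### Weights on exponents and divisors of weight-homogeneous polynomials. -/

section Weights

variable {R : Type*} [CommRing R] [IsDomain R] {σ : Type*}

/-- Among the terms of maximal weight in `A` and `B`, some pair has a sum attained only once, by the
unique sums property; its product cannot cancel. -/
theorem exists_max_weight (W : (σ →₀ ℕ) →+ ℤ) {A B : MvPolynomial σ R} (hA : A ≠ 0) (hB : B ≠ 0) :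
    ∃ a ∈ A.support, ∃ b ∈ B.support, (∀ a' ∈ A.support, W a' ≤ W a) ∧
      (∀ b' ∈ B.support, W b' ≤ W b) ∧ a + b ∈ (A * B).support := by
  classical
  let mx : MvPolynomial σ R → Finset (σ →₀ ℕ) := fun A =>
    A.support.filter fun a => ∀ a' ∈ A.support, W a' ≤ W a
  have hne : ∀ A : MvPolynomial σ R, A ≠ 0 → (mx A).Nonempty := by
    intro A hA
    obtain ⟨a, ha, hmax⟩ := Finset.exists_max_image A.support W (support_nonempty.2 hA)
    exact ⟨a, Finset.mem_filter.2 ⟨ha, hmax⟩⟩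
  obtain ⟨a, ha, b, hb, huniq⟩ := UniqueSums.uniqueAdd_of_nonempty (hne A hA) (hne B hB)
  obtain ⟨ha1, ha2⟩ := Finset.mem_filter.1 ha
  obtain ⟨hb1, hb2⟩ := Finset.mem_filter.1 hb
  refine ⟨a, ha1, b, hb1, ha2, hb2, ?_⟩
  rw [mem_support_iff, coeff_mul, Finset.sum_eq_single (a, b)]
  · exact mul_ne_zero (mem_support_iff.1 ha1) (mem_support_iff.1 hb1)
  · rintro ⟨x, y⟩ hxy hne
    rw [Finset.HasAntidiagonal.mem_antidiagonal] at hxy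
    by_contra h0
    have hx := mem_support_iff.2 (left_ne_zero_of_mul h0)
    have hy := mem_support_iff.2 (right_ne_zero_of_mul h0)
    have hW := congrArg W hxy
    simp only [map_add] at hW
    have h1 := ha2 x hx
    have h2 := hb2 y hy
    have hx' : x ∈ mx A := Finset.mem_filter.2 ⟨hx, fun a' h' => by have := ha2 a' h'; omega⟩
    have hy' : y ∈ mx B := Finset.mem_filter.2 ⟨hy, fun b' h' => by have := hb2 b' h'; omega⟩
    obtain ⟨h3, h4⟩ := huniq hx' hy' hxy
    exact hne (Prod.ext h3 h4)
  · simp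

/-- The maximal and minimal weights of a product are sums of those of the factors, so constancy of
the weight on the product forces it on each factor. -/
theorem weight_const_of_mul (W : (σ →₀ ℕ) →+ ℤ) {A B : MvPolynomial σ R}
    (h : ∀ m ∈ (A * B).support, ∀ m' ∈ (A * B).support, W m = W m') :
    A * B ≠ 0 → ∀ m ∈ A.support, ∀ m' ∈ A.support, W m = W m' := by
  intro h0 m hm m' hm'
  have hA := left_ne_zero_of_mul h0
  have hB := right_ne_zero_of_mul h0
  obtain ⟨a, ha, b, hb, h1, h2, h3⟩ := exists_max_weight W hA hB
  obtain ⟨a', ha', b', hb', h1', h2', h3'⟩ := exists_max_weight (-W) hA hB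
  have h4 := h _ h3 _ h3'
  simp only [map_add, AddMonoidHom.neg_apply] at h4 h1' h2'
  have := h1 m hm
  have := h1 m' hm'
  have := h1' m hm
  have := h1' m' hm'
  have := h2 b' hb'
  have := h1 a' ha'
  omega

theorem weight_const_of_dvd (W : (σ →₀ ℕ) →+ ℤ) {A P : MvPolynomial σ R} (hP : P ≠ 0) (hAP : A ∣ P)
    (h : ∀ m ∈ P.support, ∀ m' ∈ P.support, W m = W m') :
    ∀ m ∈ A.support, ∀ m' ∈ A.support, W m = W m' := by
  obtain ⟨B, rfl⟩ := hAP
  exact weight_const_of_mul W h hP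

end Weights

/-! ### Pairs of monomials and their direction vectors. -/

section MonomialPairs

variable {k : Type*} [Field k]

/-- By `FormIn.monomial_cases` the only obstruction is that each monomial is the `d`-th power of a
linear form. Distinct monomials then come from independent linear forms. -/
theorem FormIn.two_monomials [IsAlgClosed k] {σ : Type*} {d : ℕ} {φ ψ : MvPolynomial σ k}
    {e e' : σ →₀ ℕ} (h : FormIn d φ ψ (monomial e (1 : k))) (h' : FormIn d φ ψ (monomial e' (1 : k)))
    (hne : e ≠ e') : ∃ (v w : k × k) (a b : σ →₀ ℕ), v.1 * w.2 - v.2 * w.1 ≠ 0 ∧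
      lin v φ ψ = monomial a 1 ∧ lin w φ ψ = monomial b 1 := by
  have hd : d ≠ 0 := by
    rintro rfl
    have key : ∀ e : σ →₀ ℕ, FormIn 0 φ ψ (monomial e (1 : k)) → e = 0 := by
      intro e h
      have h1 := h.totalDegree_le
      rw [← isUnit_monomial_iff (k := k), isUnit_iff_totalDegree (by simp)]
      omega
    exact hne ((key e h).trans (key e' h').symm)
  obtain ⟨v, w, a, hdet, hv, ⟨b, hw⟩ | ha⟩ := h.monomial_cases hd
  · exact ⟨v, w, a, b, hdet, hv, hw⟩
  obtain ⟨v', w', a', hdet', hv', ⟨b, hw'⟩ | ha'⟩ := h'.monomial_cases hd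
  · exact ⟨v', w', a', b, hdet', hv', hw'⟩
  refine ⟨v, v', a, a', fun h0 => hne ?_, hv, hv'⟩
  have hv0 : v ≠ 0 := by
    rintro rfl
    simp at hdet
  obtain ⟨r, rfl⟩ := exists_smul_of_det_eq_zero hv0 h0
  rw [lin_smul, hv, C_mul_monomial, mul_one, monomial_eq_monomial_iff] at hv'
  rw [ha, ha', (hv'.resolve_right (by simp)).1]

variable {n : ℕ} {a b : Fin n →₀ ℕ}

theorem exists_indec_monomial [IsAlgClosed k] (h : ∀ i, a i = 0 ∨ b i = 0) (hne : a ≠ b) :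
    ∃ (a' b' : Fin n →₀ ℕ) (d : ℕ), (∀ i, a' i = 0 ∨ b' i = 0) ∧
      Indec (monomial a' (1 : k)) (monomial b' 1) ∧
      FormIn d (monomial a' 1) (monomial b' 1) (monomial a (1 : k)) ∧
      FormIn d (monomial a' 1) (monomial b' 1) (monomial b (1 : k)) ∧
      max (monomial a' (1 : k)).totalDegree (monomial b' (1 : k)).totalDegree ≤
        max (monomial a (1 : k)).totalDegree (monomial b (1 : k)).totalDegree := by
  obtain ⟨φ, ψ, d, h1, h2, h3, h4, h5⟩ := exists_indec (isRelPrime_monomial_iff (k := k).2 h)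
  obtain ⟨v, w, a', b', hdet, hv, hw⟩ := h2.two_monomials h3 hne
  rw [← max_totalDegree_lin hdet, hv, hw] at h5
  have h6 := isRelPrime_lin_change h1 hdet
  have h7 := h4.lin_change hdet
  have h8 := h2.lin_change hdet
  have h9 := h3.lin_change hdet
  rw [hv, hw] at h6 h7 h8 h9
  exact ⟨a', b', d, isRelPrime_monomial_iff.1 h6, h7, h8, h9, h5⟩

/-- A common divisor `c` of the exponents makes both monomials `c`-th powers, and their roots form a
lower pair when `c > 1`. -/
theorem Indec.eq_one_of_dvd (h : ∀ i, a i = 0 ∨ b i = 0)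
    (hind : Indec (monomial a (1 : k)) (monomial b 1))
    (hdeg : 0 < max (monomial a (1 : k)).totalDegree (monomial b (1 : k)).totalDegree) {c : ℕ}
    (hc : c ≠ 0) (hca : ∀ i, c ∣ a i) (hcb : ∀ i, c ∣ b i) : c = 1 := by
  have key : ∀ a : Fin n →₀ ℕ, (∀ i, c ∣ a i) → ∃ a' : Fin n →₀ ℕ, a = c • a' := by
    intro a ha
    refine ⟨a.mapRange (· / c) (Nat.zero_div c), ?_⟩
    ext i
    simp [Nat.mul_div_cancel' (ha i)]
  obtain ⟨a', rfl⟩ := key a hca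
  obtain ⟨b', rfl⟩ := key b hcb
  have hpow : ∀ a' : Fin n →₀ ℕ, monomial (c • a') (1 : k) = monomial a' 1 ^ c := by
    intro a'
    simp [monomial_pow]
  have h1 := hind (monomial a' 1) (monomial b' 1) c (isRelPrime_monomial_iff.2 fun i => by
      have := h i
      simpa [hc] using this)
    (by simpa [hpow] using (formIn_left (monomial a' (1 : k)) (monomial b' 1)).pow c)
    (by simpa [hpow] using (formIn_right (monomial a' (1 : k)) (monomial b' 1)).pow c)
  rw [hpow, hpow, totalDegree_pow_eq, totalDegree_pow_eq, Nat.mul_max_mul_left] at h1 hdeg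
  set M := max (monomial a' (1 : k)).totalDegree (monomial b' (1 : k)).totalDegree
  have hM : 0 < M := Nat.pos_of_mul_pos_left hdeg
  by_contra h2
  have h3 : 2 ≤ c := by omega
  have := Nat.mul_le_mul_right M h3
  omega

/-- A vector parallel to the direction of an indecomposable pair of monomials is an integral
multiple of this direction. -/
theorem Indec.exists_eq_mul (h : ∀ i, a i = 0 ∨ b i = 0)
    (hind : Indec (monomial a (1 : k)) (monomial b 1))
    (hdeg : 0 < max (monomial a (1 : k)).totalDegree (monomial b (1 : k)).totalDegree)
    {x : Fin n → ℤ} (hx : ∀ i j, x i * ((a j : ℤ) - b j) = x j * ((a i : ℤ) - b i)) :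
    ∃ c : ℤ, ∀ i, x i = c * ((a i : ℤ) - b i) := by
  set u : Fin n → ℤ := fun i => (a i : ℤ) - b i with hu
  -- `g` is the greatest common divisor of the entries of `a - b`. Disjoint supports make it divide
  -- `a` and `b` separately, so it is a unit, and Bézout coefficients `c j` yield the multiplier.
  obtain ⟨g, hg⟩ := IsPrincipalIdealRing.principal (Ideal.span (Set.range u))
  have hgu : ∀ i, g ∣ u i := by
    intro i
    have h1 : u i ∈ Ideal.span (Set.range u) := Ideal.subset_span ⟨i, rfl⟩
    rw [hg] at h1
    exact Ideal.mem_span_singleton.1 h1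
  have hdvd : ∀ i, g.natAbs ∣ a i ∧ g.natAbs ∣ b i := by
    intro i
    have h1 := hgu i
    simp only [hu] at h1
    rcases h i with h2 | h2
    · rw [h2] at h1 ⊢
      refine ⟨dvd_zero _, ?_⟩
      rw [Nat.cast_zero, zero_sub, dvd_neg] at h1
      exact Int.natAbs_dvd_natAbs.2 h1
    · rw [h2] at h1 ⊢
      refine ⟨?_, dvd_zero _⟩
      rw [Nat.cast_zero, sub_zero] at h1
      exact Int.natAbs_dvd_natAbs.2 h1
  have hg0 : g.natAbs ≠ 0 := by
    intro h0
    have ha : a = 0 := by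
      ext i
      have := (hdvd i).1
      rw [h0, zero_dvd_iff] at this
      exact this
    have hb : b = 0 := by
      ext i
      have := (hdvd i).2
      rw [h0, zero_dvd_iff] at this
      exact this
    rw [ha, hb] at hdeg
    simp at hdeg
  have hg1 := hind.eq_one_of_dvd h hdeg hg0 (fun i => (hdvd i).1) fun i => (hdvd i).2
  have h1 : (1 : ℤ) ∈ Ideal.span (Set.range u) := by
    rw [hg]
    exact Ideal.mem_span_singleton.2 (Int.isUnit_iff_natAbs_eq.2 hg1).dvd
  obtain ⟨c, hc⟩ := Ideal.mem_span_range_iff_exists_fun.1 h1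
  refine ⟨∑ j, c j * x j, fun i => ?_⟩
  calc x i = x i * ∑ j, c j * u j := by rw [hc, mul_one]
    _ = ∑ j, c j * (x i * u j) := by
      rw [Finset.mul_sum]
      exact Finset.sum_congr rfl fun j _ => by ring
    _ = ∑ j, c j * (x j * u i) := Finset.sum_congr rfl fun j _ => by rw [hx i j]
    _ = _ := by
      rw [Finset.sum_mul]
      exact Finset.sum_congr rfl fun j _ => by ring

theorem Indec.exists_ne (h : ∀ i, a i = 0 ∨ b i = 0)
    (hdeg : 0 < max (monomial a (1 : k)).totalDegree (monomial b (1 : k)).totalDegree) :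
    ∃ i, (a i : ℤ) - b i ≠ 0 := by
  by_contra! h0
  have ha : a = 0 := by
    ext i
    have := h0 i
    have := h i
    simp
    omega
  have hb : b = 0 := by
    ext i
    have := h0 i
    have := h i
    simp
    omega
  rw [ha, hb] at hdeg
  simp at hdeg

/-- The pair of monomials is determined by its direction. -/
theorem Indec.eq_or_eq {a' b' : Fin n →₀ ℕ} (h : ∀ i, a i = 0 ∨ b i = 0)
    (hind : Indec (monomial a (1 : k)) (monomial b 1))
    (hdeg : 0 < max (monomial a (1 : k)).totalDegree (monomial b (1 : k)).totalDegree)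
    (h' : ∀ i, a' i = 0 ∨ b' i = 0) (hind' : Indec (monomial a' (1 : k)) (monomial b' 1))
    (hdeg' : 0 < max (monomial a' (1 : k)).totalDegree (monomial b' (1 : k)).totalDegree)
    {p q : ℤ} (hp : p ≠ 0) (hq : q ≠ 0)
    (hpq : ∀ i, p * ((a i : ℤ) - b i) = q * ((a' i : ℤ) - b' i)) :
    (a = a' ∧ b = b') ∨ (a = b' ∧ b = a') := by
  obtain ⟨c, hc⟩ := hind.exists_eq_mul h hdeg (x := fun i => (a' i : ℤ) - b' i) fun i j => by
    apply mul_left_cancel₀ hq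
    linear_combination (-(a j : ℤ) + b j) * hpq i + ((a i : ℤ) - b i) * hpq j
  obtain ⟨c', hc'⟩ := hind'.exists_eq_mul h' hdeg' (x := fun i => (a i : ℤ) - b i) fun i j => by
    apply mul_left_cancel₀ hp
    linear_combination ((a' j : ℤ) - b' j) * hpq i - ((a' i : ℤ) - b' i) * hpq j
  obtain ⟨j, hj⟩ := Indec.exists_ne h hdeg
  have hcc : c' * c = 1 := by
    apply mul_right_cancel₀ hj
    rw [one_mul, mul_assoc, ← hc j, ← hc' j]
  rcases Int.eq_one_or_neg_one_of_mul_eq_one hcc with rfl | rfl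
  · left
    constructor <;> ext i <;> have h1 := hc' i <;> have h2 := h i <;> have h3 := h' i <;> omega
  · right
    constructor <;> ext i <;> have h1 := hc' i <;> have h2 := h i <;> have h3 := h' i <;> omega

/-- A monomial on the line that contains the support of a form in an indecomposable pair of
monomials is of the same shape if its degree is not too large. -/
theorem Indec.exists_of_parallel (h : ∀ i, a i = 0 ∨ b i = 0)
    (hind : Indec (monomial a (1 : k)) (monomial b 1))
    (hdeg : 0 < max (monomial a (1 : k)).totalDegree (monomial b (1 : k)).totalDegree)
    {P : MvPolynomial (Fin n) k} {δ : ℕ} (hP : FormIn δ (monomial a 1) (monomial b 1) P)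
    {m e : Fin n →₀ ℕ} (hm : m ∈ P.support)
    (he : (monomial e (1 : k)).totalDegree ≤ P.totalDegree)
    (hx : ∀ i j, ((e i : ℤ) - m i) * ((a j : ℤ) - b j) = ((e j : ℤ) - m j) * ((a i : ℤ) - b i)) :
    ∃ l ≤ δ, e = l • a + (δ - l) • b := by
  obtain ⟨c, hc⟩ := hind.exists_eq_mul h hdeg (x := fun i => (e i : ℤ) - m i) hx
  obtain ⟨j, hj, rfl⟩ := hP.support hm
  have key : ∀ i, (e i : ℤ) = (j + c) * a i + (δ - j - c) * b i := by
    intro i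
    have := hc i
    simp only [Finsupp.add_apply, Finsupp.smul_apply, smul_eq_mul, Nat.cast_add, Nat.cast_mul,
      Nat.cast_sub hj] at this
    linear_combination this
  -- The supports are disjoint, so a coordinate where `a` is nonzero sees only the coefficient of
  -- `a`.
  have ha : a ≠ 0 → 0 ≤ j + c := by
    intro ha
    obtain ⟨i, hi⟩ := Finsupp.ne_iff.1 ha
    have hi : a i ≠ 0 := hi
    have hb := (h i).resolve_left hi
    have := key i
    rw [hb, Nat.cast_zero, mul_zero, add_zero] at this
    have h1 : (0 : ℤ) < a i := by omega
    exact nonneg_of_mul_nonneg_left (by omega : 0 ≤ (j + c) * (a i : ℤ)) h1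
  have hb : b ≠ 0 → 0 ≤ δ - j - c := by
    intro hb
    obtain ⟨i, hi⟩ := Finsupp.ne_iff.1 hb
    have hi : b i ≠ 0 := hi
    have ha := (h i).resolve_right hi
    have := key i
    rw [ha, Nat.cast_zero, mul_zero, zero_add] at this
    have h1 : (0 : ℤ) < b i := by omega
    exact nonneg_of_mul_nonneg_left (by omega : 0 ≤ (δ - j - c) * (b i : ℤ)) h1
  have hle := he.trans hP.totalDegree_le
  have hpow : ∀ (r : ℕ) (a : Fin n →₀ ℕ),
      (monomial (r • a) (1 : k)).totalDegree = r * (monomial a (1 : k)).totalDegree := by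
    intro r a
    rw [← totalDegree_pow_eq, monomial_pow, one_pow]
  -- If both monomials are nonconstant, nonnegativity of the two coefficients suffices. If one is
  -- `1`, its coefficient is not visible, and the bound by `δ` on the other comes from the degree of
  -- `e`.
  by_cases ha0 : a = 0
  · subst ha0
    have hb0 : b ≠ 0 := by
      rintro rfl
      simp at hdeg
    obtain ⟨r, hr⟩ := Int.eq_ofNat_of_zero_le (hb hb0)
    have her : e = r • b := by
      ext i
      have := key i
      rw [hr] at this
      simp only [Finsupp.coe_zero, Pi.zero_apply, Nat.cast_zero, mul_zero, zero_add] at this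
      simp only [Finsupp.smul_apply, smul_eq_mul]
      exact_mod_cast this
    have hz : (monomial (0 : Fin n →₀ ℕ) (1 : k)).totalDegree = 0 := by simp
    rw [her, hpow, hz, zero_max] at hle
    rw [hz, zero_max] at hdeg
    have hrδ := Nat.le_of_mul_le_mul_right hle hdeg
    exact ⟨δ - r, Nat.sub_le _ _, by rw [Nat.sub_sub_self hrδ, her, smul_zero, zero_add]⟩
  · obtain ⟨r, hr⟩ := Int.eq_ofNat_of_zero_le (ha ha0)
    have hrδ : r ≤ δ := by
      by_cases hb0 : b = 0
      · subst hb0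
        have her : e = r • a := by
          ext i
          have := key i
          rw [hr] at this
          simp only [Finsupp.coe_zero, Pi.zero_apply, Nat.cast_zero, mul_zero, add_zero] at this
          simp only [Finsupp.smul_apply, smul_eq_mul]
          exact_mod_cast this
        have hz : (monomial (0 : Fin n →₀ ℕ) (1 : k)).totalDegree = 0 := by simp
        rw [her, hpow, hz, max_zero] at hle
        rw [hz, max_zero] at hdeg
        exact Nat.le_of_mul_le_mul_right hle hdeg
      · have := hb hb0
        omega
    refine ⟨r, hrδ, ?_⟩
    ext i
    have := key i
    simp only [Finsupp.add_apply, Finsupp.smul_apply, smul_eq_mul]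
    zify [hrδ]
    rw [this, ← hr]
    ring

end MonomialPairs

end MonSite

namespace MonSite

open IntermediateField

variable {K : Type*} [Field K] {n : ℕ} {P : MvPolynomial (Fin n) K} {S : Finset (Fin n →₀ ℕ)}

/-! ### From exponents and forms to the vocabulary of the theorem. -/

section Translation

theorem mono_eq_mul_iff {e a b : Fin n →₀ ℕ} {i j : ℕ} :
    mono K e = mono K a ^ i * mono K b ^ j ↔ e = i • a + j • b := by
  rw [mono, mono, mono, ← monomial_smul_add, monomial_eq_monomial_iff]
  simp

theorem mono_eq_pow_iff {e a : Fin n →₀ ℕ} {d : ℕ} : mono K e = mono K a ^ d ↔ e = d • a := by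
  rw [mono, mono, monomial_pow, one_pow, monomial_eq_monomial_iff]
  simp

theorem mem_support_mono {m e : Fin n →₀ ℕ} : m ∈ (mono K e).support ↔ m = e := by
  classical
  rw [mono, support_monomial, if_neg one_ne_zero, Finset.mem_singleton]

theorem inPowVars_iff {p : ℕ} {P : MvPolynomial (Fin n) K} :
    InPowVars p P ↔ ∀ m ∈ P.support, ∀ i, p ∣ m i := by
  classical
  constructor
  · rintro ⟨R, rfl⟩ m hm i
    obtain ⟨m', -, rfl⟩ := Finset.mem_image.1 (support_expand_subset R hm)
    exact ⟨m' i, rfl⟩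
  · intro h
    refine ⟨∑ m ∈ P.support, monomial (m.mapRange (· / p) (Nat.zero_div p)) (P.coeff m), ?_⟩
    rw [map_sum]
    conv_lhs => rw [P.as_sum]
    refine Finset.sum_congr rfl fun m hm => ?_
    have hpm : p • m.mapRange (· / p) (Nat.zero_div p) = m := by
      ext i
      simp [Nat.mul_div_cancel' (h m hm i)]
    rw [expand_monomial, hpm]

theorem divCase_iff : DivCase P S ↔
    ∃ p : ℕ, p.Prime ∧ CharP K p ∧ InPowVars p P ∧ ∀ e ∈ S, InPowVars p (mono K e) := by
  refine exists_congr fun p => and_congr_right fun _ => and_congr_right fun _ => ?_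
  rw [inPowVars_iff]
  constructor
  · intro h
    refine ⟨fun m hm => h m (Or.inl hm), fun e he => inPowVars_iff.2 fun m hm => ?_⟩
    exact h m (Or.inr (mem_support_mono.1 hm ▸ he))
  · rintro ⟨h1, h2⟩ m (hm | hm)
    · exact h1 m hm
    · exact inPowVars_iff.1 (h2 m hm) m (mem_support_mono.2 rfl)

theorem IsHomDecomp.formIn {L : Type*} [Field L] [Algebra K L] {F : MvPolynomial (Fin n) L}
    {φ ψ : MvPolynomial (Fin n) K} {H : MvPolynomial (Fin 2) L} {d : ℕ}
    (h : IsHomDecomp F φ ψ H d) :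
    FormIn d (map (algebraMap K L) φ) (map (algebraMap K L) ψ) F :=
  ⟨H, h.homogeneous, h.eq⟩

theorem exists_isHomDecomp_iff {φ ψ : MvPolynomial (Fin n) K} {d : ℕ} :
    (∃ h, IsHomDecomp P φ ψ h d) ↔ IsRelPrime φ ψ ∧
      max φ.totalDegree ψ.totalDegree < P.totalDegree ∧ FormIn d φ ψ P := by
  constructor
  · rintro ⟨h, hh⟩
    have := hh.formIn
    rw [Algebra.algebraMap_self, MvPolynomial.map_id, MvPolynomial.map_id] at this
    exact ⟨hh.relPrime, hh.degree_lt, this⟩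
  · rintro ⟨h1, h2, H, h3, h4⟩
    refine ⟨H, h1, h2, h3, ?_⟩
    rw [Algebra.algebraMap_self, MvPolynomial.map_id, MvPolynomial.map_id]
    exact h4

theorem FormIn.max_pos {φ ψ : MvPolynomial (Fin n) K} {d : ℕ} (h : FormIn d φ ψ P)
    (hP : 0 < P.totalDegree) : 0 < max φ.totalDegree ψ.totalDegree := by
  by_contra h0
  have := h.totalDegree_le
  rw [Nat.eq_zero_of_not_pos h0, mul_zero] at this
  omega

theorem genericPoly_unit (φ ψ : MvPolynomial (Fin n) K) :
    genericPoly φ (fun _ : Unit => ψ) = pencil (lam K ()) φ ψ := by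
  simp [genericPoly, pencil]

theorem exists_isMaxHomDecomp_iff [IsAlgClosed K] (hP : 0 < P.totalDegree)
    {φ ψ : MvPolynomial (Fin n) K} {d : ℕ} :
    (∃ h, IsMaxHomDecomp P φ ψ h d) ↔ IsRelPrime φ ψ ∧
      max φ.totalDegree ψ.totalDegree < P.totalDegree ∧ FormIn d φ ψ P ∧ Indec φ ψ := by
  have ht := transcendental_lam (K := K) ()
  constructor
  · rintro ⟨h, hh⟩
    obtain ⟨h1, h2, h3⟩ := exists_isHomDecomp_iff.1 ⟨h, hh.toIsHomDecomp⟩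
    have h4 := hh.irreducible
    rw [genericPoly_unit] at h4
    exact ⟨h1, h2, h3, indec_of_irreducible ht h4⟩
  · rintro ⟨h1, h2, h3, h4⟩
    obtain ⟨h, hh⟩ := exists_isHomDecomp_iff.2 ⟨h1, h2, h3⟩
    refine ⟨h, hh, ?_⟩
    rw [genericPoly_unit]
    have halg : Algebra.IsAlgebraic K⟮(lam K () : GenField K Unit)⟯ (GenField K Unit) :=
      isAlgebraic_adjoin_lam () fun j hj => absurd rfl hj
    exact h4.irreducible h1 (h3.max_pos hP) ht

theorem homInTwoMonomials_iff : HomInTwoMonomials P ↔ ∃ (a b : Fin n →₀ ℕ) (d : ℕ),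
    (∀ i, a i = 0 ∨ b i = 0) ∧
    max (mono K a).totalDegree (mono K b).totalDegree < P.totalDegree ∧
    FormIn d (mono K a) (mono K b) P := by
  constructor
  · rintro ⟨a, b, h, d, hh⟩
    obtain ⟨h1, h2, h3⟩ := exists_isHomDecomp_iff.1 ⟨h, hh⟩
    exact ⟨a, b, d, isRelPrime_monomial_iff.1 h1, h2, h3⟩
  · rintro ⟨a, b, d, h1, h2, h3⟩
    obtain ⟨h, hh⟩ := exists_isHomDecomp_iff.2 ⟨isRelPrime_monomial_iff.2 h1, h2, h3⟩
    exact ⟨a, b, h, d, hh⟩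

theorem exists_support_ne (hP : P ≠ 0) (hmon : ¬ IsMonomial P) :
    ∃ m ∈ P.support, ∃ m' ∈ P.support, m ≠ m' := by
  obtain ⟨m, hm⟩ := support_nonempty.2 hP
  by_contra! h
  refine hmon ⟨m, P.coeff m, mem_support_iff.1 hm, ?_⟩
  conv_lhs => rw [P.as_sum]
  rw [Finset.sum_eq_single m (fun m' hm' hne => absurd (h m' hm' m hm) hne)
    fun h => absurd hm h]

end Translation

/-! ### Polynomials homogeneous in two monomials. -/

section TwoMonomials

/-- `P` is a form of degree `δ` in an indecomposable pair of monomials. -/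
structure MonomialForm (P : MvPolynomial (Fin n) K) (a b : Fin n →₀ ℕ) (δ : ℕ) : Prop where
  disjoint : ∀ i, a i = 0 ∨ b i = 0
  degree_lt : max (mono K a).totalDegree (mono K b).totalDegree < P.totalDegree
  formIn : FormIn δ (mono K a) (mono K b) P
  indec : Indec (mono K a) (mono K b)

theorem exists_isMaxHomDecomp_mono_iff [IsAlgClosed K] (hP : 0 < P.totalDegree)
    {a b : Fin n →₀ ℕ} {δ : ℕ} :
    (∃ h, IsMaxHomDecomp P (mono K a) (mono K b) h δ) ↔ MonomialForm P a b δ := by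
  rw [exists_isMaxHomDecomp_iff hP]
  exact ⟨fun ⟨h1, h2, h3, h4⟩ => ⟨isRelPrime_monomial_iff.1 h1, h2, h3, h4⟩,
    fun ⟨h1, h2, h3, h4⟩ => ⟨isRelPrime_monomial_iff.2 h1, h2, h3, h4⟩⟩

theorem HomInTwoMonomials.exists_monomialForm [IsAlgClosed K] (hP : 0 < P.totalDegree)
    (h : HomInTwoMonomials P) : ∃ a b δ, MonomialForm P a b δ := by
  obtain ⟨a, b, d, h1, h2, h3⟩ := homInTwoMonomials_iff.1 h
  have hne : a ≠ b := by
    rintro rfl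
    have ha : a = 0 := by
      ext i
      simpa using h1 i
    have := h3.max_pos hP
    simp [mono, ha] at this
  obtain ⟨a', b', d', h4, h5, h6, h7, h8⟩ := exists_indec_monomial (k := K) h1 hne
  exact ⟨a', b', _, h4, h8.trans_lt h2, h3.trans h6 h7, h5⟩

/-- Two distinct exponents of `P` differ by a nonzero multiple of each of the two directions, so the
directions are parallel, and they determine the pairs. -/
theorem MonomialForm.eq_or_eq (hP : 0 < P.totalDegree) (hmon : ¬ IsMonomial P)
    {a b a' b' : Fin n →₀ ℕ} {δ δ' : ℕ} (h : MonomialForm P a b δ) (h' : MonomialForm P a' b' δ') :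
    (a = a' ∧ b = b') ∨ (a = b' ∧ b = a') := by
  have hP0 : P ≠ 0 := by
    rintro rfl
    simp at hP
  obtain ⟨m, hm, m', hm', hne⟩ := exists_support_ne hP0 hmon
  obtain ⟨i, hi, him⟩ := h.formIn.support hm
  obtain ⟨j, hj, hjm⟩ := h.formIn.support hm'
  obtain ⟨i', hi', him'⟩ := h'.formIn.support hm
  obtain ⟨j', hj', hjm'⟩ := h'.formIn.support hm'
  refine h.indec.eq_or_eq h.disjoint (h.formIn.max_pos hP) h'.disjoint h'.indec
    (h'.formIn.max_pos hP) (p := (i : ℤ) - j) (q := (i' : ℤ) - j') ?_ ?_ ?_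
  · intro h0
    have : i = j := by omega
    exact hne (by rw [him, hjm, this])
  · intro h0
    have : i' = j' := by omega
    exact hne (by rw [him', hjm', this])
  · intro l
    have h1 := congrArg (fun x : Fin n →₀ ℕ => (x l : ℤ)) (him.symm.trans him')
    have h2 := congrArg (fun x : Fin n →₀ ℕ => (x l : ℤ)) (hjm.symm.trans hjm')
    simp only [Finsupp.add_apply, Finsupp.smul_apply, smul_eq_mul, Nat.cast_add, Nat.cast_mul,
      Nat.cast_sub hi, Nat.cast_sub hj, Nat.cast_sub hi', Nat.cast_sub hj'] at h1 h2
    linear_combination h1 - h2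

/-- `P` has two distinct exponents, hence spans the line of exponents of either pair. The elements
of `S` lie on this line, and the degree bound of admissibility does the rest. -/
theorem MonomialForm.of_twoCase (hP : 0 < P.totalDegree) (hmon : ¬ IsMonomial P)
    (hS : Admissible P S) {a b : Fin n →₀ ℕ} {δ : ℕ} (h : MonomialForm P a b δ)
    (h2 : TwoCase P S) {e : Fin n →₀ ℕ} (he : e ∈ S) : ∃ l ≤ δ, e = l • a + (δ - l) • b := by
  have hP0 : P ≠ 0 := by
    rintro rfl
    simp at hP
  obtain ⟨m, hm, m', hm', hne⟩ := exists_support_ne hP0 hmon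
  obtain ⟨a', b', d, -, -, h3, -⟩ := h2
  obtain ⟨i, hi, him⟩ := h.formIn.support hm
  obtain ⟨j, hj, hjm⟩ := h.formIn.support hm'
  obtain ⟨i', hi', him'⟩ := h3 m (Or.inl hm)
  obtain ⟨j', hj', hjm'⟩ := h3 m' (Or.inl hm')
  obtain ⟨r, hr, her⟩ := h3 e (Or.inr he)
  have hne' : (i' : ℤ) - j' ≠ 0 := by
    intro h0
    have : i' = j' := by omega
    exact hne (by rw [him', hjm', this])
  refine h.indec.exists_of_parallel h.disjoint (h.formIn.max_pos hP) h.formIn hm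
    (hS.degree_le e he) fun x y => ?_
  have key : ∀ l, ((i' : ℤ) - j') * ((e l : ℤ) - m l) =
      (((r : ℤ) - i') * (i - j)) * ((a l : ℤ) - b l) := by
    intro l
    have h1 := congrArg (fun x : Fin n →₀ ℕ => (x l : ℤ)) him
    have h2 := congrArg (fun x : Fin n →₀ ℕ => (x l : ℤ)) hjm
    have h3 := congrArg (fun x : Fin n →₀ ℕ => (x l : ℤ)) him'
    have h4 := congrArg (fun x : Fin n →₀ ℕ => (x l : ℤ)) hjm'
    have h5 := congrArg (fun x : Fin n →₀ ℕ => (x l : ℤ)) her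
    simp only [Finsupp.add_apply, Finsupp.smul_apply, smul_eq_mul, Nat.cast_add, Nat.cast_mul,
      Nat.cast_sub hi, Nat.cast_sub hj, Nat.cast_sub hi', Nat.cast_sub hj', Nat.cast_sub hr]
      at h1 h2 h3 h4 h5
    linear_combination ((i' : ℤ) - j') * (h5 - h3) - ((r : ℤ) - i') * (h3 - h4 - h1 + h2)
  apply mul_left_cancel₀ hne'
  linear_combination ((a y : ℤ) - b y) * key x - ((a x : ℤ) - b x) * key y

theorem weight_multiset_prod {ι : Type*} (W : (Fin n →₀ ℕ) →+ ℤ)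
    (f : ι → MvPolynomial (Fin n) K) (w : ℤ) (s : Multiset ι)
    (h : ∀ i ∈ s, ∀ m ∈ (f i).support, W m = w) :
    ∀ m ∈ (s.map f).prod.support, W m = s.card * w := by
  classical
  induction s using Multiset.induction_on with
  | empty =>
    intro m hm
    rw [Multiset.map_zero, Multiset.prod_zero, support_one, Finset.mem_singleton] at hm
    simp [hm]
  | cons i s ih =>
    intro m hm
    rw [Multiset.map_cons, Multiset.prod_cons] at hm
    obtain ⟨x, hx, y, hy, rfl⟩ := Finset.mem_add.1 (support_mul _ _ hm)
    rw [map_add, h i (by simp) x hx, ih (fun j hj => h j (by simp [hj])) y hy,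
      Multiset.card_cons]
    push_cast
    ring

/-- `P` is homogeneous for every weight killing `a - b`, hence so are its factors `ψ - r m`. Two
distinct roots force `ψ` and `m` to have the same weight, so `m^d` has the weight of `P`. A single
root is excluded since `P` is not a pure power. -/
theorem MonomialForm.of_singleCase [IsAlgClosed K] (hP : 0 < P.totalDegree)
    (hpow : ¬ IsPurePower P) (hS : Admissible P S) {a b : Fin n →₀ ℕ} {δ : ℕ}
    (h : MonomialForm P a b δ) (h1 : SingleCase P S) {e : Fin n →₀ ℕ} (he : e ∈ S) :
    ∃ l ≤ δ, e = l • a + (δ - l) • b := by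
  have hP0 : P ≠ 0 := by
    rintro rfl
    simp at hP
  obtain ⟨a', ψ, d, hd, rfl, -, -, hform, hdeg⟩ := h1
  rw [Finset.mem_singleton] at he
  subst he
  obtain ⟨f, hfd, hf⟩ := hform.symm.exists_homogenize
  have hcard := (IsAlgClosed.splits f).natDegree_eq_card_roots
  set q : K → MvPolynomial (Fin n) K := fun r => lin (1, -r) ψ (mono K a') with hq
  have hprod : P = C f.leadingCoeff * ((f.roots.map q).prod * mono K a' ^ (d - f.natDegree)) := by
    conv_lhs => rw [hf, aeval_homogenize_eq_prod hfd, linFactors, Multiset.map_add,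
      Multiset.prod_add, Multiset.map_map, Multiset.map_replicate, Multiset.prod_replicate]
    simp [lin, hq, Function.comp_def]
  have hN : a' ≠ 0 → f.natDegree = d := by
    intro ha
    by_contra hne
    apply ha
    rw [← isUnit_monomial_iff (k := K)]
    apply hS.relPrime
    · rw [hprod]
      exact ((dvd_pow_self _ (by omega)).mul_left _).mul_left _
    · intro e he
      rw [Finset.mem_singleton] at he
      rw [mono_eq_pow_iff.2 he]
      exact dvd_pow_self _ (by omega)
  have hprod : P = C f.leadingCoeff * (f.roots.map q).prod := by
    by_cases ha : a' = 0
    · rw [hprod, ha]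
      simp [mono]
    · rw [hprod, hN ha, Nat.sub_self, pow_zero, mul_one]
  by_cases hall : ∃ r ∈ f.roots, ∃ r' ∈ f.roots, r ≠ r'
  · obtain ⟨m, hm⟩ := support_nonempty.2 hP0
    refine h.indec.exists_of_parallel h.disjoint (h.formIn.max_pos hP) h.formIn hm
      (hS.degree_le _ (by simp)) fun i j => ?_
    -- This is the minor in coordinates `i`, `j` of a vector against `a - b`. It is constant on the
    -- support of `P`, and equal values at `e` and `m` are the required parallelism.
    let W : (Fin n →₀ ℕ) →+ ℤ :=
      { toFun := fun x => (x i : ℤ) * ((a j : ℤ) - b j) - (x j : ℤ) * ((a i : ℤ) - b i)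
        map_zero' := by simp
        map_add' := fun x y => by
          simp only [Finsupp.add_apply, Nat.cast_add]
          ring }
    have hW : ∀ x, W x = (x i : ℤ) * ((a j : ℤ) - b j) - (x j : ℤ) * ((a i : ℤ) - b i) :=
      fun _ => rfl
    have hWP : ∀ m ∈ P.support, W m = δ * W a := by
      intro m hm
      obtain ⟨l, hl, rfl⟩ := h.formIn.support hm
      have hab : W b = W a := by
        simp only [hW]
        ring
      rw [map_add, map_nsmul, map_nsmul, hab, ← add_smul, Nat.add_sub_cancel' hl, nsmul_eq_mul]
    have hconst : ∀ r ∈ f.roots, ∀ x ∈ (q r).support, ∀ y ∈ (q r).support, W x = W y := by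
      intro r hr
      refine weight_const_of_dvd W hP0 ?_ fun x hx y hy => (hWP x hx).trans (hWP y hy).symm
      rw [hprod]
      exact (Multiset.dvd_prod (Multiset.mem_map_of_mem _ hr)).mul_left _
    have hcoef : ∀ r x, coeff x (q r) = coeff x ψ + -r * if a' = x then 1 else 0 := by
      classical
      intro r x
      simp only [hq, lin, mono, coeff_add, coeff_C_mul, coeff_monomial, one_mul]
    -- The term `a'` cancels in `ψ - r m` for at most one `r`. If it does, the remaining terms also
    -- occur for another root `r'`, where `a'` is present for comparison.
    have hroot : ∀ r ∈ f.roots, ∀ x ∈ (q r).support, W x = W a' := by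
      intro r hr x hx
      obtain ⟨r', hr', hne⟩ : ∃ r' ∈ f.roots, r ≠ r' := by
        obtain ⟨r₁, h1, r₂, h2, h3⟩ := hall
        by_cases h4 : r = r₁
        · exact ⟨r₂, h2, h4 ▸ h3⟩
        · exact ⟨r₁, h1, h4⟩
      by_cases ha : a' ∈ (q r).support
      · exact hconst r hr x hx a' ha
      · have hxa : a' ≠ x := fun h => ha (h ▸ hx)
        rw [mem_support_iff, hcoef, if_neg hxa, mul_zero] at hx
        rw [mem_support_iff, hcoef, if_pos rfl, not_not] at ha
        apply hconst r' hr'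
        · rwa [mem_support_iff, hcoef, if_neg hxa, mul_zero]
        · rw [mem_support_iff, hcoef, if_pos rfl]
          intro h0
          exact hne (by linear_combination h0 - ha)
    have hWm : W m = f.roots.card * W a' := by
      rw [hprod, mem_support_iff, coeff_C_mul] at hm
      exact weight_multiset_prod W q _ _ hroot m (mem_support_iff.2 (right_ne_zero_of_mul hm))
    have hWe : W (d • a') = W m := by
      rw [hWm, ← hcard, map_nsmul, nsmul_eq_mul]
      by_cases ha : a' = 0
      · rw [ha, map_zero, mul_zero, mul_zero]
      · rw [hN ha]
    rw [hW, hW] at hWe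
    linear_combination hWe
  · exfalso
    push Not at hall
    have hlc : f.leadingCoeff ≠ 0 := by
      intro h0
      rw [h0, C_0, zero_mul] at hprod
      exact hP0 hprod
    -- No root makes `P` constant, one root makes its degree at most that of the pair, and a
    -- repeated single root makes it a pure power.
    rcases Nat.lt_or_ge f.roots.card 2 with h2 | h2
    · have h01 : f.roots.card = 0 ∨ f.roots.card = 1 := by omega
      rcases h01 with h0 | h0
      · rw [Multiset.card_eq_zero.1 h0] at hprod
        rw [hprod] at hP
        simp at hP
      · obtain ⟨r, hr⟩ := Multiset.card_eq_one.1 h0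
        rw [hr, Multiset.map_singleton, Multiset.prod_singleton] at hprod
        have h3 := totalDegree_lin_le (1, -r) ψ (mono K a')
        have h4 := totalDegree_mul (C f.leadingCoeff) (q r)
        rw [← hprod, totalDegree_C, zero_add] at h4
        rw [max_comm] at h3
        exact absurd (h4.trans h3) (not_le.2 hdeg)
    · apply hpow
      obtain ⟨r, hr⟩ := Multiset.card_pos_iff_exists_mem.1 (by omega : 0 < f.roots.card)
      have h3 : f.roots = Multiset.replicate f.roots.card r :=
        Multiset.eq_replicate.2 ⟨rfl, fun r' hr' => hall r' hr' r hr⟩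
      rw [h3, Multiset.map_replicate, Multiset.prod_replicate] at hprod
      obtain ⟨z, hz⟩ := IsAlgClosed.exists_pow_nat_eq f.leadingCoeff
        (by omega : 0 < f.roots.card)
      refine ⟨C z * q r, f.roots.card, by omega, ?_⟩
      rw [mul_pow, ← C_pow, hz]
      exact hprod

end TwoMonomials

/-! ### Reducibility of `F`: the converse directions. -/

section Sites

theorem Admissible.isReducible_of_formIn (h : Admissible P S) {φ ψ : MvPolynomial (Fin n) K}
    {d : ℕ} (hdeg : max φ.totalDegree ψ.totalDegree < P.totalDegree) (hP : FormIn d φ ψ P)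
    (hS : ∀ e ∈ S, FormIn d φ ψ (mono K e)) : IsReducible (sitePoly P S) := by
  refine FormIn.isReducible (d := d) (φ := map (algebraMap K _) φ) (ψ := map (algebraMap K _) ψ)
    ?_ ?_
  · exact (hP.map _).add (formIn_sum _ fun e _ => ((hS e.1 e.2).map _).C_mul _)
  · rwa [totalDegree_map_algebraMap, totalDegree_map_algebraMap, h.totalDegree_sitePoly]

/-- All exponents of `F` are multiples of `p` and its coefficient field is algebraically closed, so
`F` is a nonconstant `p`-th power. -/
theorem Admissible.isReducible_of_divCase (hP : 0 < P.totalDegree) (h : Admissible P S)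
    (hd : DivCase P S) : IsReducible (sitePoly P S) := by
  obtain ⟨p, hp, hchar, hdiv⟩ := hd
  have : CharP (GenField K S) p :=
    charP_of_injective_algebraMap (algebraMap K (GenField K S)).injective p
  obtain ⟨φ, hφ⟩ := exists_pow_of_dvd hp (sitePoly P S)
    fun m hm => hdiv m (mem_support_sitePoly.1 hm)
  have hdeg := h.totalDegree_sitePoly
  rw [hφ, totalDegree_pow_eq] at hdeg
  have hφ0 : 0 < φ.totalDegree := by
    by_contra h0
    rw [Nat.eq_zero_of_not_pos h0, mul_zero] at hdeg
    omega
  have hφ1 : φ ≠ 0 := by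
    rintro rfl
    simp at hφ0
  have hunit : ∀ j, j ≠ 0 → ¬ IsUnit (φ ^ j) := by
    intro j hj
    rw [isUnit_iff_totalDegree (pow_ne_zero _ hφ1), totalDegree_pow_eq]
    exact (Nat.mul_pos (Nat.pos_of_ne_zero hj) hφ0).ne'
  refine ⟨φ ^ 1, φ ^ (p - 1), hunit 1 one_ne_zero, hunit _ ?_, ?_⟩
  · have := hp.two_le
    omega
  · rw [hφ, ← pow_add]
    congr 1
    have := hp.two_le
    omega

theorem DivCase.isPurePower [IsAlgClosed K] (h : DivCase P S) : IsPurePower P := by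
  obtain ⟨p, hp, hchar, hdiv⟩ := h
  obtain ⟨φ, hφ⟩ := exists_pow_of_dvd hp P fun m hm => hdiv m (Or.inl hm)
  exact ⟨φ, p, hp.one_lt, hφ⟩

theorem TwoCase.homInTwoMonomials (h : TwoCase P S) : HomInTwoMonomials P := by
  obtain ⟨a, b, d, -, h1, h2, h3⟩ := h
  exact homInTwoMonomials_iff.2 ⟨a, b, d, h1, h3, formIn_of_support fun m hm => h2 m (Or.inl hm)⟩

/-- The case of a single monomial, when the second polynomial of the pair is not a monomial. -/
theorem SingleCase.cases (h : SingleCase P S) : TwoCase P S ∨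
    ∃ (a : Fin n →₀ ℕ) (ψ : MvPolynomial (Fin n) K) (d : ℕ), 2 ≤ d ∧ S = {d • a} ∧
      IsRelPrime (mono K a) ψ ∧ Indec (mono K a) ψ ∧ FormIn d (mono K a) ψ P ∧
      max (mono K a).totalDegree ψ.totalDegree < P.totalDegree ∧ ¬ IsMonomial ψ := by
  obtain ⟨a, ψ, d, hd, rfl, h1, h2, h3, h4⟩ := h
  by_cases hψ : IsMonomial ψ
  · left
    obtain ⟨b, γ, hγ, rfl⟩ := hψ
    have hb : monomial b γ = C γ * mono K b := by
      rw [mono, C_mul_monomial, mul_one]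
    rw [hb] at h1 h3 h4
    have h5 : FormIn d (mono K a) (mono K b) P := by
      have := h3.trans (formIn_left (mono K a) (mono K b))
        ((formIn_right (mono K a) (mono K b)).C_mul γ)
      rwa [one_mul] at this
    refine ⟨a, b, d, hd, ?_, ?_, ?_⟩
    · exact isRelPrime_monomial_iff.1 ((isRelPrime_mul_unit_left_right (isUnit_C hγ)).1 h1)
    · rintro m (hm | hm)
      · exact h5.support hm
      · rw [Finset.mem_singleton] at hm
        exact ⟨d, le_rfl, by rw [hm]; simp⟩
    · rwa [totalDegree_mul_of_isDomain (by simpa using hγ) (by simp [mono]), totalDegree_C,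
        zero_add] at h4
  · exact Or.inr ⟨a, ψ, d, hd, rfl, h1, h2, h3, h4, hψ⟩

theorem MonomialForm.isReducible (hS : Admissible P S) {a b : Fin n →₀ ℕ} {δ : ℕ}
    (h : MonomialForm P a b δ) (he : ∀ e ∈ S, ∃ l ≤ δ, e = l • a + (δ - l) • b) :
    IsReducible (sitePoly P S) := by
  refine hS.isReducible_of_formIn h.degree_lt h.formIn fun e heS => formIn_of_support ?_
  intro m hm
  exact mem_support_mono.1 hm ▸ he e heS

end Sites

end MonSite

namespace MonSite

variable {K : Type*} [Field K] {n : ℕ} {P : MvPolynomial (Fin n) K} {S : Finset (Fin n →₀ ℕ)}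

/-! ### The case where `P` is a monomial. -/

section Monomial

variable {e₀ : Fin n →₀ ℕ} {γ : K}

theorem Admissible.monomial_ne (h : Admissible (monomial e₀ γ) S) {e : Fin n →₀ ℕ} (he : e ∈ S) :
    e₀ ≠ e := by
  rintro rfl
  exact h.distinct e₀ he γ (by rw [mono, C_mul_monomial, mul_one])

theorem monomial_coeff_ne_zero (hP : 0 < (monomial e₀ γ : MvPolynomial (Fin n) K).totalDegree) :
    γ ≠ 0 := by
  rintro rfl
  simp at hP

theorem mem_support_monomial (hγ : γ ≠ 0) {m : Fin n →₀ ℕ} :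
    m ∈ (monomial e₀ γ : MvPolynomial (Fin n) K).support ↔ m = e₀ := by
  classical
  rw [support_monomial, if_neg hγ, Finset.mem_singleton]

theorem mem_insert_iff (hγ : γ ≠ 0) {m : Fin n →₀ ℕ} :
    m ∈ insert e₀ S ↔ m ∈ (monomial e₀ γ : MvPolynomial (Fin n) K).support ∨ m ∈ S := by
  rw [Finset.mem_insert, mem_support_monomial hγ]

/-- The pair of monomials can be chosen such that both of its powers occur. -/
theorem Admissible.exists_pow_mem (hP : 0 < (monomial e₀ γ : MvPolynomial (Fin n) K).totalDegree)
    (h : Admissible (monomial e₀ γ) S) (h2 : TwoCase (monomial e₀ γ) S) :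
    ∃ (a b : Fin n →₀ ℕ) (d : ℕ), 1 < d ∧ (∀ i, a i = 0 ∨ b i = 0) ∧
      (∀ e ∈ insert e₀ S, ∃ k ≤ d, e = k • a + (d - k) • b) ∧
      (∃ e ∈ insert e₀ S, e = d • a) ∧ (∃ e ∈ insert e₀ S, e = d • b) := by
  have hγ := monomial_coeff_ne_zero hP
  obtain ⟨a, b, d, hd, hab, hform, hdeg⟩ := h2
  have hform' : ∀ e ∈ insert e₀ S, ∃ k ≤ d, e = k • a + (d - k) • b :=
    fun e he => hform e ((mem_insert_iff hγ).1 he)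
  have hzero : ∀ m : Fin n →₀ ℕ, (∀ e ∈ insert e₀ S, m ≤ e) → m = 0 := fun m hm =>
    h.eq_zero_of_le fun m' hm' => hm m' ((mem_insert_iff hγ).2 (mem_support_sitePoly.1 hm'))
  -- Used when one monomial of the pair is `1`: the degree `d` may then exceed all exponents that
  -- occur, and is replaced by the largest one, `M`. Here `M > 1` because the monomial has smaller
  -- degree than `P`.
  have key : ∀ a : Fin n →₀ ℕ, (∀ e ∈ insert e₀ S, ∃ k ≤ d, e = k • a) →
      (mono K a).totalDegree < (monomial e₀ γ : MvPolynomial (Fin n) K).totalDegree →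
      ∃ M, 1 < M ∧ (∀ e ∈ insert e₀ S, ∃ k ≤ M, e = k • a) ∧ ∃ e ∈ insert e₀ S, e = M • a := by
    intro a ha hlt
    choose! k hk using ha
    obtain ⟨e, he, hmax⟩ := Finset.exists_max_image (insert e₀ S) k ⟨e₀, by simp⟩
    refine ⟨k e, ?_, fun e' he' => ⟨k e', hmax e' he', (hk e' he').2⟩, e, he, (hk e he).2⟩
    refine lt_of_lt_of_le ?_ (hmax e₀ (by simp))
    have h0 := (hk e₀ (by simp)).2
    have h1 : (monomial e₀ γ : MvPolynomial (Fin n) K).totalDegree =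
        k e₀ * (mono K a).totalDegree := by
      rw [← totalDegree_pow_eq, ← mono_eq_pow_iff.2 h0, totalDegree_monomial _ hγ, totalDegree_mono]
      rfl
    rw [h1] at hlt
    by_contra hle
    have := Nat.mul_le_mul_right (mono K a).totalDegree (not_lt.1 hle)
    omega
  -- If `d • b` did not occur, the monomial of `a` would divide every element, against joint
  -- primality.
  have hend : ∀ a b : Fin n →₀ ℕ, a ≠ 0 → (∀ e ∈ insert e₀ S, ∃ k ≤ d, e = k • a + (d - k) • b) →
      ∃ e ∈ insert e₀ S, e = d • b := by
    intro a b ha hab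
    by_contra! hne
    apply ha
    apply hzero
    intro e he
    obtain ⟨k, hk, rfl⟩ := hab e he
    have hk0 : 1 ≤ k := by
      by_contra hk0
      apply hne _ he
      have : k = 0 := by omega
      simp [this]
    intro i
    simp only [Finsupp.add_apply, Finsupp.smul_apply, smul_eq_mul]
    have := Nat.mul_le_mul_right (a i) hk0
    omega
  by_cases ha : a = 0
  · subst ha
    obtain ⟨M, hM, h1, h2⟩ := key b (fun e he => by
      obtain ⟨k, hk, rfl⟩ := hform' e he
      exact ⟨d - k, Nat.sub_le _ _, by simp⟩) ((le_max_right _ _).trans_lt hdeg)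
    have hb : b ≠ 0 := by
      rintro rfl
      obtain ⟨e, he, rfl⟩ := h2
      obtain ⟨k, -, hk⟩ := hform' e₀ (by simp)
      rw [hk] at hP
      simp at hP
    refine ⟨b, 0, M, hM, fun i => Or.inr rfl, fun e he => ?_, h2, ?_⟩
    · obtain ⟨k, hk, rfl⟩ := h1 e he
      exact ⟨k, hk, by simp⟩
    · obtain ⟨e, he, hee⟩ := hend b 0 hb fun e he => by
        obtain ⟨k, hk, rfl⟩ := hform' e he
        exact ⟨d - k, Nat.sub_le _ _, by simp⟩
      exact ⟨e, he, by simpa using hee⟩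
  · by_cases hb : b = 0
    · subst hb
      obtain ⟨M, hM, h1, h2⟩ := key a (fun e he => by
        obtain ⟨k, hk, rfl⟩ := hform' e he
        exact ⟨k, hk, by simp⟩) ((le_max_left _ _).trans_lt hdeg)
      refine ⟨a, 0, M, hM, fun i => Or.inr rfl, fun e he => ?_, h2, ?_⟩
      · obtain ⟨k, hk, rfl⟩ := h1 e he
        exact ⟨k, hk, by simp⟩
      · obtain ⟨e, he, hee⟩ := hend a 0 ha hform'
        exact ⟨e, he, by simpa using hee⟩
    · refine ⟨a, b, d, hd, hab, hform', hend b a hb fun e he => ?_, hend a b ha hform'⟩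
      obtain ⟨k, hk, rfl⟩ := hform' e he
      exact ⟨d - k, Nat.sub_le _ _, by rw [Nat.sub_sub_self hk, add_comm]⟩

/-- Here `P`, up to a constant, and `Q = m^d` are distinct monomials that are forms of one degree in
the same pair, so `FormIn.two_monomials` replaces the pair by two monomials. -/
theorem SingleCase.twoCase [IsAlgClosed K]
    (hP : 0 < (monomial e₀ γ : MvPolynomial (Fin n) K).totalDegree)
    (h : Admissible (monomial e₀ γ) S) (h1 : SingleCase (monomial e₀ γ) S) :
    TwoCase (monomial e₀ γ) S := by
  have hγ := monomial_coeff_ne_zero hP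
  obtain ⟨a, ψ, d, hd, rfl, hrel, -, hform, hdeg⟩ := h1
  have hf1 : FormIn d (mono K a) ψ (mono K e₀) := by
    have := hform.C_mul γ⁻¹
    rwa [C_mul_monomial, inv_mul_cancel₀ hγ] at this
  have hf2 : FormIn d (mono K a) ψ (mono K (d • a)) := by
    rw [mono_eq_pow_iff.2 rfl]
    simpa using (formIn_left (mono K a) ψ).pow d
  obtain ⟨v, w, a', b', hdet, hv, hw⟩ := hf1.two_monomials hf2 (h.monomial_ne (by simp))
  have hrel' := isRelPrime_lin_change hrel hdet
  rw [← max_totalDegree_lin hdet] at hdeg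
  replace hf1 := hf1.lin_change hdet
  replace hf2 := hf2.lin_change hdet
  rw [hv, hw] at hrel' hdeg hf1 hf2
  refine ⟨a', b', d, hd, isRelPrime_monomial_iff.1 hrel', ?_, hdeg⟩
  rintro m (hm | hm)
  · rw [mem_support_monomial hγ] at hm
    exact hf1.support (mem_support_mono.2 hm)
  · rw [Finset.mem_singleton] at hm
    exact hf2.support (mem_support_mono.2 hm)

theorem Admissible.isReducible_monomial_iff [IsAlgClosed K]
    (hP : 0 < (monomial e₀ γ : MvPolynomial (Fin n) K).totalDegree)
    (h : Admissible (monomial e₀ γ) S) : IsReducible (sitePoly (monomial e₀ γ) S) ↔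
      DivCase (monomial e₀ γ) S ∨
      ∃ (a b : Fin n →₀ ℕ) (d : ℕ), 1 < d ∧ (∀ i, a i = 0 ∨ b i = 0) ∧
        (∀ e ∈ insert e₀ S, ∃ k ≤ d, e = k • a + (d - k) • b) ∧
        (∃ e ∈ insert e₀ S, e = d • a) ∧ (∃ e ∈ insert e₀ S, e = d • b) := by
  have hγ := monomial_coeff_ne_zero hP
  constructor
  · intro hred
    rcases h.site_cases hP hred with h1 | h1 | h1
    · exact Or.inl h1
    · exact Or.inr (h.exists_pow_mem hP h1)
    · exact Or.inr (h.exists_pow_mem hP (h1.twoCase hP h))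
  · rintro (h1 | ⟨a, b, d, hd, -, hform, ⟨_, ha, rfl⟩, ⟨_, hb, rfl⟩⟩)
    · exact h.isReducible_of_divCase hP h1
    · have hlt : ∀ a : Fin n →₀ ℕ, d • a ∈ insert e₀ S →
          (mono K a).totalDegree < (monomial e₀ γ : MvPolynomial (Fin n) K).totalDegree := by
        intro a ha
        have hle : (mono K (d • a)).totalDegree ≤
            (monomial e₀ γ : MvPolynomial (Fin n) K).totalDegree := by
          rcases Finset.mem_insert.1 ha with h0 | h0
          · rw [h0, totalDegree_mono, totalDegree_monomial _ hγ]
            rfl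
          · exact h.degree_le _ h0
        rw [mono_eq_pow_iff.2 rfl, totalDegree_pow_eq] at hle
        have := Nat.mul_le_mul_right (mono K a).totalDegree hd
        omega
      refine h.isReducible_of_formIn (d := d) (max_lt (hlt a ha) (hlt b hb))
        (formIn_of_support fun m hm => hform m ((mem_insert_iff hγ).2 (Or.inl hm)))
        fun e he => formIn_of_support fun m hm => ?_
      rw [mem_support_mono.1 hm]
      exact hform e (Finset.mem_insert_of_mem he)

/-- A linear functional sending `1` and the indeterminates to prescribed values. -/
theorem exists_functional {ι : Type*} (c : Option ι → K) :
    ∃ f : GenField K ι →ₗ[K] K, f 1 = c none ∧ ∀ i, f (lam K i) = c (some i) := by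
  -- `1` and the `λ_i` are images of distinct monomials in algebraically independent elements, hence
  -- linearly independent over `K`, so a functional with these values exists.
  let g : Option ι → (ι →₀ ℕ) := fun o => o.elim 0 fun i => Finsupp.single i 1
  have hg : Function.Injective g := by
    rintro (_ | i) (_ | j) h
    · rfl
    · exact absurd h.symm (by simp [g])
    · exact absurd h (by simp [g])
    · exact congrArg some (Finsupp.single_left_injective one_ne_zero h)
  let φ : MvPolynomial ι K →ₐ[K] GenField K ι := aeval (lam K)
  have h1 := ((basisMonomials ι K).linearIndependent.comp g hg).map' φ.toLinearMap
    (LinearMap.ker_eq_bot.2 (algebraicIndependent_lam (K := K) (ι := ι)))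
  obtain ⟨r, hr⟩ := LinearMap.exists_leftInverse_of_injective _ (LinearMap.ker_eq_bot.2 h1)
  refine ⟨Finsupp.linearCombination K c ∘ₗ r, ?_, fun i => ?_⟩
  · have h2 := LinearMap.congr_fun hr (Finsupp.single none 1)
    rw [LinearMap.comp_apply, Finsupp.linearCombination_single, one_smul] at h2
    simp only [Function.comp_apply, coe_basisMonomials, g, Option.elim_none,
      AlgHom.toLinearMap_apply] at h2
    rw [show φ (monomial 0 1) = 1 from map_one φ] at h2
    rw [LinearMap.comp_apply, h2]
    simp
  · have h2 := LinearMap.congr_fun hr (Finsupp.single (some i) 1)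
    rw [LinearMap.comp_apply, Finsupp.linearCombination_single, one_smul] at h2
    simp only [Function.comp_apply, coe_basisMonomials, g, Option.elim_some,
      AlgHom.toLinearMap_apply] at h2
    rw [show φ (monomial (Finsupp.single i 1) 1) = lam K i from aeval_X _ _] at h2
    rw [LinearMap.comp_apply, h2]
    simp

/-- Linear functionals applied to the coefficients preserve forms in polynomials over `K`. -/
theorem FormIn.functional {σ L : Type*} [Field L] [Algebra K L] {φ ψ : MvPolynomial σ K}
    {F : MvPolynomial σ L} {d : ℕ}
    (h : FormIn d (MvPolynomial.map (algebraMap K L) φ) (MvPolynomial.map (algebraMap K L) ψ) F)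
    (f : L →ₗ[K] K)
    {G : MvPolynomial σ K} (hG : ∀ m, coeff m G = f (coeff m F)) : FormIn d φ ψ G := by
  obtain ⟨c, rfl⟩ := h.exists_sum
  have : G = ∑ i ∈ Finset.range (d + 1), C (f (c i)) * (φ ^ i * ψ ^ (d - i)) := by
    ext m
    rw [hG, coeff_sum, coeff_sum, map_sum]
    refine Finset.sum_congr rfl fun i _ => ?_
    rw [← map_pow, ← map_pow, ← map_mul, coeff_C_mul, coeff_C_mul, coeff_map, mul_comm (c i),
      ← Algebra.smul_def, map_smul, smul_eq_mul, mul_comm]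
  rw [this]
  exact formIn_sum _ fun i hi => (formIn_pow_mul_pow _ _ (by simp at hi; omega)).C_mul _

/-- Functionals on the coefficients that single out `1`, respectively one `λ_i`, extract `P` and
`Q_i` from `F` as forms in `φ, ψ` over `K`. These are two distinct monomials, so the span of `φ, ψ`
has a basis of monomials. -/
theorem Admissible.exists_lin_eq_monomial [IsAlgClosed K] (hγ : γ ≠ 0)
    (h : Admissible (monomial e₀ γ) S) {φ ψ : MvPolynomial (Fin n) K} {d : ℕ}
    (hF : FormIn d (map (algebraMap K _) φ) (map (algebraMap K _) ψ)
      (sitePoly (monomial e₀ γ) S)) :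
    ∃ (v w : K × K) (a b : Fin n →₀ ℕ), v.1 * w.2 - v.2 * w.1 ≠ 0 ∧
      lin v φ ψ = mono K a ∧ lin w φ ψ = mono K b := by
  classical
  obtain ⟨e, he⟩ := h.nonempty
  have hne := h.monomial_ne he
  have hval : ∀ (f : GenField K S →ₗ[K] K) (c : K), f (algebraMap K _ c) = c * f 1 := by
    intro f c
    rw [Algebra.algebraMap_eq_smul_one, map_smul, smul_eq_mul]
  have h1 : FormIn d φ ψ (mono K e₀) := by
    obtain ⟨f, hf1, hf2⟩ := exists_functional (K := K) (ι := S)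
      (fun o => o.elim γ⁻¹ fun _ => 0)
    refine hF.functional f fun m => ?_
    by_cases hm : m ∈ S
    · rw [coeff_sitePoly_of_mem hm, map_add, hval, hf1, hf2, mono, coeff_monomial, coeff_monomial,
        if_neg (h.monomial_ne hm), if_neg (h.monomial_ne hm)]
      simp
    · rw [coeff_sitePoly_of_notMem hm, hval, hf1, mono, coeff_monomial, coeff_monomial]
      split_ifs <;> simp [hγ]
  have h2 : FormIn d φ ψ (mono K e) := by
    obtain ⟨f, hf1, hf2⟩ := exists_functional (K := K) (ι := S)
      (fun o => o.elim 0 fun i => if i.1 = e then 1 else 0)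
    refine hF.functional f fun m => ?_
    by_cases hm : m ∈ S
    · rw [coeff_sitePoly_of_mem hm, map_add, hval, hf1, hf2, mono, coeff_monomial]
      simp [eq_comm]
    · rw [coeff_sitePoly_of_notMem hm, hval, hf1, mono, coeff_monomial, if_neg]
      · simp
      · rintro rfl
        exact hm he
  exact h1.two_monomials h2 hne

end Monomial

/-! ### The characterizations of sites. -/

section Main

variable [IsAlgClosed K]

/-- Exponents divisible by `p` would make `P` a pure power; in each of the other two cases of the
trichotomy the site lies on the line of the given pair. -/
theorem isSite_iff_of_monomialForm (hP : 0 < P.totalDegree) (hmon : ¬ IsMonomial P)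
    (hpow : ¬ IsPurePower P) {a b : Fin n →₀ ℕ} {δ : ℕ} (h : MonomialForm P a b δ) :
    IsSite P S ↔ Admissible P S ∧ ∀ e ∈ S, ∃ l ≤ δ, e = l • a + (δ - l) • b := by
  constructor
  · rintro ⟨hS, hred⟩
    refine ⟨hS, fun e he => ?_⟩
    rcases hS.site_cases hP hred with h1 | h1 | h1
    · exact absurd h1.isPurePower hpow
    · exact h.of_twoCase hP hmon hS h1 he
    · exact h.of_singleCase hP hpow hS h1 he
  · exact fun ⟨hS, he⟩ => ⟨hS, h.isReducible hS he⟩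

theorem Admissible.isReducible_singleton (hP : 0 < P.totalDegree) (hS : Admissible P S)
    {a : Fin n →₀ ℕ} {d : ℕ} {ψ : MvPolynomial (Fin n) K} {h : MvPolynomial (Fin 2) K}
    (he : S = {d • a}) (hh : IsMaxHomDecomp P (mono K a) ψ h d) : IsReducible (sitePoly P S) := by
  obtain ⟨-, h2, h3, -⟩ := (exists_isMaxHomDecomp_iff hP).1 ⟨h, hh⟩
  refine hS.isReducible_of_formIn h2 h3 fun e heS => ?_
  rw [he, Finset.mem_singleton] at heS
  rw [mono_eq_pow_iff.2 heS]
  simpa using (formIn_left (mono K a) ψ).pow d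

theorem isSite_iff_of_not_homInTwoMonomials (hP : 0 < P.totalDegree)
    (hpow : ¬ IsPurePower P) (hhom : ¬ HomInTwoMonomials P) : IsSite P S ↔ Admissible P S ∧
      ∃ (a : Fin n →₀ ℕ) (d : ℕ) (ψ : MvPolynomial (Fin n) K) (h : MvPolynomial (Fin 2) K),
        2 ≤ d ∧ (∃ e, S = {e} ∧ mono K e = mono K a ^ d) ∧ IsRelPrime (mono K a) P ∧
        ¬ IsMonomial ψ ∧ IsMaxHomDecomp P (mono K a) ψ h d := by
  constructor
  · rintro ⟨hS, hred⟩
    refine ⟨hS, ?_⟩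
    have h2 : ¬ TwoCase P S := fun h => hhom h.homInTwoMonomials
    rcases hS.site_cases hP hred with h1 | h1 | h1
    · exact absurd h1.isPurePower hpow
    · exact absurd h1 h2
    obtain ⟨a, ψ, d, hd, hSa, h3, h4, h5, h6, h7⟩ := h1.cases.resolve_left h2
    obtain ⟨h, hh⟩ := (exists_isMaxHomDecomp_iff hP).2 ⟨h3, h6, h5, h4⟩
    refine ⟨a, d, ψ, h, hd, ⟨d • a, hSa, mono_eq_pow_iff.2 rfl⟩, fun D hD1 hD2 => ?_, h7, hh⟩
    refine hS.relPrime D hD2 fun e he => ?_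
    rw [hSa, Finset.mem_singleton] at he
    rw [mono_eq_pow_iff.2 he]
    exact hD1.trans (dvd_pow_self _ (by omega))
  · rintro ⟨hS, a, d, ψ, h, -, ⟨e, hSe, he⟩, -, -, hh⟩
    rw [mono_eq_pow_iff.1 he] at hSe
    exact ⟨hS, hS.isReducible_singleton hP hSe hh⟩

theorem isSite_iff_of_isPurePower (hP : 0 < P.totalDegree) (hmon : ¬ IsMonomial P) :
    IsSite P S ↔ Admissible P S ∧
      ((∃ (a b : Fin n →₀ ℕ) (h : MvPolynomial (Fin 2) K) (δ : ℕ),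
          IsMaxHomDecomp P (mono K a) (mono K b) h δ ∧
          ∀ e ∈ S, ∃ k ≤ δ, mono K e = mono K a ^ k * mono K b ^ (δ - k)) ∨
        (∃ (a : Fin n →₀ ℕ) (d : ℕ) (ψ : MvPolynomial (Fin n) K) (h : MvPolynomial (Fin 2) K),
          (∃ e, S = {e} ∧ mono K e = mono K a ^ d) ∧
          ¬ IsMonomial ψ ∧ IsMaxHomDecomp P (mono K a) ψ h d) ∨
        (∃ p : ℕ, p.Prime ∧ CharP K p ∧ InPowVars p P ∧
          ∀ e ∈ S, ∃ a : Fin n →₀ ℕ, mono K e = mono K a ^ p)) := by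
  constructor
  · rintro ⟨hS, hred⟩
    refine ⟨hS, ?_⟩
    have htwo : TwoCase P S → ∃ (a b : Fin n →₀ ℕ) (h : MvPolynomial (Fin 2) K) (δ : ℕ),
        IsMaxHomDecomp P (mono K a) (mono K b) h δ ∧
        ∀ e ∈ S, ∃ k ≤ δ, mono K e = mono K a ^ k * mono K b ^ (δ - k) := by
      intro h2
      obtain ⟨a, b, δ, hab⟩ := h2.homInTwoMonomials.exists_monomialForm hP
      obtain ⟨h, hh⟩ := (exists_isMaxHomDecomp_mono_iff hP).2 hab
      refine ⟨a, b, h, δ, hh, fun e he => ?_⟩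
      obtain ⟨l, hl, hel⟩ := hab.of_twoCase hP hmon hS h2 he
      exact ⟨l, hl, mono_eq_mul_iff.2 hel⟩
    rcases hS.site_cases hP hred with h1 | h1 | h1
    · obtain ⟨p, hp, hchar, hdiv⟩ := h1
      refine Or.inr (Or.inr ⟨p, hp, hchar, inPowVars_iff.2 fun m hm => hdiv m (Or.inl hm),
        fun e he => ⟨e.mapRange (· / p) (Nat.zero_div p), mono_eq_pow_iff.2 ?_⟩⟩)
      ext i
      simp [Nat.mul_div_cancel' (hdiv e (Or.inr he) i)]
    · exact Or.inl (htwo h1)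
    · rcases h1.cases with h2 | ⟨a, ψ, d, hd, hSa, h3, h4, h5, h6, h7⟩
      · exact Or.inl (htwo h2)
      · obtain ⟨h, hh⟩ := (exists_isMaxHomDecomp_iff hP).2 ⟨h3, h6, h5, h4⟩
        exact Or.inr (Or.inl ⟨a, d, ψ, h, ⟨d • a, hSa, mono_eq_pow_iff.2 rfl⟩, h7, hh⟩)
  · rintro ⟨hS, ⟨a, b, h, δ, hh, he⟩ | ⟨a, d, ψ, h, ⟨e, hSe, he⟩, -, hh⟩ | ⟨p, hp, hchar, h1, h2⟩⟩
    · have hab := (exists_isMaxHomDecomp_mono_iff hP).1 ⟨h, hh⟩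
      refine ⟨hS, hab.isReducible hS fun e heS => ?_⟩
      obtain ⟨l, hl, hel⟩ := he e heS
      exact ⟨l, hl, mono_eq_mul_iff.1 hel⟩
    · rw [mono_eq_pow_iff.1 he] at hSe
      exact ⟨hS, hS.isReducible_singleton hP hSe hh⟩
    · refine ⟨hS, hS.isReducible_of_divCase hP ⟨p, hp, hchar, ?_⟩⟩
      rintro m (hm | hm) i
      · exact inPowVars_iff.1 h1 m hm i
      · obtain ⟨a, ha⟩ := h2 m hm
        rw [mono_eq_pow_iff.1 ha]
        exact ⟨a i, rfl⟩

end Main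

end MonSite

theorem theorem3p4 {K : Type*} [Field K] [IsAlgClosed K] {n : ℕ} (hn : 2 ≤ n)
    (P : MvPolynomial (Fin n) K) (hP : 0 < P.totalDegree) :
    -- maximal decompositions in two monomials exist and are unique up to order
    (¬ IsMonomial P → HomInTwoMonomials P →
      (∃ (a b : Fin n →₀ ℕ) (h : MvPolynomial (Fin 2) K) (δ : ℕ),
        IsMaxHomDecomp P (mono K a) (mono K b) h δ) ∧
      (∀ (a b a' b' : Fin n →₀ ℕ) (h h' : MvPolynomial (Fin 2) K) (δ δ' : ℕ),
        IsMaxHomDecomp P (mono K a) (mono K b) h δ →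
        IsMaxHomDecomp P (mono K a') (mono K b') h' δ' →
        (a = a' ∧ b = b') ∨ (a = b' ∧ b = a'))) ∧
    -- general case
    (¬ IsMonomial P → ¬ IsPurePower P →
      (HomInTwoMonomials P →
        ∀ (a b : Fin n →₀ ℕ) (h : MvPolynomial (Fin 2) K) (δ : ℕ),
          IsMaxHomDecomp P (mono K a) (mono K b) h δ →
          ∀ S : Finset (Fin n →₀ ℕ), IsSite P S ↔
            Admissible P S ∧
            ∀ e ∈ S, ∃ k ≤ δ, mono K e = mono K a ^ k * mono K b ^ (δ - k)) ∧
      (¬ HomInTwoMonomials P →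
        ∀ S : Finset (Fin n →₀ ℕ), IsSite P S ↔
          Admissible P S ∧
          ∃ (a : Fin n →₀ ℕ) (d : ℕ) (ψ : MvPolynomial (Fin n) K) (h : MvPolynomial (Fin 2) K),
            2 ≤ d ∧ (∃ e, S = {e} ∧ mono K e = mono K a ^ d) ∧ IsRelPrime (mono K a) P ∧
            ¬ IsMonomial ψ ∧ IsMaxHomDecomp P (mono K a) ψ h d)) ∧
    -- the case of a monomial
    (∀ (e₀ : Fin n →₀ ℕ) (γ : K), P = monomial e₀ γ →
      ∀ S : Finset (Fin n →₀ ℕ), Admissible P S →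
        (IsReducible (sitePoly P S) ↔
          (∃ p : ℕ, p.Prime ∧ CharP K p ∧ InPowVars p P ∧ ∀ e ∈ S, InPowVars p (mono K e)) ∨
          (∃ (a b : Fin n →₀ ℕ) (d : ℕ), 1 < d ∧ IsRelPrime (mono K a) (mono K b) ∧
            (∀ e ∈ insert e₀ S, ∃ k ≤ d, mono K e = mono K a ^ k * mono K b ^ (d - k)) ∧
            (∃ e ∈ insert e₀ S, mono K e = mono K a ^ d) ∧
            (∃ e ∈ insert e₀ S, mono K e = mono K b ^ d))) ∧
        (∀ (φ ψ : MvPolynomial (Fin n) K) (H : MvPolynomial (Fin 2) (GenField K S)) (d : ℕ),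
          IsHomDecomp (sitePoly P S) φ ψ H d →
          ∃ (L : Matrix.GeneralLinearGroup (Fin 2) K) (a b : Fin n →₀ ℕ),
            C (L.1 0 0) * φ + C (L.1 0 1) * ψ = mono K a ∧
            C (L.1 1 0) * φ + C (L.1 1 1) * ψ = mono K b)) ∧
    -- the case of a pure power that is not a monomial
    (¬ IsMonomial P → IsPurePower P →
      ∀ S : Finset (Fin n →₀ ℕ), IsSite P S ↔
        Admissible P S ∧
        ((∃ (a b : Fin n →₀ ℕ) (h : MvPolynomial (Fin 2) K) (δ : ℕ),
            IsMaxHomDecomp P (mono K a) (mono K b) h δ ∧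
            ∀ e ∈ S, ∃ k ≤ δ, mono K e = mono K a ^ k * mono K b ^ (δ - k)) ∨
          (∃ (a : Fin n →₀ ℕ) (d : ℕ) (ψ : MvPolynomial (Fin n) K) (h : MvPolynomial (Fin 2) K),
            (∃ e, S = {e} ∧ mono K e = mono K a ^ d) ∧
            ¬ IsMonomial ψ ∧ IsMaxHomDecomp P (mono K a) ψ h d) ∨
          (∃ p : ℕ, p.Prime ∧ CharP K p ∧ InPowVars p P ∧
            ∀ e ∈ S, ∃ a : Fin n →₀ ℕ, mono K e = mono K a ^ p))) := by
  refine ⟨fun hmon hhom => ⟨?_, ?_⟩, fun hmon hpow => ⟨?_, fun hhom S => ?_⟩, ?_,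
    fun hmon _ S => isSite_iff_of_isPurePower hP hmon⟩
  · obtain ⟨a, b, δ, hab⟩ := hhom.exists_monomialForm hP
    obtain ⟨h, hh⟩ := (exists_isMaxHomDecomp_mono_iff hP).2 hab
    exact ⟨a, b, h, δ, hh⟩
  · intro a b a' b' h h' δ δ' hh hh'
    exact ((exists_isMaxHomDecomp_mono_iff hP).1 ⟨h, hh⟩).eq_or_eq hP hmon
      ((exists_isMaxHomDecomp_mono_iff hP).1 ⟨h', hh'⟩)
  · intro _ a b h δ hh S
    simp only [mono_eq_mul_iff]
    exact isSite_iff_of_monomialForm hP hmon hpow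
      ((exists_isMaxHomDecomp_mono_iff hP).1 ⟨h, hh⟩)
  · exact isSite_iff_of_not_homInTwoMonomials hP hpow hhom
  · rintro e₀ γ rfl S hS
    refine ⟨?_, fun φ ψ H d hH => ?_⟩
    · simp only [mono_eq_mul_iff, mono_eq_pow_iff]
      rw [hS.isReducible_monomial_iff hP, divCase_iff]
      simp only [mono, isRelPrime_monomial_iff]
    · obtain ⟨v, w, a, b, hdet, hv, hw⟩ :=
        hS.exists_lin_eq_monomial (monomial_coeff_ne_zero hP) hH.formIn
      refine ⟨Matrix.GeneralLinearGroup.mkOfDetNeZero !![v.1, v.2; w.1, w.2] ?_, a, b, ?_, ?_⟩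
      · rwa [Matrix.det_fin_two_of]
      · exact hv
      · exact hw
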